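/- **Setting.** A set system $\mathcal F\subseteq 2^U$ on a finite universe $U$ is *monotone* if $U\in\mathcal F$ and $\mathcal F$ is closed under supersets in $U$. A set $S\subseteq U$ is an *$\ell$-extension* of $X\subseteq U$ if $X\cup S\in\mathcal F$ and $|S|\le \ell$. For $\alpha\ge 1$, a *random $\alpha$-extension oracle* for $(U,\mathcal F)$ is a function $\mathcal O: 2^U\times\mathbb N\times\{0,1\}^m\to 2^U$ (for some $m\in\mathbb N$) such that $X\cup \mathcal O(X,\ell,r)\in\mathcal F$ for all $X,\ell,r$, and such that, whenever $X$ has an $\ell$-extension, $\mathcal O(X,\ell,r)$ is an $\alpha\ell$-extension of $X$ for at least half of the strings $r\in\{0,1\}^m$. A *specification list* is a non-empty finite set $\mathcal L$ of pairs $(\alpha,c)$ of real numbers with $\alpha,c\ge 1$. In the *$\mathcal L$-subset minimization problem* ($\mathcal L$-SUB), an algorithm is given $U$ and, for every $(\alpha,c)\in\mathcal L$, access to a random $\alpha$-extension oracle $\mathcal O_{\alpha,c}$ for $(U,\mathcal F)$, where $\mathcal F$ is a monotone set system which is not part of the input; the goal is to find $S\in\mathcal F$ of small size. Algorithms are randomized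 random access programs (with exact real arithmetic) which can query the oracles; each query uses a fresh uniformly random string $r$. The cost of an execution is the number of computational operations plus the sum of the costs of all queries, where a query $(X,\ell)$ to $\mathcal O_{\alpha,c}$ costs $c^{\ell}$. For an algorithm $\mathcal A$, $\mathrm{cost}_{\mathcal A}(n)$ is the maximal cost of an execution over all inputs with $|U|\le n$. The algorithm $\mathcal A$ is a *(randomized) $\beta$-approximation* for $\mathcal L$-SUB if, for all $U$, all monotone $\mathcal F$ and all such oracles, it returns a set $S\in\mathcal F$ with probability $1$, and $|S|\le\beta\cdot\min_{T\in\mathcal F}|T|$ with probability at least $\frac12$. Let $$\mathrm{best}(\mathcal L,\beta)=\inf\{d\ge 1 : \text{there is a } \beta\text{-approximation for } \mathcal L\text{-SUB of cost } d^n\cdot n^{O(1)}\}.$$ **The algorithm.** Let $p(n,k,t,x)=\sum_{y=\lceil x\rceil}^{\min\{t,k\}}\binom ky\binom{n-k}{t-y}/\binom nt$, $x_{\alpha,\beta}(k,t)=(1-\frac\beta\alpha)k+\frac t\alpha$, and let $M^*_{\alpha,\beta}=0$ if $\alpha\le\beta$ and $M^*_{\alpha,\beta}=\frac{\alpha-\beta}{\alpha-1}$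 if $\alpha>\beta$. The algorithm $\mathrm{AMLS}_{\mathcal L,\beta}$ does the following for every integer $k$ with $0\le k\le n/\beta$, where $n=|U|$. It finds $(\alpha,c)\in\mathcal L$ and an integer $t\in[M^*_{\alpha,\beta}k,\ \beta k]$ which minimize $c^{(\beta k-t)/\alpha}/p(n,k,t,x_{\alpha,\beta}(k,t))$. Then it repeats the following $2\lceil 1/p(n,k,t,x_{\alpha,\beta}(k,t))\rceil$ times: sample $X\subseteq U$ with $|X|=t$ uniformly at random, query $Y=\mathcal O_{\alpha,c}(X,\,k-\lceil x_{\alpha,\beta}(k,t)\rceil)$, and record $X\cup Y$. At the end it returns a recorded set of minimum size. **Theorem.** For every specification list $\mathcal L$ and every real $\beta\ge1$: 1. $\mathrm{AMLS}_{\mathcal L,\beta}$ is a randomized $\beta$-approximation for $\mathcal L$-SUB; 2. its cost is $n^{O(1)}\cdot\mathrm{best}(\mathcal L,\beta)^n$; 3. it is optimal up to polynomial factors: for every $\beta$-approximation $\mathcal A$ for $\mathcal L$-SUB, $\mathrm{cost}_{\mathrm{AMLS}_{\mathcal L,\beta}}(n)\le n^{O(1)}\cdot\mathrm{cost}_{\mathcal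 A}(n)$. The constants in $O(1)$ may depend on $\mathcal L$, $\beta$ and $\mathcal A$, but not on $n$ or on the instance. (Factors $n^{O(1)}$ are read as $C(n+1)^C$, so that $n=0,1$ are included.) -/

import Mathlib

open scoped ENNReal

noncomputable section

namespace SubsetMin

/-! ### Instances and extension oracles

A finite universe with `n` elements is encoded as `{0, …, n - 1}`, that is, as `Fin n`. -/

/-- A monotone set system: it contains the universe and is closed under supersets. -/
def IsMonotone {n : ℕ} (F : Set (Finset (Fin n))) : Prop :=
  Finset.univ ∈ F ∧ ∀ S T : Finset (Fin n), S ⊆ T → S ∈ F → T ∈ F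

/-- `S` is an `ℓ`-extension of `X` in the set system `F`. -/
def IsExtension {n : ℕ} (F : Set (Finset (Fin n))) (ℓ : ℝ) (X S : Finset (Fin n)) : Prop :=
  X ∪ S ∈ F ∧ (S.card : ℝ) ≤ ℓ

/-- The minimum cardinality of a member of `F`. -/
def minSize {n : ℕ} (F : Set (Finset (Fin n))) : ℕ :=
  sInf {m | ∃ S ∈ F, S.card = m}

/-- A function `2^U × ℕ × {0,1}^m → 2^U` for some `m`. -/
structure OracleFun (n : ℕ) where
  m : ℕ
  ans : Finset (Fin n) → ℕ → (Fin m → Bool) → Finset (Fin n)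

/-- `o` is a random `α`-extension oracle for `F`. -/
def IsExtensionOracle {n : ℕ} (F : Set (Finset (Fin n))) (α : ℝ) (o : OracleFun n) : Prop :=
  (∀ X ℓ r, o.ans X ℓ r ∪ X ∈ F) ∧
  ∀ (X : Finset (Fin n)) (ℓ : ℕ), (∃ S, IsExtension F (ℓ : ℝ) X S) →
    (1 / 2 : ℝ) * (Nat.card (Fin o.m → Bool) : ℝ) ≤
      (Nat.card {r : Fin o.m → Bool // IsExtension F (α * (ℓ : ℝ)) X (o.ans X ℓ r)} : ℝ)

/-- An oracle specification list: a non-empty finite set of pairs `(α, c)` with `α, c ≥ 1`.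
Here `α` is the approximation ratio of an oracle and `c ^ ℓ` the cost of a query `(X, ℓ)`. -/
def IsSpecList (L : Finset (ℝ × ℝ)) : Prop :=
  L.Nonempty ∧ ∀ p ∈ L, 1 ≤ p.1 ∧ 1 ≤ p.2

/-! ### The machine model

A random access machine with two memories, one for real numbers and one for subsets of the
universe, both with indirect addressing (a real number `a` addresses cell `⌊a⌋₊`).
It is programmed in a structured language with conditionals, `for` loops and unrestricted `while`
loops, random choices, and oracle queries.  Every operation on numbers costs `1`, every operation
on sets costs `n + 1`, where `n` is the size of the universe. -/

/-- The state of the machine; `cost` accumulates the cost of the execution so far. -/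
structure State (n : ℕ) where
  num : ℕ → ℝ
  set : ℕ → Finset (Fin n)
  cost : ℝ

namespace State

variable {n : ℕ}

/-- The initial state: all cells are zero or empty. -/
def init (n : ℕ) : State n := ⟨fun _ => 0, fun _ => ∅, 0⟩

def putNum (s : State n) (i : ℕ) (x : ℝ) : State n :=
  { s with num := Function.update s.num i x }

def putSet (s : State n) (i : ℕ) (X : Finset (Fin n)) : State n :=
  { s with set := Function.update s.set i X }

/-- Charge an amount `x` of cost. -/
def charge (s : State n) (x : ℝ) : State n := { s with cost := s.cost + x }

end State

/-- Numerical expressions. -/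
inductive NExp : Type
  | const (r : ℝ)
  | size
  | load (a : NExp)
  | card (a : NExp)
  | add (e f : NExp)
  | sub (e f : NExp)
  | mul (e f : NExp)
  | div (e f : NExp)
  | pow (e f : NExp)
  | min (e f : NExp)
  | max (e f : NExp)
  | ceil (e : NExp)
  | floor (e : NExp)
  | sum (i : ℕ) (lo hi e : NExp)
  | prod (i : ℕ) (lo hi e : NExp)

namespace NExp

/-- The value of an expression.  `size` is the size of the universe (the input of the machine),
`card a` is the size of the set in cell `a`.
In `sum i lo hi e` and `prod i lo hi e`, the number cell `i` serves as a bound variable, which runs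
through the integers in `[lo, hi]`. -/
def eval {n : ℕ} : NExp → State n → ℝ
  | const r, _ => r
  | size, _ => (n : ℝ)
  | load a, s => s.num ⌊a.eval s⌋₊
  | card a, s => ((s.set ⌊a.eval s⌋₊).card : ℝ)
  | add e f, s => e.eval s + f.eval s
  | sub e f, s => e.eval s - f.eval s
  | mul e f, s => e.eval s * f.eval s
  | div e f, s => e.eval s / f.eval s
  | pow e f, s => e.eval s ^ f.eval s
  | min e f, s => Min.min (e.eval s) (f.eval s)
  | max e f, s => Max.max (e.eval s) (f.eval s)
  | ceil e, s => (⌈e.eval s⌉ : ℝ)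
  | floor e, s => (⌊e.eval s⌋ : ℝ)
  | sum i lo hi e, s =>
      ∑ y ∈ Finset.Icc ⌈lo.eval s⌉ ⌊hi.eval s⌋, e.eval (s.putNum i (y : ℝ))
  | prod i lo hi e, s =>
      ∏ y ∈ Finset.Icc ⌈lo.eval s⌉ ⌊hi.eval s⌋, e.eval (s.putNum i (y : ℝ))

/-- The number of operations spent on evaluating an expression. -/
def ops {n : ℕ} : NExp → State n → ℝ
  | const _, _ => 1
  | size, _ => 1
  | load a, s => 1 + a.ops s
  | card a, s => ((n : ℝ) + 1) + a.ops s
  | add e f, s => 1 + e.ops s + f.ops s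
  | sub e f, s => 1 + e.ops s + f.ops s
  | mul e f, s => 1 + e.ops s + f.ops s
  | div e f, s => 1 + e.ops s + f.ops s
  | pow e f, s => 1 + e.ops s + f.ops s
  | min e f, s => 1 + e.ops s + f.ops s
  | max e f, s => 1 + e.ops s + f.ops s
  | ceil e, s => 1 + e.ops s
  | floor e, s => 1 + e.ops s
  | sum i lo hi e, s => 1 + lo.ops s + hi.ops s +
      ∑ y ∈ Finset.Icc ⌈lo.eval s⌉ ⌊hi.eval s⌋, (1 + e.ops (s.putNum i (y : ℝ)))
  | prod i lo hi e, s => 1 + lo.ops s + hi.ops s +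
      ∑ y ∈ Finset.Icc ⌈lo.eval s⌉ ⌊hi.eval s⌋, (1 + e.ops (s.putNum i (y : ℝ)))

/-- The content of the number cell with the fixed address `i`. -/
def reg (i : ℕ) : NExp := load (const (i : ℝ))

end NExp

/-- Set expressions. -/
inductive SExp : Type
  | empty
  | univ
  | load (a : NExp)
  | single (e : NExp)
  | union (S T : SExp)
  | inter (S T : SExp)
  | sdiff (S T : SExp)

namespace SExp

/-- The value of a set expression.  `single e` is the singleton of the element number `⌊e⌋₊` of
the universe (empty if there is no such element). -/
def eval {n : ℕ} : SExp → State n → Finset (Fin n)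
  | empty, _ => ∅
  | univ, _ => Finset.univ
  | load a, s => s.set ⌊a.eval s⌋₊
  | single e, s => Finset.univ.filter fun u : Fin n => (u : ℕ) = ⌊e.eval s⌋₊
  | union S T, s => S.eval s ∪ T.eval s
  | inter S T, s => S.eval s ∩ T.eval s
  | sdiff S T, s => S.eval s \ T.eval s

/-- The number of operations spent on evaluating a set expression. -/
def ops {n : ℕ} : SExp → State n → ℝ
  | empty, _ => (n : ℝ) + 1
  | univ, _ => (n : ℝ) + 1
  | load a, s => ((n : ℝ) + 1) + a.ops s
  | single e, s => ((n : ℝ) + 1) + e.ops s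
  | union S T, s => ((n : ℝ) + 1) + S.ops s + T.ops s
  | inter S T, s => ((n : ℝ) + 1) + S.ops s + T.ops s
  | sdiff S T, s => ((n : ℝ) + 1) + S.ops s + T.ops s

/-- The content of the set cell with the fixed address `i`. -/
def reg (i : ℕ) : SExp := load (NExp.const (i : ℝ))

end SExp

/-- Programs with access to oracles indexed by `ι`. -/
inductive Prog (ι : Type) : Type
  | skip
  /-- number cell `a` := `e` -/
  | setNum (a e : NExp)
  /-- set cell `a` := `S` -/
  | setSet (a : NExp) (S : SExp)
  /-- number cell `a` := a uniformly random element of `{0, …, ⌊m⌋₊ - 1}` -/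
  | randNum (a m : NExp)
  /-- set cell `a` := the singleton of a uniformly random element of `S` -/
  | randElem (a : NExp) (S : SExp)
  /-- set cell `a` := the answer of oracle `j` to the query `(X, ⌊ℓ⌋₊)` -/
  | query (j : ι) (a : NExp) (X : SExp) (ℓ : NExp)
  | seq (P Q : Prog ι)
  /-- if `e ≤ f` then `P` else `Q` -/
  | ifLe (e f : NExp) (P Q : Prog ι)
  /-- while `e ≤ f` do `P` -/
  | whileLe (e f : NExp) (P : Prog ι)
  /-- for `i` from `⌈lo⌉` to `⌊hi⌋` do `P`, where `lo`, `hi` are evaluated once, before the loop -/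
  | forDo (i : ℕ) (lo hi : NExp) (P : Prog ι)

/-! ### Executions

For a bound `fuel` on the number of iterations of `while` loops, the outcome of an execution is a
probability distribution on `Option (State n)`; the value `none` means that some `while` loop has
not ended after `fuel` iterations. -/

/-- Sequential composition of random computations. -/
def andThen {σ : Type} (p : PMF (Option σ)) (f : σ → PMF (Option σ)) : PMF (Option σ) :=
  p.bind fun o => o.elim (PMF.pure none) f

/-- At most `fuel` iterations of a loop; `test` performs the charge for a test of the condition. -/
def whileIter {σ : Type} (test : σ → σ) (cond : σ → Prop) [DecidablePred cond]
    (body : σ → PMF (Option σ)) : ℕ → σ → PMF (Option σ)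
  | 0, s => if cond s then PMF.pure none else PMF.pure (some (test s))
  | fuel + 1, s =>
      if cond s then andThen (body (test s)) (whileIter test cond body fuel)
      else PMF.pure (some (test s))

/-- Run `body 0`, `body 1`, …, `body (k - 1)` in this order. -/
def forIter {σ : Type} (body : ℕ → σ → PMF (Option σ)) : ℕ → σ → PMF (Option σ)
  | 0, s => PMF.pure (some s)
  | k + 1, s => andThen (forIter body k s) (body k)

/-- The uniform distribution on `S`, or the point mass at `d` if `S` is empty. -/
def uniformOr {τ : Type} (S : Finset τ) (d : τ) : PMF τ :=
  if h : S.Nonempty then PMF.uniformOfFinset S h else PMF.pure d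

/-- The distribution of the outcome of a program, run with the oracle functions `O`, where a query
`(X, ℓ)` to oracle `j` costs `c j ^ ℓ` and is answered with fresh uniformly random bits. -/
def exec {ι : Type} {n : ℕ} (c : ι → ℝ) (O : ι → OracleFun n) (fuel : ℕ) :
    Prog ι → State n → PMF (Option (State n))
  | .skip, s => PMF.pure (some (s.charge 1))
  | .setNum a e, s =>
      PMF.pure (some ((s.putNum ⌊a.eval s⌋₊ (e.eval s)).charge (1 + a.ops s + e.ops s)))
  | .setSet a S, s =>
      PMF.pure (some ((s.putSet ⌊a.eval s⌋₊ (S.eval s)).charge (1 + a.ops s + S.ops s)))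
  | .randNum a m, s =>
      (uniformOr (Finset.range ⌊m.eval s⌋₊) 0).map fun v =>
        some ((s.putNum ⌊a.eval s⌋₊ (v : ℝ)).charge (1 + a.ops s + m.ops s))
  | .randElem a S, s =>
      (uniformOr ((S.eval s).image fun u => ({u} : Finset (Fin n))) ∅).map fun X =>
        some ((s.putSet ⌊a.eval s⌋₊ X).charge (1 + a.ops s + S.ops s))
  | .query j a X ℓ, s =>
      (PMF.uniformOfFintype (Fin (O j).m → Bool)).map fun r =>
        some ((s.putSet ⌊a.eval s⌋₊ ((O j).ans (X.eval s) ⌊ℓ.eval s⌋₊ r)).charge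
          (1 + a.ops s + X.ops s + ℓ.ops s + c j ^ ⌊ℓ.eval s⌋₊))
  | .seq P Q, s => andThen (exec c O fuel P s) (exec c O fuel Q)
  | .ifLe e f P Q, s =>
      if e.eval s ≤ f.eval s then exec c O fuel P (s.charge (1 + e.ops s + f.ops s))
      else exec c O fuel Q (s.charge (1 + e.ops s + f.ops s))
  | .whileLe e f P, s =>
      whileIter (fun s => s.charge (1 + e.ops s + f.ops s)) (fun s => e.eval s ≤ f.eval s)
        (exec c O fuel P) fuel s
  | .forDo i lo hi P, s =>
      forIter
        (fun m s' => exec c O fuel P ((s'.putNum i ((⌈lo.eval s⌉ : ℝ) + (m : ℝ))).charge 1))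
        (⌊hi.eval s⌋ + 1 - ⌈lo.eval s⌉).toNat (s.charge (1 + lo.ops s + hi.ops s))

/-! ### Algorithms for the subset minimization problem -/

/-- Algorithms for `L`-subset minimization: the input is the size of the universe, there is one
oracle for each `(α, c) ∈ L`, and the output is the content of set cell `0` upon termination. -/
abbrev Algorithm (L : Finset (ℝ × ℝ)) : Type := Prog L

/-- The distribution of the outcome of an algorithm started in the initial state. -/
def Algorithm.run {L : Finset (ℝ × ℝ)} (A : Algorithm L) {n : ℕ} (O : L → OracleFun n)
    (fuel : ℕ) : PMF (Option (State n)) :=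
  exec (fun j => j.1.2) O fuel A (State.init n)

/-- The probability that the algorithm terminates and its output satisfies `p`. -/
def Algorithm.prob {L : Finset (ℝ × ℝ)} (A : Algorithm L) {n : ℕ} (O : L → OracleFun n)
    (p : Finset (Fin n) → Prop) : ℝ≥0∞ :=
  ⨆ fuel, (A.run O fuel).toOuterMeasure {o | ∃ s, o = some s ∧ p (s.set 0)}

/-- The maximal cost of an execution with given oracles: the number of operations plus the costs
of all oracle queries.  It is `∞` if there is an infinite execution. -/
def Algorithm.execCost {L : Finset (ℝ × ℝ)} (A : Algorithm L) {n : ℕ}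
    (O : L → OracleFun n) : ℝ≥0∞ :=
  ⨅ fuel, ⨆ o ∈ (A.run O fuel).support, o.elim ⊤ fun s => ENNReal.ofReal s.cost

/-- The maximal cost of an execution on an input whose universe has at most `N` elements. -/
def Algorithm.cost {L : Finset (ℝ × ℝ)} (A : Algorithm L) (N : ℕ) : ℝ≥0∞ :=
  ⨆ (n : ℕ) (_ : n ≤ N) (F : Set (Finset (Fin n))) (_ : IsMonotone F)
    (O : L → OracleFun n) (_ : ∀ j : L, IsExtensionOracle F j.1.1 (O j)), A.execCost O

/-- `A` is a randomized `β`-approximation for `L`-subset minimization. -/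
def Algorithm.IsApprox {L : Finset (ℝ × ℝ)} (A : Algorithm L) (β : ℝ) : Prop :=
  ∀ (n : ℕ) (F : Set (Finset (Fin n))), IsMonotone F →
    ∀ O : L → OracleFun n, (∀ j : L, IsExtensionOracle F j.1.1 (O j)) →
      A.prob O (fun S => S ∈ F) = 1 ∧
      1 / 2 ≤ A.prob O (fun S => (S.card : ℝ) ≤ β * (minSize F : ℝ))

/-- `A` is of cost `d ^ n * n ^ O(1)`. -/
def Algorithm.HasCostBase {L : Finset (ℝ × ℝ)} (A : Algorithm L) (d : ℝ) : Prop :=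
  ∃ C : ℕ, ∀ n : ℕ, A.cost n ≤ ENNReal.ofReal (C * ((n : ℝ) + 1) ^ C * d ^ n)

/-- `best(L, β)`, the optimal base of the cost of a `β`-approximation. -/
def best (L : Finset (ℝ × ℝ)) (β : ℝ) : ℝ :=
  sInf {d : ℝ | 1 ≤ d ∧ ∃ A : Algorithm L, A.IsApprox β ∧ A.HasCostBase d}

/-! ### Approximate monotone local search -/

/-- The constant `M*` bounding the sizes of the sampled sets from below. -/
def Mstar (α β : ℝ) : ℝ := if α ≤ β then 0 else (α - β) / (α - 1)

/-- `binom(a, b)` for integers `a, b ≥ 0`, as the product of `(a - b + i) / i` for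
`i = 1, …, b`. -/
def chooseE (a b : NExp) : NExp :=
  .prod 9 (.const 1) b (.div (.add (.sub a b) (.reg 9)) (.reg 9))

/-- `x(k, t) = (1 - β / α) k + t / α`. -/
def xE (α β : ℝ) (k t : NExp) : NExp :=
  .add (.mul (.const (1 - β / α)) k) (.div t (.const α))

/-- `p(n, k, t, x(k, t))`, where `p(n, k, t, x)` is the sum, for `y` from `⌈x⌉` to `min {t, k}`,
of `binom(k, y) binom(n - k, t - y) / binom(n, t)`; the terms with `y < 0` are zero. -/
def pE (α β : ℝ) (k t : NExp) : NExp :=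
  .sum 8 (.max (.ceil (xE α β k t)) (.const 0)) (.min t k)
    (.div (.mul (chooseE k (.reg 8)) (chooseE (.sub .size k) (.sub t (.reg 8))))
      (chooseE .size t))

/-- The quantity `c ^ ((β k - t) / α) / p(n, k, t, x(k, t))` to be minimized. -/
def objE (α c β : ℝ) (k t : NExp) : NExp :=
  .div (.pow (.const c) (.div (.sub (.mul (.const β) k) t) (.const α))) (pE α β k t)

/-- Sequential composition of a list of programs. -/
def seqs {ι : Type} : List (Prog ι) → Prog ι
  | [] => .skip
  | P :: Ps => .seq P (seqs Ps)

section AMLS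

variable {L : Finset (ℝ × ℝ)}

/-- Assignment to the number cell with the fixed address `i`. -/
def letNum (i : ℕ) (e : NExp) : Algorithm L := .setNum (.const (i : ℝ)) e

/-- Assignment to the set cell with the fixed address `i`. -/
def letSet (i : ℕ) (S : SExp) : Algorithm L := .setSet (.const (i : ℝ)) S

/-- Number cell `0` holds `k`.  This goes through all `t ∈ [M* k, β k] ∩ ℕ` (cell `1`) for the
oracle `j` with the number `m`.  Cells `3`, `4`, `5` hold the smallest value of the objective found
so far, the corresponding `t`, and the number of the corresponding oracle.  As the objective is
positive, the value `0` in cell `3` means that no value has been found. -/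
def scan (β : ℝ) (j : L) (m : ℕ) : Algorithm L :=
  .forDo 1 (.mul (.const (Mstar j.1.1 β)) (.reg 0)) (.mul (.const β) (.reg 0)) <|
    .seq (letNum 2 (objE j.1.1 j.1.2 β (.reg 0) (.reg 1))) <|
      .ifLe (.reg 3) (.const 0) (record m) <|
        .ifLe (.reg 3) (.reg 2) .skip (record m)
where
  record (m : ℕ) : Algorithm L :=
    seqs [letNum 3 (.reg 2), letNum 4 (.reg 1), letNum 5 (.const (m : ℝ))]

/-- The sampling procedure with `k` in number cell `0` and `t` in number cell `4`.  Set cell `1`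
receives a uniformly random set `X` with `t` elements, which are drawn one after the other without
replacement; set cell `2` receives first `Y`, the answer to the query, and then `Z = X ∪ Y`. -/
def sample (β : ℝ) (j : L) : Algorithm L :=
  seqs
    [ letSet 1 .empty,
      .forDo 6 (.const 1) (.reg 4) <|
        .seq (.randElem (.const 2) (.sdiff .univ (.reg 1))) (letSet 1 (.union (.reg 1) (.reg 2))),
      .query j (.const 2) (.reg 1) (.sub (.reg 0) (.ceil (xE j.1.1 β (.reg 0) (.reg 4)))),
      letSet 2 (.union (.reg 1) (.reg 2)) ]

/-- If the oracle `j` with the number `m` has been selected, then run the sampling procedure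
`2 ⌈1 / p⌉` times.  The smallest set found so far is kept in set cell `0`. -/
def sampling (β : ℝ) (j : L) (m : ℕ) : Algorithm L :=
  .ifLe (.reg 5) (.const (m : ℝ))
    (.ifLe (.const (m : ℝ)) (.reg 5)
      (.forDo 7 (.const 1)
        (.mul (.const 2) (.ceil (.div (.const 1) (pE j.1.1 β (.reg 0) (.reg 4))))) <|
        .seq (sample β j) <|
          .ifLe (.card (.const 2)) (.card (.const 0)) (letSet 0 (.reg 2)) .skip)
      .skip)
    .skip

/-- Approximate monotone local search.  The output cell is initialized with the universe, which is
replaced by the first set that is sampled. -/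
def amls (L : Finset (ℝ × ℝ)) (β : ℝ) : Algorithm L :=
  .seq (letSet 0 .univ) <|
    .forDo 0 (.const 0) (.div .size (.const β)) <|
      seqs
        [ letNum 3 (.const 0),
          seqs (L.attach.toList.zipIdx.map fun q => scan β q.1 q.2),
          seqs (L.attach.toList.zipIdx.map fun q => sampling β q.1 q.2) ]

end AMLS

end SubsetMin

end

open SubsetMin

namespace SubsetMin

open Finset

section

/-! ### Hypergeometric weights -/

/-! For fixed `k`, let Φ be the least value of `obj` over the oracles and the admissible `t`. Up to
polynomial factors, Φ is what it costs to repeat the best query until success is likely. The theorem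
follows from two matching estimates: the algorithm spends at most a polynomial times the largest Φ
over all `k`, and no approximation can spend less, up to a polynomial.

Upper estimate. Let K be an optimal solution with k elements. A uniform t-set X meets K in at least
⌈x⌉ elements with some probability p. Then K \ X is a legal extension for the query, so with
probability at least 1/2 the answer is short, and the union has at most t + (βk - t) = βk elements.
A round fails with probability at most 1 - p/2 (`expect_trial_fail_le`), so 2⌈1/p⌉ rounds fail with
probability at most 1/e, at a cost of order 1/p times the query cost (`runs_sampling_of_eq`).

Lower estimate. Hide a random k-set K in `hardFamily`. The oracles `adversary` depend on K only at
queries (X, l) with ⌊αl⌋ + |X| ≤ βk and |K \ X| ≤ l. If `HypBound` holds with value v, such a query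
is affected by at most a fraction poly · v · c^l of all K. A potential argument over executions
(`dominated_exec`) compares the runs with a reference run without hidden set and charges the number
of affected K to the cost of the reference run. Since an output of at most βk elements also contains
few of the sets K, this gives 1 ≤ poly · v · cost (`one_le_mul_cost`). Finally v = cmax / Φ is
possible (`hypBound_of_le_obj`), because every revealing query is dominated by one that the
algorithm considers. This settles the comparison with a single algorithm.

The base `best`. The polynomial in the cost of a competitor depends on the competitor, so the lower
estimate at n alone says nothing uniform. Passing from (n, k) to (nm, km) turns v into (poly(n)
v)^m, with a polynomial independent of m and of the competitor (`HypBound.mul`). Letting m tend to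
infinity eliminates the competitor's polynomial and leaves Φ ≤ poly(n) · d^n, a closed condition on
d, which therefore holds at the infimum. -/

lemma choose_mul_choose_le (a b i j : ℕ) :
    a.choose i * b.choose j ≤ (a + b).choose (i + j) := by
  rw [Nat.add_choose_eq]
  exact Finset.single_le_sum (f := fun ij : ℕ × ℕ => a.choose ij.1 * b.choose ij.2)
    (fun _ _ => Nat.zero_le _) (a := (i, j)) (by simp)

lemma choose_pow_le (a i m : ℕ) : a.choose i ^ m ≤ (a * m).choose (i * m) := by
  induction m with
  | zero => simp
  | succ m ih =>
    rw [pow_succ, Nat.mul_succ, Nat.mul_succ]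
    exact (Nat.mul_le_mul_right _ ih).trans (choose_mul_choose_le _ _ _ _)

lemma choose_succ_le (N a : ℕ) : N.choose (a + 1) ≤ (N + 1) * N.choose a := by
  have h := Nat.choose_succ_right_eq N a
  calc N.choose (a + 1) ≤ N.choose (a + 1) * (a + 1) := Nat.le_mul_of_pos_right _ (by omega)
    _ = N.choose a * (N - a) := h
    _ ≤ N.choose a * (N + 1) := Nat.mul_le_mul_left _ (by omega)
    _ = _ := mul_comm _ _

lemma choose_le_succ {N a : ℕ} (ha : a < N) : N.choose a ≤ (N + 1) * N.choose (a + 1) := by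
  have h := Nat.choose_succ_right_eq N a
  calc N.choose a ≤ N.choose a * (N - a) := Nat.le_mul_of_pos_right _ (by omega)
    _ = N.choose (a + 1) * (a + 1) := h.symm
    _ ≤ N.choose (a + 1) * (N + 1) := Nat.mul_le_mul_left _ (by omega)
    _ = _ := mul_comm _ _

/-- The probability that a uniformly random `t`-subset of an `n`-set meets a fixed `k`-subset in
exactly `i` elements, for `i ≤ t` and `k ≤ n`. -/
noncomputable def hyp (n k t i : ℕ) : ℝ :=
  (k.choose i : ℝ) * ((n - k).choose (t - i) : ℝ) / (n.choose t : ℝ)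

/-- The probability that the intersection has at least `y` elements. -/
noncomputable def tail (n k t y : ℕ) : ℝ := ∑ i ∈ Icc y (min t k), hyp n k t i

lemma hyp_nonneg (n k t i : ℕ) : 0 ≤ hyp n k t i := by unfold hyp; positivity

lemma hyp_le_of_nat {n k t i t' i' C : ℕ} (ht : t ≤ n) (ht' : t' ≤ n)
    (h : k.choose i * (n - k).choose (t - i) * n.choose t' ≤
      C * (k.choose i' * (n - k).choose (t' - i') * n.choose t)) :
    hyp n k t i ≤ C * hyp n k t' i' := by
  unfold hyp
  have h1 : (0 : ℝ) < n.choose t := by exact_mod_cast Nat.choose_pos ht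
  have h2 : (0 : ℝ) < n.choose t' := by exact_mod_cast Nat.choose_pos ht'
  rw [← mul_div_assoc, div_le_div_iff₀ h1 h2, mul_assoc (C : ℝ)]
  exact_mod_cast h

/-- One binomial coefficient in the numerator and the denominator each change to a neighbour, at a
price of at most `n + 1`. -/
lemma hyp_succ_le {n k u i : ℕ} (hi : i ≤ u) (hu : u + 1 ≤ n) :
    hyp n k (u + 1) i ≤ ((n + 1) ^ 2 : ℕ) * hyp n k u i := by
  apply hyp_le_of_nat hu (by omega)
  have e : u + 1 - i = (u - i) + 1 := by omega
  rw [e]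
  have h1 := choose_succ_le (n - k) (u - i)
  have h2 : n.choose u ≤ (n + 1) * n.choose (u + 1) := choose_le_succ (by omega)
  have h1' : (n - k).choose (u - i + 1) ≤ (n + 1) * (n - k).choose (u - i) :=
    h1.trans (Nat.mul_le_mul_right _ (by omega))
  calc _ ≤ k.choose i * ((n + 1) * (n - k).choose (u - i)) * ((n + 1) * n.choose (u + 1)) := by
        gcongr
    _ = _ := by ring

lemma hyp_diag_succ_le {n k t : ℕ} (ht : t < k) (hk : k ≤ n) :
    hyp n k t t ≤ ((n + 1) ^ 2 : ℕ) * hyp n k (t + 1) (t + 1) := by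
  apply hyp_le_of_nat (by omega) (by omega)
  simp only [Nat.sub_self, Nat.choose_zero_right, mul_one]
  have h1 : k.choose t ≤ (n + 1) * k.choose (t + 1) :=
    (choose_le_succ ht).trans (Nat.mul_le_mul_right _ (by omega))
  have h2 := choose_succ_le n t
  calc _ ≤ ((n + 1) * k.choose (t + 1)) * ((n + 1) * n.choose t) := by gcongr
    _ = _ := by ring

lemma hyp_diag_add_le {n k t : ℕ} (hk : k ≤ n) (s : ℕ) (hs : t + s ≤ k) :
    hyp n k t t ≤ ((n + 1) ^ (2 * s) : ℕ) * hyp n k (t + s) (t + s) := by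
  induction s with
  | zero => simp
  | succ s ih =>
    have h1 := ih (by omega)
    have h2 := hyp_diag_succ_le (n := n) (k := k) (t := t + s) (by omega) hk
    calc _ ≤ ((n + 1) ^ (2 * s) : ℕ) * hyp n k (t + s) (t + s) := h1
      _ ≤ ((n + 1) ^ (2 * s) : ℕ) * (((n + 1) ^ 2 : ℕ) * hyp n k (t + s + 1) (t + s + 1)) := by
        gcongr
      _ = _ := by push_cast; ring_nf

/-- A violation of `α (k - i) + t ≤ β k` by less than one can be repaired at the price of a
polynomial factor. -/
lemma exists_hyp_le_of_lt {α β : ℝ} {S : ℕ} (hα : 1 ≤ α) (hβ : 1 ≤ β)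
    (hS : α = 1 ∨ 1 ≤ (α - 1) * S) {n k t i : ℕ} (hk : k ≤ n) (hik : i ≤ k) (hit : i ≤ t)
    (htn : t ≤ n) (h : α * ((k - i : ℕ) : ℝ) + t < β * k + 1) :
    ∃ t' i', i ≤ i' ∧ i' ≤ k ∧ i' ≤ t' ∧ t' ≤ n ∧ α * ((k - i' : ℕ) : ℝ) + t' ≤ β * k ∧
      hyp n k t i ≤ ((n + 1) ^ (2 * (S + 1)) : ℕ) * hyp n k t' i' := by
  have hmono : ∀ {a b : ℕ} {x : ℝ}, a ≤ b → 0 ≤ x →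
      (((n + 1) ^ a : ℕ) : ℝ) * x ≤ ((n + 1) ^ b : ℕ) * x := by
    intro a b x hab hx
    have : (n + 1) ^ a ≤ (n + 1) ^ b := Nat.pow_le_pow_right (by omega) hab
    have : (((n + 1) ^ a : ℕ) : ℝ) ≤ ((n + 1) ^ b : ℕ) := by exact_mod_cast this
    gcongr
  rcases Nat.lt_or_ge i t with hlt | hge
  -- The sample has an element outside the fixed set to spare. Dropping it lowers the constraint by
  -- exactly one and leaves `i` alone.
  · obtain ⟨u, rfl⟩ : ∃ u, t = u + 1 := ⟨t - 1, by omega⟩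
    refine ⟨u, i, le_rfl, hik, by omega, by omega, ?_, ?_⟩
    · push_cast at h; linarith
    · exact (hyp_succ_le (by omega) htn).trans (hmono (by omega) (hyp_nonneg _ _ _ _))
  · obtain rfl : i = t := le_antisymm hit hge
    -- Now the sample lies inside the fixed set, so `t` and `i` must grow together. Each step gains
    -- `α - 1`, so `S` steps gain one. If `i` reaches `k` earlier, or if `α = 1`, the constraint
    -- reads `k ≤ β * k`.
    set s := min (k - i) S with hs
    have hsk : i + s ≤ k := by omega
    refine ⟨i + s, i + s, by omega, hsk, le_rfl, by omega, ?_,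
      (hyp_diag_add_le hk s hsk).trans (hmono (by omega) (hyp_nonneg _ _ _ _))⟩
    rw [Nat.cast_sub hsk]
    rw [Nat.cast_sub hik] at h
    push_cast
    have hk0 : (0 : ℝ) ≤ k := Nat.cast_nonneg k
    rcases hS with rfl | hS
    · nlinarith
    · rcases le_total (k - i) S with h1 | h1
      · have : s = k - i := by omega
        have : i + s = k := by omega
        have : (i : ℝ) + s = k := by exact_mod_cast this
        nlinarith
      · have : s = S := by omega
        rw [this]
        nlinarith

/-- `v` bounds the probability of success per cost of all queries that have to be answered
helpfully. -/
def HypBound (L : Finset (ℝ × ℝ)) (β : ℝ) (n k : ℕ) (v : ℝ) : Prop :=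
  ∀ j ∈ L, ∀ t i : ℕ, i ≤ k → i ≤ t → t ≤ n → j.1 * ((k - i : ℕ) : ℝ) + t ≤ β * k →
    hyp n k t i ≤ v * j.2 ^ (k - i)

/-- Tolerance for rounding: the repair of the constraint never lowers `i`, so the power of the query
cost does not grow, and only a polynomial factor is lost. -/
lemma HypBound.of_lt {L : Finset (ℝ × ℝ)} (hL : IsSpecList L) {β : ℝ} (hβ : 1 ≤ β) {S : ℕ}
    (hS : ∀ j ∈ L, j.1 = 1 ∨ 1 ≤ (j.1 - 1) * S) {n k : ℕ} {v : ℝ} (hv : 0 ≤ v) (hk : k ≤ n)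
    (H : HypBound L β n k v) {j : ℝ × ℝ} (hj : j ∈ L) {t i : ℕ} (hik : i ≤ k) (hit : i ≤ t)
    (htn : t ≤ n) (h : j.1 * ((k - i : ℕ) : ℝ) + t < β * k + 1) :
    hyp n k t i ≤ ((n + 1) ^ (2 * (S + 1)) : ℕ) * v * j.2 ^ (k - i) := by
  obtain ⟨t', i', h1, h2, h3, h4, h5, h6⟩ :=
    exists_hyp_le_of_lt (hL.2 j hj).1 hβ (hS j hj) hk hik hit htn h
  have h7 := H j hj t' i' h2 h3 h4 h5
  have h8 : j.2 ^ (k - i') ≤ j.2 ^ (k - i) := pow_le_pow_right₀ (hL.2 j hj).2 (by omega)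
  calc _ ≤ _ := h6
    _ ≤ ((n + 1) ^ (2 * (S + 1)) : ℕ) * (v * j.2 ^ (k - i)) := by
      gcongr; exact h7.trans (by gcongr)
    _ = _ := by ring

/-- One `S` for the whole list, so that the degrees of all later polynomials depend on `L` only. -/
lemma exists_slack (L : Finset (ℝ × ℝ)) (hL : IsSpecList L) :
    ∃ S : ℕ, ∀ j ∈ L, j.1 = 1 ∨ 1 ≤ (j.1 - 1) * S := by
  refine ⟨∑ j ∈ L, ⌈1 / (j.1 - 1)⌉₊, fun j hj => ?_⟩
  rcases eq_or_lt_of_le (hL.2 j hj).1 with h | h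
  · exact Or.inl h.symm
  · right
    have h1 : ⌈1 / (j.1 - 1)⌉₊ ≤ ∑ j ∈ L, ⌈1 / (j.1 - 1)⌉₊ :=
      Finset.single_le_sum (f := fun j : ℝ × ℝ => ⌈1 / (j.1 - 1)⌉₊) (fun _ _ => Nat.zero_le _) hj
    have h2 : 1 / (j.1 - 1) ≤ ((∑ j ∈ L, ⌈1 / (j.1 - 1)⌉₊ : ℕ) : ℝ) :=
      (Nat.le_ceil _).trans (by exact_mod_cast h1)
    rw [div_le_iff₀ (by linarith)] at h2
    linarith

/-! ### Binomial coefficients of multiples -/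

/-- Consecutive terms have ratio x(k - i)/(i + 1), which decreases in i, and this x = (a + 1/2)/(k -
a + 1/2) makes it cross one at `a`. The halves keep x positive and finite also for `a = 0` and `a =
k`. -/
lemma choose_mul_pow_le {k a : ℕ} (ha : a ≤ k) {x : ℝ}
    (hx : x = (2 * a + 1) / (2 * (k - a : ℕ) + 1)) (i : ℕ) :
    (k.choose i : ℝ) * x ^ i ≤ k.choose a * x ^ a := by
  have hx0 : 0 < x := by rw [hx]; positivity
  have key : ∀ i, i < k → (k.choose (i + 1) : ℝ) * (i + 1) = k.choose i * ((k : ℝ) - i) := by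
    intro i hi
    have := Nat.choose_succ_right_eq k i
    rw [← Nat.cast_sub hi.le]
    exact_mod_cast this
  have hxe : x * (2 * ((k : ℝ) - a) + 1) = 2 * a + 1 := by
    rw [hx, ← Nat.cast_sub ha]; field_simp
  have hak : (a : ℝ) ≤ k := by exact_mod_cast ha
  rcases le_total a i with h | h
  · induction i, h using Nat.le_induction with
    | base => exact le_rfl
    | succ i hai ih =>
      refine le_trans ?_ ih
      rcases Nat.lt_or_ge i k with hik | hik
      · have h1 := key i hik
        have hai' : (a : ℝ) ≤ i := by exact_mod_cast hai
        have hik' : (i : ℝ) + 1 ≤ k := by exact_mod_cast hik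
        have h2 : x * ((k : ℝ) - i) ≤ i + 1 := by nlinarith
        have h3 : (k.choose (i + 1) : ℝ) * x ≤ k.choose i := by
          have : (k.choose (i + 1) : ℝ) * x * (i + 1) ≤ k.choose i * (i + 1) := by
            calc _ = (k.choose i : ℝ) * (x * (k - i)) := by rw [mul_right_comm, h1]; ring
              _ ≤ _ := by gcongr
          exact le_of_mul_le_mul_right this (by positivity)
        calc _ = (k.choose (i + 1) : ℝ) * x * x ^ i := by ring
          _ ≤ _ := by gcongr
      · rw [Nat.choose_eq_zero_of_lt (by omega)]
        simp only [Nat.cast_zero, zero_mul]; positivity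
  · induction h using Nat.decreasingInduction with
    | self => exact le_rfl
    | of_succ i hia ih =>
      refine le_trans ?_ ih
      have h1 := key i (by omega)
      have hai' : (i : ℝ) + 1 ≤ a := by exact_mod_cast hia
      have h2 : (i : ℝ) + 1 ≤ x * ((k : ℝ) - i) := by nlinarith
      have h3 : (k.choose i : ℝ) ≤ k.choose (i + 1) * x := by
        have : (k.choose i : ℝ) * (i + 1) ≤ k.choose (i + 1) * x * (i + 1) := by
          calc _ ≤ (k.choose i : ℝ) * (x * (k - i)) := by gcongr
            _ = _ := by rw [mul_right_comm, h1]; ring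
        exact le_of_mul_le_mul_right this (by positivity)
      calc _ ≤ (k.choose (i + 1) : ℝ) * x * x ^ i := by gcongr
        _ = _ := by ring

/-- A single term of the expansion of (1 + x)^(km) is at most the m-th power of (1 + x)^k, which in
turn is at most `k + 1` times its largest term, the one at `a`. As `y` and `a * m` differ by at most
`m` and x lies between 1/(2k + 1) and 2k + 1, exchanging x^(am) for x^y costs at most (2k + 1)^m. -/
lemma choose_mul_le_pow {k a y m : ℕ} (ha : a ≤ k) (h1 : a * m ≤ y + m) (h2 : y ≤ a * m + m) :
    ((k * m).choose y : ℝ) ≤ ((k + 1) * (2 * k + 1) * k.choose a) ^ m := by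
  set x : ℝ := (2 * a + 1) / (2 * (k - a : ℕ) + 1) with hx
  have hx0 : 0 < x := by rw [hx]; positivity
  have hak : (a : ℝ) ≤ k := by exact_mod_cast ha
  have hxu : x ≤ 2 * k + 1 := by
    rw [hx, div_le_iff₀ (by positivity), Nat.cast_sub ha]; nlinarith
  have hxl : 1 ≤ x * (2 * k + 1) := by
    rw [hx, div_mul_eq_mul_div, le_div_iff₀ (by positivity), Nat.cast_sub ha]; nlinarith
  have hgen : (1 + x) ^ k ≤ (k + 1) * (k.choose a * x ^ a) := by
    rw [add_comm, add_pow]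
    calc _ ≤ ∑ i ∈ range (k + 1), (k.choose a : ℝ) * x ^ a := by
          refine sum_le_sum fun i _ => ?_
          have := choose_mul_pow_le ha hx i
          simpa [mul_comm] using this
      _ = _ := by simp
  have hgen2 : ((k * m).choose y : ℝ) * x ^ y ≤ (1 + x) ^ (k * m) := by
    rcases le_or_gt y (k * m) with hy | hy
    · rw [add_comm, add_pow]
      have := Finset.single_le_sum (s := range (k * m + 1))
        (f := fun i => x ^ i * 1 ^ (k * m - i) * ((k * m).choose i : ℝ))
        (fun i _ => by positivity) (a := y) (by simp; omega)
      simpa [mul_comm] using this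
    · rw [Nat.choose_eq_zero_of_lt hy]; simp; positivity
  have h3 : ((k * m).choose y : ℝ) * x ^ y ≤ ((k + 1) * k.choose a) ^ m * x ^ (a * m) := by
    refine hgen2.trans ?_
    rw [pow_mul]
    calc _ ≤ ((k + 1) * (k.choose a * x ^ a)) ^ m := by gcongr
      _ = _ := by rw [← mul_assoc, mul_pow, pow_mul]
  have h4 : x ^ (a * m) ≤ (2 * k + 1) ^ m * x ^ y := by
    rcases le_total (a * m) y with h | h
    · obtain ⟨r, rfl⟩ := Nat.exists_eq_add_of_le h
      have hr : r ≤ m := by omega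
      rw [pow_add]
      have : 1 ≤ (2 * (k : ℝ) + 1) ^ m * x ^ r := by
        calc (1 : ℝ) ≤ (x * (2 * k + 1)) ^ r := one_le_pow₀ hxl
          _ = (2 * k + 1) ^ r * x ^ r := by rw [mul_pow, mul_comm]
          _ ≤ _ := by
            gcongr
            · have := Nat.cast_nonneg (α := ℝ) k; linarith
      nlinarith [pow_pos hx0 (a * m)]
    · obtain ⟨r, hr⟩ := Nat.exists_eq_add_of_le h
      have hrm : r ≤ m := by omega
      rw [hr, pow_add, mul_comm]
      gcongr
      calc x ^ r ≤ (2 * k + 1) ^ r := by gcongr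
        _ ≤ _ := by
          gcongr
          · have := Nat.cast_nonneg (α := ℝ) k; linarith
  have h5 : ((k * m).choose y : ℝ) * x ^ y ≤
      ((k + 1) * (2 * k + 1) * k.choose a) ^ m * x ^ y := by
    refine h3.trans ?_
    calc _ ≤ ((k + 1) * (k.choose a : ℝ)) ^ m * ((2 * k + 1) ^ m * x ^ y) := by gcongr
      _ = _ := by rw [mul_pow, mul_pow, mul_pow]; ring
  exact le_of_mul_le_mul_right h5 (by positivity)

/-- Write `t'` as a sum of `m` integers, each equal to `t` or to one fixed neighbour `u` of `t`.
Replacing `t` by `u` costs `n + 1` per summand, and Vandermonde merges the `m` binomial coefficients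
into one. -/
lemma choose_pow_le_mul {n t t' m : ℕ} (ht : t ≤ n) (ht' : t' ≤ n * m) (h1 : t * m ≤ t' + m)
    (h2 : t' ≤ t * m + m) :
    n.choose t ^ m ≤ (n + 1) ^ m * (n * m).choose t' := by
  have aux : ∀ u r : ℕ, r ≤ m → n.choose t ≤ (n + 1) * n.choose u →
      n.choose t ^ m ≤ (n + 1) ^ m * (n * m).choose (t * (m - r) + u * r) := by
    intro u r hr hu
    calc n.choose t ^ m = n.choose t ^ (m - r) * n.choose t ^ r := by
          rw [← pow_add]; congr 1; omega
      _ ≤ n.choose t ^ (m - r) * ((n + 1) * n.choose u) ^ r := by gcongr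
      _ = (n + 1) ^ r * (n.choose t ^ (m - r) * n.choose u ^ r) := by rw [mul_pow]; ring
      _ ≤ (n + 1) ^ m * (n * m).choose (t * (m - r) + u * r) := by
        gcongr ?_ * ?_
        · exact Nat.pow_le_pow_right (by omega) hr
        · calc _ ≤ (n * (m - r)).choose (t * (m - r)) * (n * r).choose (u * r) :=
              Nat.mul_le_mul (choose_pow_le _ _ _) (choose_pow_le _ _ _)
            _ ≤ (n * (m - r) + n * r).choose (t * (m - r) + u * r) := choose_mul_choose_le _ _ _ _
            _ = _ := by rw [← mul_add]; congr 2; omega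
  rcases lt_trichotomy (t * m) t' with h | h | h
  · have htn : t < n := by
      by_contra hc
      have : t = n := by omega
      subst this; omega
    have := aux (t + 1) (t' - t * m) (by omega) (choose_le_succ htn)
    convert this using 3
    have hz : t' - t * m ≤ m := by omega
    zify [hz, h.le]; ring
  · have := aux t 0 (by omega) (Nat.le_mul_of_pos_left _ (by omega))
    convert this using 3
    simp [h]
  · obtain ⟨u, rfl⟩ : ∃ u, t = u + 1 := ⟨t - 1, by
      rcases Nat.eq_zero_or_pos t with h0 | h0
      · subst h0; omega
      · omega⟩
    have := aux u ((u + 1) * m - t') (by omega) (choose_succ_le n u)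
    convert this using 3
    have hz : (u + 1) * m - t' ≤ m := by omega
    zify [hz, h.le]; ring

end

/-! ### Scaling an instance by a factor -/

section

/-- The two parts of the sample are rounded in opposite directions: up inside the fixed set, so that
the query does not become longer, and down outside, so that the sample exceeds `t' / m` by less than
one. Each numerator coefficient contributes `2 * (n + 1) ^ 2` and the denominator `n + 1`. -/
lemma hyp_mul_le_pow {n k t' i' m : ℕ} (hm : 0 < m) (hk : k ≤ n) (hi : i' ≤ t')
    (hik : i' ≤ k * m) (htn : t' ≤ n * m) (hb : t' - i' ≤ (n - k) * m) :
    ∃ t a, a ≤ k ∧ a ≤ t ∧ t ≤ n ∧ i' ≤ a * m ∧ t * m < t' + m ∧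
      hyp (n * m) (k * m) t' i' ≤ ((4 * (n + 1) ^ 5 : ℕ) * hyp n k t a) ^ m := by
  set a := (i' + (m - 1)) / m with ha
  set b := (t' - i') / m with hbdef
  have h1 : i' ≤ a * m := by
    have := Nat.lt_div_mul_add (a := i' + (m - 1)) hm; rw [← ha] at this; omega
  have h2 : a * m ≤ i' + (m - 1) := Nat.div_mul_le_self _ _
  have h3 : b * m ≤ t' - i' := Nat.div_mul_le_self _ _
  have h4 : t' - i' < b * m + m := Nat.lt_div_mul_add hm
  have hak : a ≤ k := by
    have : a * m < (k + 1) * m := by rw [Nat.succ_mul]; omega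
    exact Nat.lt_succ_iff.mp (Nat.lt_of_mul_lt_mul_right this)
  have hbk : b ≤ n - k := Nat.le_of_mul_le_mul_right (h3.trans hb) hm
  have e : (a + b) * m = a * m + b * m := add_mul _ _ _
  clear_value a b
  refine ⟨a + b, a, hak, by omega, by omega, h1, by omega, ?_⟩
  have u1 := choose_mul_le_pow (k := k) (a := a) (y := i') (m := m) hak (by omega) (by omega)
  have u2 := choose_mul_le_pow (k := n - k) (a := b) (y := t' - i') (m := m) hbk
    (by omega) (by omega)
  have u3 := choose_pow_le_mul (n := n) (t := a + b) (t' := t') (m := m) (by omega) htn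
    (by omega) (by omega)
  have u3' : (n.choose (a + b) : ℝ) ^ m ≤ (n + 1) ^ m * (n * m).choose t' := by exact_mod_cast u3
  have p1 : (0 : ℝ) < n.choose (a + b) := by exact_mod_cast Nat.choose_pos (by omega)
  have p2 : (0 : ℝ) < (n * m).choose t' := by exact_mod_cast Nat.choose_pos htn
  unfold hyp
  rw [← Nat.sub_mul, Nat.add_sub_cancel_left, ← mul_div_assoc, div_pow, div_le_div_iff₀ p2
    (by positivity)]
  have hkn : (k : ℝ) ≤ n := by exact_mod_cast hk
  have hkn' : ((n - k : ℕ) : ℝ) ≤ n := by exact_mod_cast Nat.sub_le _ _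
  have hn : (0 : ℝ) ≤ n := Nat.cast_nonneg n
  have v1 : ((k : ℝ) + 1) * (2 * k + 1) ≤ 2 * (n + 1) ^ 2 := by
    have := Nat.cast_nonneg (α := ℝ) k; nlinarith
  have v2 : (((n - k : ℕ) : ℝ) + 1) * (2 * (n - k : ℕ) + 1) ≤ 2 * (n + 1) ^ 2 := by
    have := Nat.cast_nonneg (α := ℝ) (n - k); nlinarith
  calc _ ≤ ((2 * (n + 1) ^ 2) * (k.choose a : ℝ)) ^ m * ((2 * (n + 1) ^ 2) * (n - k).choose b) ^ m
        * ((n + 1) ^ m * (n * m).choose t') := by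
        gcongr ?_ * ?_ * ?_
        · exact u1.trans (by gcongr)
        · exact u2.trans (by gcongr)
    _ = _ := by
        simp only [← mul_pow, ← mul_assoc]
        congr 2
        push_cast
        ring

/-- A weight of the scaled instance is at most the m-th power of an original one, up to constants.
Rounding may break the constraint by less than one, which `HypBound.of_lt` absorbs. The factor in
front of `v` is free of `m`, which is what matters in the limit. -/
lemma HypBound.mul {L : Finset (ℝ × ℝ)} (hL : IsSpecList L) {β : ℝ} (hβ : 1 ≤ β) {S : ℕ}
    (hS : ∀ j ∈ L, j.1 = 1 ∨ 1 ≤ (j.1 - 1) * S) {n k : ℕ} {v : ℝ} (hv : 0 ≤ v) (hk : k ≤ n)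
    (H : HypBound L β n k v) {m : ℕ} (hm : 0 < m) :
    HypBound L β (n * m) (k * m)
      (((4 * (n + 1) ^ 5 * (n + 1) ^ (2 * (S + 1)) : ℕ) * v) ^ m) := by
  intro j hj t' i' hik hit htn h
  have hc := (hL.2 j hj).2
  have hc0 : 0 ≤ j.2 := by linarith
  by_cases hb : t' - i' ≤ (n - k) * m
  · obtain ⟨t, a, h1, h2, h3, h4, h5, h6⟩ := hyp_mul_le_pow hm hk hit hik htn hb
    have hm' : (0 : ℝ) < m := by exact_mod_cast hm
    have hlt : j.1 * ((k - a : ℕ) : ℝ) + t < β * k + 1 := by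
      have e4 : (i' : ℝ) ≤ a * m := by exact_mod_cast h4
      have e5 : (t : ℝ) * m < t' + m := by exact_mod_cast h5
      rw [Nat.cast_sub hik] at h
      rw [Nat.cast_sub h1]
      push_cast at h
      have hα := (hL.2 j hj).1
      have : (j.1 * ((k : ℝ) - a) + t) * m < (β * k + 1) * m := by nlinarith
      exact lt_of_mul_lt_mul_right this hm'.le
    have h7 := H.of_lt hL hβ hS hv hk hj h1 h2 h3 hlt
    have h8 : (j.2 ^ (k - a)) ^ m ≤ j.2 ^ (k * m - i') := by
      rw [← pow_mul]
      apply pow_le_pow_right₀ hc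
      rw [Nat.sub_mul]; omega
    calc _ ≤ _ := h6
      _ ≤ ((4 * (n + 1) ^ 5 : ℕ) * (((n + 1) ^ (2 * (S + 1)) : ℕ) * v * j.2 ^ (k - a))) ^ m := by
        have := hyp_nonneg n k t a
        gcongr
      _ = ((4 * (n + 1) ^ 5 * (n + 1) ^ (2 * (S + 1)) : ℕ) * v) ^ m * (j.2 ^ (k - a)) ^ m := by
        rw [← mul_pow]; push_cast; ring
      _ ≤ _ := by gcongr
  -- More elements are required outside the fixed set than there are.
  · have : hyp (n * m) (k * m) t' i' = 0 := by
      unfold hyp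
      rw [← Nat.sub_mul, Nat.choose_eq_zero_of_lt (not_le.mp hb)]; simp
    rw [this]; positivity

/-! ### Counting sets by the size of an intersection -/

section Count

variable {n : ℕ}

/-- The parts of a set inside and outside `X` are chosen independently. -/
lemma card_filter_card_inter_eq (X : Finset (Fin n)) (k i : ℕ) (hi : i ≤ k) :
    #{K ∈ powersetCard k (univ : Finset (Fin n)) | #(K ∩ X) = i} =
      (#X).choose i * (n - #X).choose (k - i) := by
  have hc : n - #X = #Xᶜ := by simp [card_compl]
  rw [hc, ← card_powersetCard i X, ← card_powersetCard (k - i) Xᶜ, ← card_product]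
  refine card_bij' (fun K _ => (K ∩ X, K \ X)) (fun p _ => p.1 ∪ p.2) ?_ ?_ ?_ ?_
  · intro K hK
    simp only [mem_filter, mem_powersetCard, subset_univ, true_and] at hK
    simp only [mem_product, mem_powersetCard, inter_subset_right, true_and]
    refine ⟨hK.2, fun x hx => by simp at hx ⊢; exact hx.2, ?_⟩
    have := card_inter_add_card_sdiff K X
    omega
  · rintro ⟨A, B⟩ hp
    simp only [mem_product, mem_powersetCard] at hp
    obtain ⟨⟨hA, hAc⟩, hB, hBc⟩ := hp
    have hBX : Disjoint B X := disjoint_left.mpr fun x hx => by simpa using hB hx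
    simp only [mem_filter, mem_powersetCard, subset_univ, true_and]
    have hd : Disjoint A B := (hBX.mono_right hA).symm
    refine ⟨by rw [card_union_of_disjoint hd]; omega, ?_⟩
    rw [union_inter_distrib_right, disjoint_iff_inter_eq_empty.mp hBX, union_empty,
      inter_eq_left.mpr hA, hAc]
  · intro K _
    rw [union_comm]; exact sdiff_union_inter K X
  · rintro ⟨A, B⟩ hp
    simp only [mem_product, mem_powersetCard] at hp
    obtain ⟨⟨hA, hAc⟩, hB, hBc⟩ := hp
    have hBX : Disjoint B X := disjoint_left.mpr fun x hx => by simpa using hB hx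
    have e1 : (A ∪ B) ∩ X = A := by
      rw [union_inter_distrib_right, disjoint_iff_inter_eq_empty.mp hBX, union_empty,
        inter_eq_left.mpr hA]
    have e2 : (A ∪ B) \ X = B := by
      rw [union_sdiff_distrib, sdiff_eq_empty_iff_subset.mpr hA, empty_union,
        sdiff_eq_self_of_disjoint hBX]
    simp only [e1, e2]

/-- Here `X` is fixed and `K` varies, so `#X` takes the slot of the fixed set in `tail`. `tail_comm`
switches to the view with a fixed solution and a random sample. -/
lemma card_filter_le_card_inter (X : Finset (Fin n)) {k : ℕ} (hk : k ≤ n) (y : ℕ) :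
    (#{K ∈ powersetCard k (univ : Finset (Fin n)) | y ≤ #(K ∩ X)} : ℝ) =
      n.choose k * tail n (#X) k y := by
  have hmaps : ∀ K ∈ {K ∈ powersetCard k (univ : Finset (Fin n)) | y ≤ #(K ∩ X)},
      #(K ∩ X) ∈ Icc y (min k #X) := by
    intro K hK
    simp only [mem_filter, mem_powersetCard, subset_univ, true_and] at hK
    rw [mem_Icc, le_min_iff]
    exact ⟨hK.2, (card_le_card inter_subset_left).trans hK.1.le, card_le_card inter_subset_right⟩
  rw [card_eq_sum_card_fiberwise hmaps, tail, mul_sum, Nat.cast_sum]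
  refine sum_congr rfl fun i hi => ?_
  rw [mem_Icc, le_min_iff] at hi
  have : {K ∈ {K ∈ powersetCard k (univ : Finset (Fin n)) | y ≤ #(K ∩ X)} | #(K ∩ X) = i} =
      {K ∈ powersetCard k (univ : Finset (Fin n)) | #(K ∩ X) = i} := by
    rw [filter_filter]
    exact filter_congr fun K _ => ⟨fun h => h.2, fun h => ⟨h ▸ hi.1, h⟩⟩
  rw [this, card_filter_card_inter_eq _ _ _ hi.2.1, hyp]
  have : (n.choose k : ℝ) ≠ 0 := by exact_mod_cast (Nat.choose_pos hk).ne'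
  push_cast
  field_simp

end Count

lemma exists_finset_card_eq {n k : ℕ} (hk : k ≤ n) : ∃ K : Finset (Fin n), #K = k := by
  obtain ⟨K, _, hK⟩ := exists_subset_card_eq (s := (univ : Finset (Fin n))) (n := k) (by simpa)
  exact ⟨K, hK⟩

/-- Double counting of the pairs of a k-set and a t-set that meet in `i` elements. -/
lemma hyp_comm {n k t i : ℕ} (hk : k ≤ n) (ht : t ≤ n) (hik : i ≤ k) (hit : i ≤ t) :
    hyp n k t i = hyp n t k i := by
  have h := sum_card_bipartiteAbove_eq_sum_card_bipartiteBelow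
    (s := powersetCard k (univ : Finset (Fin n))) (t := powersetCard t (univ : Finset (Fin n)))
    (fun K T => #(K ∩ T) = i)
  have e1 : ∀ K ∈ powersetCard k (univ : Finset (Fin n)),
      #(bipartiteAbove (fun K T : Finset (Fin n) => #(K ∩ T) = i) (powersetCard t univ) K) =
        k.choose i * (n - k).choose (t - i) := by
    intro K hK
    rw [mem_powersetCard] at hK
    rw [bipartiteAbove, ← hK.2, ← card_filter_card_inter_eq K t i hit]
    simp only [inter_comm K]
  have e2 : ∀ T ∈ powersetCard t (univ : Finset (Fin n)),
      #(bipartiteBelow (fun K T : Finset (Fin n) => #(K ∩ T) = i) (powersetCard k univ) T) =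
        t.choose i * (n - t).choose (k - i) := by
    intro T hT
    rw [mem_powersetCard] at hT
    rw [bipartiteBelow, ← hT.2, ← card_filter_card_inter_eq T k i hik]
  rw [sum_congr rfl e1, sum_congr rfl e2] at h
  simp only [sum_const, card_powersetCard, card_univ, Fintype.card_fin, smul_eq_mul] at h
  have p1 : (0 : ℝ) < n.choose t := by exact_mod_cast Nat.choose_pos ht
  have p2 : (0 : ℝ) < n.choose k := by exact_mod_cast Nat.choose_pos hk
  unfold hyp
  rw [div_eq_div_iff p1.ne' p2.ne']
  have : ((n.choose k * (k.choose i * (n - k).choose (t - i)) : ℕ) : ℝ) =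
    (n.choose t * (t.choose i * (n - t).choose (k - i)) : ℕ) := by exact_mod_cast h
  push_cast at this
  linarith

lemma tail_comm {n k t : ℕ} (hk : k ≤ n) (ht : t ≤ n) (y : ℕ) : tail n k t y = tail n t k y := by
  unfold tail
  rw [min_comm]
  refine sum_congr rfl fun i hi => ?_
  rw [mem_Icc, le_min_iff] at hi
  exact hyp_comm hk ht hi.2.1 hi.2.2

/-- After an exchange of roles, a random k-set meets the larger of two nested fixed sets in at least
as many elements as the smaller one. -/
lemma tail_mono {n k t t' : ℕ} (hk : k ≤ n) (htt : t ≤ t') (ht' : t' ≤ n) (y : ℕ) :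
    tail n k t y ≤ tail n k t' y := by
  obtain ⟨X', hX'⟩ := exists_finset_card_eq ht'
  obtain ⟨X, hXX, hX⟩ := exists_subset_card_eq (s := X') (n := t) (by omega)
  have h1 := card_filter_le_card_inter X hk y
  have h2 := card_filter_le_card_inter X' hk y
  rw [hX, ← tail_comm hk (htt.trans ht')] at h1
  rw [hX', ← tail_comm hk ht'] at h2
  have p : (0 : ℝ) < n.choose k := by exact_mod_cast Nat.choose_pos hk
  refine le_of_mul_le_mul_left ?_ p
  rw [← h1, ← h2]
  have : #{K ∈ powersetCard k (univ : Finset (Fin n)) | y ≤ #(K ∩ X)} ≤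
      #{K ∈ powersetCard k (univ : Finset (Fin n)) | y ≤ #(K ∩ X')} := by
    refine card_le_card fun K hK => ?_
    rw [mem_filter] at hK ⊢
    exact ⟨hK.1, hK.2.trans (card_le_card (inter_subset_inter_left hXX))⟩
  exact_mod_cast this

lemma tail_le_one {n k t : ℕ} (hk : k ≤ n) (ht : t ≤ n) (y : ℕ) : tail n k t y ≤ 1 := by
  obtain ⟨X, hX⟩ := exists_finset_card_eq ht
  have h1 := card_filter_le_card_inter X hk y
  rw [hX, ← tail_comm hk ht] at h1
  have p : (0 : ℝ) < n.choose k := by exact_mod_cast Nat.choose_pos hk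
  refine le_of_mul_le_mul_left ?_ p
  rw [← h1, mul_one]
  have := card_filter_le (powersetCard k (univ : Finset (Fin n))) (fun K => y ≤ #(K ∩ X))
  rw [card_powersetCard, card_univ, Fintype.card_fin] at this
  exact_mod_cast this

lemma hyp_le_tail {n k t i : ℕ} (hik : i ≤ k) (hit : i ≤ t) : hyp n k t i ≤ tail n k t i :=
  single_le_sum (f := fun i => hyp n k t i) (fun _ _ => hyp_nonneg _ _ _ _)
    (by simp [hik, hit])

lemma tail_pos {n k t y : ℕ} (hk : k ≤ n) (ht : t ≤ n) (hyk : y ≤ k) (hyt : y ≤ t) :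
    0 < tail n k t y := by
  have hmem : min t k ∈ Icc y (min t k) := by simp [hyk, hyt]
  refine lt_of_lt_of_le ?_ (single_le_sum (f := fun i => hyp n k t i)
    (fun _ _ => hyp_nonneg _ _ _ _) hmem)
  unfold hyp
  have h1 := Nat.choose_pos (n := k) (k := min t k) (by omega)
  have h2 := Nat.choose_pos (n := n - k) (k := t - min t k) (by omega)
  have h3 := Nat.choose_pos ht
  positivity

/-! ### The objective function -/

/-- `x(k, t) = (1 - β / α) k + t / α`. -/
noncomputable def xval (α β : ℝ) (k t : ℕ) : ℝ := (1 - β / α) * k + t / α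

/-- The quantity that the algorithm minimizes. -/
noncomputable def obj (α c β : ℝ) (n k t : ℕ) : ℝ :=
  c ^ ((β * k - t) / α) / tail n k t ⌈xval α β k t⌉₊

/-- The integers `t` in `[M* k, β k]`. -/
def ValidT (α β : ℝ) (k t : ℕ) : Prop := Mstar α β * k ≤ t ∧ (t : ℝ) ≤ β * k

lemma Mstar_nonneg {α β : ℝ} (hβ : 1 ≤ β) : 0 ≤ Mstar α β := by
  unfold Mstar
  split_ifs with h
  · exact le_rfl
  · exact div_nonneg (by linarith) (by linarith)

lemma Mstar_le_one {α β : ℝ} (hβ : 1 ≤ β) : Mstar α β ≤ 1 := by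
  unfold Mstar
  split_ifs with h
  · exact zero_le_one
  · rw [div_le_one (by linarith)]; linarith

lemma validT_self {α β : ℝ} (hβ : 1 ≤ β) (k : ℕ) : ValidT α β k k := by
  have hk : (0 : ℝ) ≤ k := Nat.cast_nonneg k
  have := Mstar_le_one (α := α) hβ
  constructor <;> nlinarith

lemma xval_eq {α β : ℝ} (k t : ℕ) : xval α β k t = k - (β * k - t) / α := by
  unfold xval; ring

/-- The meaning of `Mstar`: below this threshold more elements of the solution are demanded than the
sample has, and the success probability would vanish. -/
lemma Mstar_mul_le_iff {α β : ℝ} (hα : 1 ≤ α) (hβ : 1 ≤ β) (k t : ℕ) :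
    Mstar α β * k ≤ t ↔ xval α β k t ≤ t := by
  have hk : (0 : ℝ) ≤ k := Nat.cast_nonneg k
  have ht : (0 : ℝ) ≤ t := Nat.cast_nonneg t
  have hα0 : 0 < α := by linarith
  have e : xval α β k t ≤ t ↔ (α - β) * k ≤ (α - 1) * t := by
    rw [xval_eq, sub_le_iff_le_add, ← sub_le_iff_le_add', le_div_iff₀ hα0]
    constructor <;> intro h <;> nlinarith
  rw [e]
  unfold Mstar
  split_ifs with h
  · simp only [zero_mul, Nat.cast_nonneg, true_iff]
    nlinarith [mul_nonneg (sub_nonneg.mpr hα) ht, mul_nonneg (sub_nonneg.mpr h) hk]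
  · rw [div_mul_eq_mul_div, div_le_iff₀ (by linarith), mul_comm (t : ℝ)]

lemma ValidT.xval_le {α β : ℝ} (hα : 1 ≤ α) {k t : ℕ} (h : ValidT α β k t) :
    xval α β k t ≤ k := by
  rw [xval_eq]
  have : 0 ≤ (β * k - t) / α := div_nonneg (by linarith [h.2]) (by linarith)
  linarith

lemma ValidT.ceil_le {α β : ℝ} (hα : 1 ≤ α) (hβ : 1 ≤ β) {k t : ℕ} (h : ValidT α β k t) :
    ⌈xval α β k t⌉₊ ≤ k ∧ ⌈xval α β k t⌉₊ ≤ t :=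
  ⟨Nat.ceil_le.mpr (h.xval_le hα), Nat.ceil_le.mpr ((Mstar_mul_le_iff hα hβ k t).mp h.1)⟩

lemma le_of_mul_le {β : ℝ} (hβ : 1 ≤ β) {n k : ℕ} (hk : β * k ≤ n) : k ≤ n := by
  have : (k : ℝ) ≤ n := by nlinarith [Nat.cast_nonneg (α := ℝ) k]
  exact_mod_cast this

lemma ValidT.le {α β : ℝ} {n k t : ℕ} (hk : β * k ≤ n) (h : ValidT α β k t) : t ≤ n := by
  exact_mod_cast h.2.trans hk

lemma ValidT.tail_pos {α β : ℝ} (hα : 1 ≤ α) (hβ : 1 ≤ β) {n k t : ℕ} (hk : β * k ≤ n)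
    (h : ValidT α β k t) : 0 < tail n k t ⌈xval α β k t⌉₊ :=
  SubsetMin.tail_pos (le_of_mul_le hβ hk) (h.le hk) (h.ceil_le hα hβ).1 (h.ceil_le hα hβ).2

lemma ValidT.obj_pos {α c β : ℝ} (hα : 1 ≤ α) (hc : 1 ≤ c) (hβ : 1 ≤ β) {n k t : ℕ}
    (hk : β * k ≤ n) (h : ValidT α β k t) : 0 < obj α c β n k t :=
  div_pos (Real.rpow_pos_of_pos (by linarith) _) (h.tail_pos hα hβ hk)

/-- Every query `(X, k - i)` with `|X| = t₀` that satisfies the constraint can be replaced by one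
with a larger set that satisfies the constraint with equality up to rounding. -/
lemma exists_validT {α β : ℝ} (hα : 1 ≤ α) (hβ : 1 ≤ β) {k t₀ i : ℕ} (hik : i ≤ k) (hit : i ≤ t₀)
    (h : α * ((k - i : ℕ) : ℝ) + t₀ ≤ β * k) :
    ∃ t, t₀ ≤ t ∧ ValidT α β k t ∧ ⌈xval α β k t⌉₊ = i ∧
      (β * k - t) / α ≤ ((k - i : ℕ) : ℝ) + 1 := by
  have hα0 : 0 < α := by linarith
  -- The sample size that makes the constraint an equality; its floor is the witness.
  set z : ℝ := β * k - α * ((k - i : ℕ) : ℝ) with hz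
  have hz0 : (t₀ : ℝ) ≤ z := by linarith
  have hz1 : 0 ≤ z := (Nat.cast_nonneg _).trans hz0
  have h1 : ((⌊z⌋₊ : ℕ) : ℝ) ≤ z := Nat.floor_le hz1
  have h2 : z < ⌊z⌋₊ + 1 := Nat.lt_floor_add_one z
  have h3 : t₀ ≤ ⌊z⌋₊ := Nat.le_floor hz0
  have h4 : (β * k - (⌊z⌋₊ : ℕ)) / α < ((k - i : ℕ) : ℝ) + 1 := by
    rw [div_lt_iff₀ hα0]; nlinarith
  have h5 : ((k - i : ℕ) : ℝ) ≤ (β * k - (⌊z⌋₊ : ℕ)) / α := by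
    rw [le_div_iff₀ hα0]; nlinarith
  have hki : ((k - i : ℕ) : ℝ) = k - i := Nat.cast_sub hik
  have h6 : xval α β k ⌊z⌋₊ ≤ i := by rw [xval_eq]; linarith
  have h7 : (i : ℝ) - 1 < xval α β k ⌊z⌋₊ := by rw [xval_eq]; linarith
  refine ⟨⌊z⌋₊, h3, ⟨?_, ?_⟩, ?_, h4.le⟩
  · rw [Mstar_mul_le_iff hα hβ]
    exact h6.trans (by exact_mod_cast hit.trans h3)
  · have : 0 ≤ α * ((k - i : ℕ) : ℝ) := by positivity
    linarith
  · apply le_antisymm (Nat.ceil_le.mpr h6)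
    -- For `i = 0` the real number x may be as low as just above -1, and the truncated ceiling is
    -- what makes the value 0.
    rcases Nat.eq_zero_or_pos i with h0 | h0
    · omega
    · have : i - 1 < ⌈xval α β k ⌊z⌋₊⌉₊ := by
        rw [Nat.lt_ceil, Nat.cast_sub h0]; exact_mod_cast h7
      omega

/-- Enlarging the sample until the constraint is tight turns a revealing query into one that the
algorithm considers. The probability only grows, and the exponent of the objective exceeds `k - i`
by at most one, whence the factor `cmax`. -/
lemma hypBound_of_le_obj {L : Finset (ℝ × ℝ)} (hL : IsSpecList L) {β : ℝ} (hβ : 1 ≤ β)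
    {n k : ℕ} (hk : β * k ≤ n) {cmax Φ : ℝ} (hcmax : ∀ j ∈ L, j.2 ≤ cmax) (hΦ : 0 < Φ)
    (h : ∀ j ∈ L, ∀ t, ValidT j.1 β k t → Φ ≤ obj j.1 j.2 β n k t) :
    HypBound L β n k (cmax / Φ) := by
  intro j hj t₀ i hik hit htn hcon
  obtain ⟨hα, hc⟩ := hL.2 j hj
  obtain ⟨t, h1, h2, h3, h4⟩ := exists_validT hα hβ hik hit hcon
  have h5 := h j hj t h2
  have hpos := h2.tail_pos hα hβ hk
  rw [obj, h3, le_div_iff₀ (h3 ▸ hpos)] at h5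
  have h6 : j.2 ^ ((β * k - t) / j.1) ≤ j.2 * j.2 ^ (k - i) := by
    calc _ ≤ j.2 ^ (((k - i : ℕ) : ℝ) + 1) := Real.rpow_le_rpow_of_exponent_le hc h4
      _ = _ := by
        rw [Real.rpow_add (by linarith), Real.rpow_natCast, Real.rpow_one, mul_comm]
  have h7 := (hyp_le_tail (n := n) hik hit).trans
    (tail_mono (le_of_mul_le hβ hk) h1 (h2.le hk) i)
  rw [div_mul_eq_mul_div, le_div_iff₀ hΦ]
  have hc0 : 0 ≤ j.2 ^ (k - i) := by have : 0 ≤ j.2 := by linarith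
                                     positivity
  calc hyp n k t₀ i * Φ ≤ tail n k t i * Φ := by gcongr
    _ = Φ * tail n k t i := mul_comm _ _
    _ ≤ j.2 * j.2 ^ (k - i) := h5.trans h6
    _ ≤ _ := by gcongr; exact hcmax j hj

end

section

/-! ### Expectations -/

/-- The expectation of a nonnegative function. -/
noncomputable def expect {τ : Type} (p : PMF τ) (φ : τ → ℝ≥0∞) : ℝ≥0∞ := ∑' o, p o * φ o

section Expect

variable {τ σ : Type}

lemma expect_pure (a : τ) (φ : τ → ℝ≥0∞) : expect (PMF.pure a) φ = φ a := by
  unfold expect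
  rw [tsum_eq_single a]
  · simp
  · intro b hb; simp [PMF.pure_apply, hb]

lemma expect_bind (p : PMF σ) (f : σ → PMF τ) (φ : τ → ℝ≥0∞) :
    expect (p.bind f) φ = expect p fun a => expect (f a) φ := by
  unfold expect
  simp only [PMF.bind_apply, ← ENNReal.tsum_mul_right, ← ENNReal.tsum_mul_left]
  rw [ENNReal.tsum_comm]
  simp only [mul_assoc]

lemma expect_map (p : PMF σ) (f : σ → τ) (φ : τ → ℝ≥0∞) :
    expect (p.map f) φ = expect p fun a => φ (f a) := by
  rw [← PMF.bind_pure_comp, expect_bind]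
  simp only [Function.comp_apply, expect_pure]

lemma expect_mono_support {p : PMF τ} {φ ψ : τ → ℝ≥0∞} (h : ∀ o ∈ p.support, φ o ≤ ψ o) :
    expect p φ ≤ expect p ψ := by
  refine ENNReal.tsum_le_tsum fun o => ?_
  by_cases ho : o ∈ p.support
  · gcongr; exact h o ho
  · rw [(p.apply_eq_zero_iff o).mpr ho]; simp

lemma expect_const (p : PMF τ) (r : ℝ≥0∞) : expect p (fun _ => r) = r := by
  unfold expect
  rw [ENNReal.tsum_mul_right, p.tsum_coe, one_mul]

lemma expect_le_of_support {p : PMF τ} {φ : τ → ℝ≥0∞} {r : ℝ≥0∞} (h : ∀ o ∈ p.support, φ o ≤ r) :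
    expect p φ ≤ r :=
  (expect_mono_support h).trans_eq (expect_const p r)

lemma expect_add (p : PMF τ) (φ ψ : τ → ℝ≥0∞) :
    expect p (fun o => φ o + ψ o) = expect p φ + expect p ψ := by
  unfold expect
  rw [← ENNReal.tsum_add]
  simp only [mul_add]

lemma expect_sum {κ : Type} (p : PMF τ) (s : Finset κ) (φ : κ → τ → ℝ≥0∞) :
    expect p (fun o => ∑ K ∈ s, φ K o) = ∑ K ∈ s, expect p (φ K) := by
  classical
  induction s using Finset.induction_on with
  | empty => simp [expect]
  | insert a s ha ih => simp only [sum_insert ha, expect_add, ih]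

lemma expect_mul_left (p : PMF τ) (r : ℝ≥0∞) (φ : τ → ℝ≥0∞) :
    expect p (fun o => r * φ o) = r * expect p φ := by
  unfold expect
  rw [← ENNReal.tsum_mul_left]
  exact tsum_congr fun o => by ring

lemma toOuterMeasure_eq_expect (p : PMF τ) (S : Set τ) :
    p.toOuterMeasure S = expect p (S.indicator 1) := by
  rw [PMF.toOuterMeasure_apply]
  refine tsum_congr fun o => ?_
  by_cases ho : o ∈ S <;> simp [ho]

lemma expect_andThen (p : PMF (Option σ)) (f : σ → PMF (Option σ)) (φ : Option σ → ℝ≥0∞) :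
    expect (andThen p f) φ = expect p fun o => o.elim (φ none) fun s => expect (f s) φ := by
  unfold andThen
  rw [expect_bind]
  congr 1
  funext o
  cases o <;> simp [expect_pure]

lemma mem_support_andThen {p : PMF (Option σ)} {f : σ → PMF (Option σ)} {s' : σ}
    (h : some s' ∈ (andThen p f).support) :
    ∃ s, some s ∈ p.support ∧ some s' ∈ (f s).support := by
  unfold andThen at h
  rw [PMF.mem_support_bind_iff] at h
  obtain ⟨o, ho, hs⟩ := h
  cases o with
  | none => simp at hs
  | some s => exact ⟨s, ho, hs⟩

/-! ### Monotonicity in the bound on the number of iterations -/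

/-- Every proper outcome is at least as likely under `q` as under `p`. -/
def OutcomeLE (p q : PMF (Option σ)) : Prop := ∀ s, p (some s) ≤ q (some s)

lemma OutcomeLE.refl (p : PMF (Option σ)) : OutcomeLE p p := fun _ => le_rfl

lemma OutcomeLE.trans {p q r : PMF (Option σ)} (h : OutcomeLE p q) (h' : OutcomeLE q r) :
    OutcomeLE p r := fun s => (h s).trans (h' s)

lemma outcomeLE_pure_none (q : PMF (Option σ)) : OutcomeLE (PMF.pure none) q := fun s => by
  simp [PMF.pure_apply]

lemma OutcomeLE.andThen {p q : PMF (Option σ)} {f g : σ → PMF (Option σ)} (h : OutcomeLE p q)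
    (hf : ∀ s, OutcomeLE (f s) (g s)) : OutcomeLE (andThen p f) (andThen q g) := by
  intro s
  unfold SubsetMin.andThen
  rw [PMF.bind_apply, PMF.bind_apply]
  refine ENNReal.tsum_le_tsum fun o => ?_
  cases o with
  | none => simp [PMF.pure_apply]
  | some s' => exact mul_le_mul' (h s') (hf s' s)

lemma OutcomeLE.expect_le {p q : PMF (Option σ)} (h : OutcomeLE p q) {φ : Option σ → ℝ≥0∞}
    (hφ : φ none = 0) : expect p φ ≤ expect q φ := by
  refine ENNReal.tsum_le_tsum fun o => ?_
  cases o with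
  | none => simp [hφ]
  | some s => gcongr; exact h s

/-- Both masses are one, so a pointwise inequality is an equality. Thus a run that always ends
within its fuel is not affected by more fuel. -/
lemma OutcomeLE.eq {p q : PMF (Option σ)} (h : OutcomeLE p q) (hp : none ∉ p.support) : p = q := by
  have hle : ∀ o, p o ≤ q o := fun o => by
    cases o with
    | none => rw [(p.apply_eq_zero_iff none).mpr hp]; exact bot_le
    | some s => exact h s
  ext o
  by_contra hne
  have hlt : p o < q o := lt_of_le_of_ne (hle o) hne
  have := ENNReal.tsum_lt_tsum (by rw [p.tsum_coe]; simp) hle hlt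
  rw [p.tsum_coe, q.tsum_coe] at this
  exact lt_irrefl _ this

end Expect

variable {ι : Type} {n : ℕ}

lemma outcomeLE_forIter {σ : Type} {b b' : ℕ → σ → PMF (Option σ)}
    (h : ∀ m s, OutcomeLE (b m s) (b' m s)) (k : ℕ) (s : σ) :
    OutcomeLE (forIter b k s) (forIter b' k s) := by
  induction k with
  | zero => exact OutcomeLE.refl _
  | succ k ih => exact ih.andThen (h k)

lemma outcomeLE_whileIter {σ : Type} {test : σ → σ} {cond : σ → Prop} [DecidablePred cond]
    {b b' : σ → PMF (Option σ)} (h : ∀ s, OutcomeLE (b s) (b' s)) (fuel : ℕ) :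
    ∀ s, OutcomeLE (whileIter test cond b fuel s) (whileIter test cond b' (fuel + 1) s) := by
  induction fuel with
  | zero =>
    intro s
    rw [whileIter, whileIter]
    split_ifs
    · exact outcomeLE_pure_none _
    · exact OutcomeLE.refl _
  | succ fuel ih =>
    intro s
    rw [whileIter, whileIter]
    split_ifs
    · exact (h _).andThen ih
    · exact OutcomeLE.refl _

lemma outcomeLE_exec_succ (c : ι → ℝ) (O : ι → OracleFun n) (fuel : ℕ) (P : Prog ι) :
    ∀ s, OutcomeLE (exec c O fuel P s) (exec c O (fuel + 1) P s) := by
  induction P with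
  | skip => intro s; simp only [exec]; exact OutcomeLE.refl _
  | setNum a e => intro s; simp only [exec]; exact OutcomeLE.refl _
  | setSet a S => intro s; simp only [exec]; exact OutcomeLE.refl _
  | randNum a m => intro s; simp only [exec]; exact OutcomeLE.refl _
  | randElem a S => intro s; simp only [exec]; exact OutcomeLE.refl _
  | query j a X l => intro s; simp only [exec]; exact OutcomeLE.refl _
  | seq P Q hP hQ => intro s; simp only [exec]; exact (hP s).andThen hQ
  | ifLe e f P Q hP hQ =>
    intro s
    simp only [exec]
    split_ifs
    · exact hP _
    · exact hQ _
  | whileLe e f P hP => intro s; simp only [exec]; exact outcomeLE_whileIter hP _ _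
  | forDo i lo hi P hP =>
    intro s
    simp only [exec]
    exact outcomeLE_forIter (fun _ _ => hP _) _ _

lemma outcomeLE_exec (c : ι → ℝ) (O : ι → OracleFun n) {fuel fuel' : ℕ} (h : fuel ≤ fuel')
    (P : Prog ι) (s : State n) : OutcomeLE (exec c O fuel P s) (exec c O fuel' P s) := by
  induction fuel', h using Nat.le_induction with
  | base => exact OutcomeLE.refl _
  | succ f _ ih => exact ih.trans (outcomeLE_exec_succ _ _ _ _ _)

/-! ### Costs are positive -/

lemma NExp.ops_nonneg (e : NExp) : ∀ s : State n, 0 ≤ e.ops s := by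
  induction e with
  | const r => intro s; simp [NExp.ops]
  | size => intro s; simp [NExp.ops]
  | load a ha => intro s; have := ha s; simp only [NExp.ops]; positivity
  | card a ha => intro s; have := ha s; simp only [NExp.ops]; positivity
  | ceil a ha => intro s; have := ha s; simp only [NExp.ops]; positivity
  | floor a ha => intro s; have := ha s; simp only [NExp.ops]; positivity
  | add e f he hf | sub e f he hf | mul e f he hf | div e f he hf | pow e f he hf
  | min e f he hf | max e f he hf =>
    intro s; have := he s; have := hf s; simp only [NExp.ops]; positivity
  | sum i lo hi e h1 h2 h3 | prod i lo hi e h1 h2 h3 =>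
    intro s
    have := h1 s
    have := h2 s
    have h4 : ∀ y ∈ Finset.Icc ⌈lo.eval s⌉ ⌊hi.eval s⌋,
        0 ≤ 1 + e.ops (s.putNum i (y : ℝ)) := fun y _ => by
      have := h3 (s.putNum i (y : ℝ)); positivity
    have := sum_nonneg h4
    simp only [NExp.ops]
    positivity

lemma SExp.ops_nonneg (e : SExp) : ∀ s : State n, 0 ≤ e.ops s := by
  induction e with
  | empty => intro s; simp only [SExp.ops]; positivity
  | univ => intro s; simp only [SExp.ops]; positivity
  | load a => intro s; have := a.ops_nonneg s; simp only [SExp.ops]; positivity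
  | single a => intro s; have := a.ops_nonneg s; simp only [SExp.ops]; positivity
  | union e f he hf | inter e f he hf | sdiff e f he hf =>
    intro s; have := he s; have := hf s; simp only [SExp.ops]; positivity

/-- Executions do not decrease the accumulated cost. -/
def CostMono (p : State n → PMF (Option (State n))) : Prop :=
  ∀ s s', some s' ∈ (p s).support → s.cost ≤ s'.cost

lemma CostMono.andThen {p q : State n → PMF (Option (State n))} (hp : CostMono p)
    (hq : CostMono q) : CostMono fun s => andThen (p s) q := by
  intro s s' h
  obtain ⟨u, h1, h2⟩ := mem_support_andThen h
  exact (hp s u h1).trans (hq u s' h2)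

lemma costMono_forIter {b : ℕ → State n → PMF (Option (State n))} (hb : ∀ m, CostMono (b m))
    (k : ℕ) : CostMono (forIter b k) := by
  induction k with
  | zero => intro s s' h; simp [forIter] at h; rw [h]
  | succ k ih => exact ih.andThen (hb k)

lemma costMono_whileIter {test : State n → State n} {cond : State n → Prop} [DecidablePred cond]
    (htest : ∀ s, s.cost ≤ (test s).cost) {b : State n → PMF (Option (State n))}
    (hb : CostMono b) (fuel : ℕ) : CostMono (whileIter test cond b fuel) := by
  induction fuel with
  | zero =>
    intro s s' h
    rw [whileIter] at h
    split_ifs at h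
    · simp at h
    · simp at h; rw [h]; exact htest s
  | succ fuel ih =>
    intro s s' h
    rw [whileIter] at h
    split_ifs at h
    · obtain ⟨u, h1, h2⟩ := mem_support_andThen h
      exact (htest s).trans ((hb _ u h1).trans (ih u s' h2))
    · simp at h; rw [h]; exact htest s

lemma add_one_le_cost_of_whileIter {test : State n → State n} {cond : State n → Prop}
    [DecidablePred cond] (htest : ∀ s, s.cost + 1 ≤ (test s).cost)
    {b : State n → PMF (Option (State n))} (hb : CostMono b) (fuel : ℕ) {s s' : State n}
    (h : some s' ∈ (whileIter test cond b fuel s).support) : s.cost + 1 ≤ s'.cost := by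
  have ht : ∀ s, s.cost ≤ (test s).cost := fun s => by linarith [htest s]
  cases fuel with
  | zero =>
    rw [whileIter] at h
    split_ifs at h
    · simp at h
    · simp at h; rw [h]; exact htest s
  | succ fuel =>
    rw [whileIter] at h
    split_ifs at h
    · obtain ⟨u, h1, h2⟩ := mem_support_andThen h
      exact (htest s).trans ((hb _ u h1).trans (costMono_whileIter ht hb fuel u s' h2))
    · simp at h; rw [h]; exact htest s

/-- Every execution costs at least one. -/
lemma add_one_le_cost {c : ι → ℝ} (hc : ∀ j, 0 ≤ c j) (O : ι → OracleFun n) (fuel : ℕ)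
    (P : Prog ι) : ∀ s s', some s' ∈ (exec c O fuel P s).support → s.cost + 1 ≤ s'.cost := by
  induction P with
  | skip => intro s s' h; simp [exec] at h; simp [h, State.charge]
  | setNum a e =>
    intro s s' h
    have := a.ops_nonneg s
    have := e.ops_nonneg s
    simp [exec] at h; simp [h, State.charge, State.putNum]; linarith
  | setSet a e =>
    intro s s' h
    have := a.ops_nonneg s
    have := e.ops_nonneg s
    simp [exec] at h; simp [h, State.charge, State.putSet]; linarith
  | randNum a e =>
    intro s s' h
    have := a.ops_nonneg s
    have := e.ops_nonneg s
    simp only [exec, PMF.mem_support_map_iff, Option.some.injEq] at h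
    obtain ⟨v, -, rfl⟩ := h
    simp [State.charge, State.putNum]; linarith
  | randElem a e =>
    intro s s' h
    have := a.ops_nonneg s
    have := e.ops_nonneg s
    simp only [exec, PMF.mem_support_map_iff, Option.some.injEq] at h
    obtain ⟨v, -, rfl⟩ := h
    simp [State.charge, State.putSet]; linarith
  | query j a X l =>
    intro s s' h
    have := a.ops_nonneg s
    have := X.ops_nonneg s
    have := l.ops_nonneg s
    have := pow_nonneg (hc j) ⌊l.eval s⌋₊
    simp only [exec, PMF.mem_support_map_iff, Option.some.injEq] at h
    obtain ⟨v, -, rfl⟩ := h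
    simp [State.charge, State.putSet]; linarith
  | seq P Q hP hQ =>
    intro s s' h
    simp only [exec] at h
    obtain ⟨u, h1, h2⟩ := mem_support_andThen h
    have := hP s u h1
    have := hQ u s' h2
    linarith
  | ifLe e f P Q hP hQ =>
    intro s s' h
    have := e.ops_nonneg s
    have := f.ops_nonneg s
    simp only [exec] at h
    split_ifs at h
    · have := hP _ s' h; simp [State.charge] at this; linarith
    · have := hQ _ s' h; simp [State.charge] at this; linarith
  | whileLe e f P hP =>
    intro s s' h
    simp only [exec] at h
    refine add_one_le_cost_of_whileIter (fun s => ?_) (fun s s' h => ?_) fuel h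
    · have := e.ops_nonneg s
      have := f.ops_nonneg s
      simp [State.charge]; linarith
    · have := hP s s' h; linarith
  | forDo i lo hi P hP =>
    intro s s' h
    have := lo.ops_nonneg s
    have := hi.ops_nonneg s
    simp only [exec] at h
    have := costMono_forIter (fun m u u' hu => by
      have := hP _ u' hu
      simp [State.charge, State.putNum] at this; linarith) _ _ s' h
    simp [State.charge] at this; linarith

lemma costMono_exec {c : ι → ℝ} (hc : ∀ j, 0 ≤ c j) (O : ι → OracleFun n) (fuel : ℕ)
    (P : Prog ι) : CostMono (exec c O fuel P) := fun s s' h => by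
  have := add_one_le_cost hc O fuel P s s' h; linarith

/-! ### Comparing a family of oracles with a reference oracle -/

section Dominated

variable {κ : Type}

/-- The executions `p K`, `K ∈ 𝒦`, differ from the reference execution `p₀` for at most
`M * cost` many `K`. -/
def Dominated (𝒦 : Finset κ) (M : ℝ) (p : κ → State n → PMF (Option (State n)))
    (p₀ : State n → PMF (Option (State n))) : Prop :=
  -- `g K` plays the role of the success probability of the remaining execution. A run that is cut
  -- off counts `0` on the left and `⊤` on the right, so both favour the inequality.
  ∀ g : κ → State n → ℝ≥0∞, (∀ K s, g K s ≤ 1) → ∀ s : State n, 0 ≤ s.cost →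
    (∑ K ∈ 𝒦, expect (p K s) fun o => o.elim 0 (g K)) + ENNReal.ofReal (M * s.cost) ≤
      expect (p₀ s) fun o =>
        o.elim ⊤ fun s' => (∑ K ∈ 𝒦, g K s') + ENNReal.ofReal (M * s'.cost)

variable {𝒦 : Finset κ} {M : ℝ}

lemma Dominated.comp {p : κ → State n → PMF (Option (State n))}
    {p₀ : State n → PMF (Option (State n))} (hM : 0 ≤ M) (h : Dominated 𝒦 M p p₀)
    {f : State n → State n} (hf : ∀ s, s.cost ≤ (f s).cost) :
    Dominated 𝒦 M (fun K s => p K (f s)) fun s => p₀ (f s) := by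
  intro g hg s hs
  refine le_trans ?_ (h g hg (f s) (hs.trans (hf s)))
  gcongr
  exact hf s

lemma dominated_const (hM : 0 ≤ M) {p : State n → PMF (Option (State n))} (hp : CostMono p) :
    Dominated 𝒦 M (fun _ => p) p := by
  intro g hg s hs
  rw [← expect_sum, ← expect_const (p s) (ENNReal.ofReal (M * s.cost)), ← expect_add]
  refine expect_mono_support fun o ho => ?_
  cases o with
  | none => simp
  | some s' =>
    simp only [Option.elim_some]
    gcongr
    exact hp s s' ho

/-- The expected value of `g K` after the second computation is itself a function bounded by one, so
it can serve as the test function for the first; the accumulated cost acts as a potential. -/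
lemma Dominated.andThen {p q : κ → State n → PMF (Option (State n))}
    {p₀ q₀ : State n → PMF (Option (State n))} (hp₀ : CostMono p₀) (hp : Dominated 𝒦 M p p₀)
    (hq : Dominated 𝒦 M q q₀) :
    Dominated 𝒦 M (fun K s => andThen (p K s) (q K)) fun s => andThen (p₀ s) q₀ := by
  intro g hg s hs
  simp only [expect_andThen]
  have hg' : ∀ K s', (expect (q K s') fun o => o.elim 0 (g K)) ≤ 1 := fun K s' =>
    expect_le_of_support fun o _ => by cases o <;> simp [hg]
  refine (hp (fun K s' => expect (q K s') fun o => o.elim 0 (g K)) hg' s hs).trans ?_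
  refine expect_mono_support fun o ho => ?_
  cases o with
  | none => simp
  | some s' => exact hq g hg s' (hs.trans (hp₀ s s' ho))

lemma dominated_pure (hM : 0 ≤ M) {f : State n → State n} (hf : ∀ s, s.cost ≤ (f s).cost) :
    Dominated 𝒦 M (fun _ s => PMF.pure (some (f s))) fun s => PMF.pure (some (f s)) :=
  dominated_const hM fun s s' h => by simp at h; rw [h]; exact hf s

lemma dominated_forIter (hM : 0 ≤ M) {b : κ → ℕ → State n → PMF (Option (State n))}
    {b₀ : ℕ → State n → PMF (Option (State n))} (hb₀ : ∀ m, CostMono (b₀ m))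
    (h : ∀ m, Dominated 𝒦 M (fun K => b K m) (b₀ m)) (k : ℕ) :
    Dominated 𝒦 M (fun K => forIter (b K) k) (forIter b₀ k) := by
  induction k with
  | zero => exact dominated_pure hM (f := fun s => s) fun _ => le_rfl
  | succ k ih => exact Dominated.andThen (costMono_forIter hb₀ k) ih (h k)

lemma dominated_whileIter (hM : 0 ≤ M) {test : State n → State n} {cond : State n → Prop}
    [DecidablePred cond] (htest : ∀ s, s.cost ≤ (test s).cost)
    {b : κ → State n → PMF (Option (State n))} {b₀ : State n → PMF (Option (State n))}
    (hb₀ : CostMono b₀) (h : Dominated 𝒦 M b b₀) (fuel : ℕ) :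
    Dominated 𝒦 M (fun K => whileIter test cond (b K) fuel) (whileIter test cond b₀ fuel) := by
  induction fuel with
  | zero =>
    intro g hg s hs
    simp only [whileIter]
    split_ifs
    · simp [expect_pure]
    · exact dominated_pure hM htest g hg s hs
  | succ fuel ih =>
    intro g hg s hs
    simp only [whileIter]
    split_ifs
    · exact (Dominated.andThen (fun s s' h => (htest s).trans (hb₀ _ s' h)) (h.comp hM htest) ih)
        g hg s hs
    · exact dominated_pure hM htest g hg s hs

/-- An oracle that does not use random bits. -/
def detOracle (ans : Finset (Fin n) → ℕ → Finset (Fin n)) : OracleFun n := ⟨0, fun X l _ => ans X l⟩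

/-- Only queries separate the executions. At a query each `K` with a deviating answer accounts for
at most one, there are at most `M * c j ^ l` of them, and the potential rises by at least that much.
-/
lemma dominated_exec (hM : 0 ≤ M) {c : ι → ℝ} (hc : ∀ j, 0 ≤ c j)
    {a : κ → ι → Finset (Fin n) → ℕ → Finset (Fin n)} {a₀ : ι → Finset (Fin n) → ℕ → Finset (Fin n)}
    (ha : ∀ j X l, (#{K ∈ 𝒦 | a K j X l ≠ a₀ j X l} : ℝ) ≤ M * c j ^ l) (fuel : ℕ) (P : Prog ι) :
    Dominated 𝒦 M (fun K => exec c (fun j => detOracle (a K j)) fuel P)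
      (exec c (fun j => detOracle (a₀ j)) fuel P) := by
  induction P with
  | skip => exact dominated_const hM (costMono_exec hc (fun j => detOracle (a₀ j)) fuel .skip)
  | setNum b e =>
    exact dominated_const hM (costMono_exec hc (fun j => detOracle (a₀ j)) fuel (.setNum b e))
  | setSet b e =>
    exact dominated_const hM (costMono_exec hc (fun j => detOracle (a₀ j)) fuel (.setSet b e))
  | randNum b e =>
    exact dominated_const hM (costMono_exec hc (fun j => detOracle (a₀ j)) fuel (.randNum b e))
  | randElem b e =>
    exact dominated_const hM (costMono_exec hc (fun j => detOracle (a₀ j)) fuel (.randElem b e))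
  | query j b X l =>
    intro g hg s hs
    -- The answers ignore the random bits, so the expectation over them is that of a constant.
    simp only [exec, expect_map, detOracle, Option.elim_some, expect_const]
    set w : ℝ := 1 + b.ops s + X.ops s + l.ops s + c j ^ ⌊l.eval s⌋₊ with hw
    set f : Finset (Fin n) → State n := fun Y => (s.putSet ⌊b.eval s⌋₊ Y).charge w with hf
    change (∑ K ∈ 𝒦, g K (f (a K j (X.eval s) ⌊l.eval s⌋₊))) + _ ≤
      (∑ K ∈ 𝒦, g K (f (a₀ j (X.eval s) ⌊l.eval s⌋₊))) + ENNReal.ofReal (M * (s.cost + w))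
    have h1 : ∑ K ∈ 𝒦, g K (f (a K j (X.eval s) ⌊l.eval s⌋₊)) ≤
        ∑ K ∈ 𝒦, (g K (f (a₀ j (X.eval s) ⌊l.eval s⌋₊)) +
          if a K j (X.eval s) ⌊l.eval s⌋₊ ≠ a₀ j (X.eval s) ⌊l.eval s⌋₊ then 1 else 0) := by
      refine sum_le_sum fun K _ => ?_
      split_ifs with h
      · exact (hg _ _).trans le_add_self
      · rw [not_not.mp h, add_zero]
    have h2 : (#{K ∈ 𝒦 | a K j (X.eval s) ⌊l.eval s⌋₊ ≠ a₀ j (X.eval s) ⌊l.eval s⌋₊} : ℝ≥0∞) ≤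
        ENNReal.ofReal (M * c j ^ ⌊l.eval s⌋₊) := by
      rw [← ENNReal.ofReal_natCast]
      exact ENNReal.ofReal_le_ofReal (ha j _ _)
    have hcp : 0 ≤ c j ^ ⌊l.eval s⌋₊ := pow_nonneg (hc j) _
    have h3 : ENNReal.ofReal (M * c j ^ ⌊l.eval s⌋₊) + ENNReal.ofReal (M * s.cost) ≤
        ENNReal.ofReal (M * (s.cost + w)) := by
      rw [← ENNReal.ofReal_add (by positivity) (by positivity)]
      apply ENNReal.ofReal_le_ofReal
      have := b.ops_nonneg s
      have := X.ops_nonneg s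
      have := l.ops_nonneg s
      rw [← mul_add]
      apply mul_le_mul_of_nonneg_left _ hM
      rw [hw]; linarith
    rw [sum_add_distrib, sum_boole] at h1
    calc _ ≤ _ := add_le_add_left h1 _
      _ ≤ _ := by
        rw [add_assoc]
        exact add_le_add_right ((add_le_add_left h2 _).trans h3) _
  | seq P Q hP hQ => exact Dominated.andThen (costMono_exec hc _ _ _) hP hQ
  | ifLe e f P Q hP hQ =>
    intro g hg s hs
    have hch : ∀ s : State n, s.cost ≤ (s.charge (1 + e.ops s + f.ops s)).cost := fun s => by
      have := e.ops_nonneg s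
      have := f.ops_nonneg s
      simp [State.charge]; linarith
    simp only [exec]
    split_ifs
    · exact hP.comp hM hch g hg s hs
    · exact hQ.comp hM hch g hg s hs
  | whileLe e f P hP =>
    have hch : ∀ s : State n, s.cost ≤ (s.charge (1 + e.ops s + f.ops s)).cost := fun s => by
      have := e.ops_nonneg s
      have := f.ops_nonneg s
      simp [State.charge]; linarith
    exact dominated_whileIter hM hch (costMono_exec hc _ _ _) hP fuel
  | forDo i lo hi P hP =>
    intro g hg s hs
    have hch : ∀ s : State n, s.cost ≤ (s.charge (1 + lo.ops s + hi.ops s)).cost := fun s => by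
      have := lo.ops_nonneg s
      have := hi.ops_nonneg s
      simp [State.charge]; linarith
    have hput : ∀ (m : ℕ) (s' : State n),
        s'.cost ≤ ((s'.putNum i ((⌈lo.eval s⌉ : ℝ) + (m : ℝ))).charge 1).cost := fun m s' => by
      simp [State.charge, State.putNum]
    simp only [exec]
    exact (dominated_forIter hM
      (b₀ := fun m s' => exec c (fun j => detOracle (a₀ j)) fuel P
        ((s'.putNum i ((⌈lo.eval s⌉ : ℝ) + (m : ℝ))).charge 1))
      (fun m u u' hu => (hput m u).trans (costMono_exec hc _ _ _ _ _ hu))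
      (fun m => hP.comp hM (hput m)) _).comp hM hch g hg s hs

end Dominated

end

section

/-! ### The lower bound -/

section Adversary

variable {n : ℕ}

/-- A subset of the complement of `X` with `i` elements, if there is one. -/
noncomputable def pick (X : Finset (Fin n)) (i : ℕ) : Finset (Fin n) :=
  open Classical in if h : ∃ Y, Y ⊆ Xᶜ ∧ #Y = i then h.choose else ∅

lemma pick_spec (X : Finset (Fin n)) {i : ℕ} (hi : i ≤ n - #X) :
    pick X i ⊆ Xᶜ ∧ #(pick X i) = i := by
  have h : ∃ Y, Y ⊆ Xᶜ ∧ #Y = i := exists_subset_card_eq (by simpa [card_compl])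
  rw [pick, dif_pos h]
  exact h.choose_spec

/-- The sets that contain the hidden set, together with all sets with more than `b` elements and
the universe. -/
def hardFamily (b : ℝ) (K : Option (Finset (Fin n))) : Set (Finset (Fin n)) :=
  {S | (∃ K' ∈ K, K' ⊆ S) ∨ b < #S ∨ S = univ}

lemma isMonotone_hardFamily (b : ℝ) (K : Option (Finset (Fin n))) :
    IsMonotone (hardFamily b K) := by
  refine ⟨Or.inr (Or.inr rfl), ?_⟩
  rintro S T hST (⟨K', hK, h⟩ | h | rfl)
  · exact Or.inl ⟨K', hK, h.trans hST⟩
  · exact Or.inr (Or.inl (h.trans_le (by exact_mod_cast card_le_card hST)))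
  · exact Or.inr (Or.inr (univ_subset_iff.mp hST))

/-- The answers of an oracle that reveals as little as possible about the hidden set. -/
noncomputable def adversary (α b : ℝ) (K : Option (Finset (Fin n))) (X : Finset (Fin n)) (l : ℕ) :
    Finset (Fin n) :=
  open Classical in
  if ((⌊α * l⌋₊ + #X : ℕ) : ℝ) ≤ b then
    K.elim Xᶜ fun K' => if #(K' \ X) ≤ l then K' \ X else Xᶜ
  else pick X (min ⌊α * l⌋₊ (n - #X))

lemma card_compl_le_of_union_eq_univ {X S : Finset (Fin n)} (h : X ∪ S = univ) : #Xᶜ ≤ #S := by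
  refine card_le_card fun x hx => ?_
  have : x ∈ X ∪ S := h ▸ mem_univ x
  rw [mem_compl] at hx
  rw [mem_union] at this
  tauto

/-- Outside the revealing range the answer fills `X` up to more than `b` elements or to the
universe. Inside it, an l-extension S leaves `X ∪ S` with at most `b` elements, so the union
contains the hidden set or is the universe; hence the set that is still missing has at most `l`
elements and is the answer. If no l-extension exists, the complement is legal at any size. -/
lemma isExtensionOracle_adversary {α : ℝ} (hα : 1 ≤ α) (b : ℝ) (K : Option (Finset (Fin n))) :
    IsExtensionOracle (hardFamily b K) α (detOracle (adversary α b K)) := by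
  have hpick : ∀ (X : Finset (Fin n)) (l : ℕ), ¬ ((⌊α * l⌋₊ + #X : ℕ) : ℝ) ≤ b →
      pick X (min ⌊α * l⌋₊ (n - #X)) ∪ X ∈ hardFamily b K := by
    intro X l h
    obtain ⟨h1, h2⟩ := pick_spec X (min_le_right ⌊α * l⌋₊ (n - #X))
    have hd : Disjoint (pick X (min ⌊α * l⌋₊ (n - #X))) X :=
      disjoint_left.mpr fun x hx => by simpa using h1 hx
    have hc := card_union_of_disjoint hd
    rw [h2] at hc
    have hX : #X ≤ n := by simpa using card_le_univ X
    rcases le_total ⌊α * l⌋₊ (n - #X) with h3 | h3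
    · rw [min_eq_left h3] at hc ⊢
      refine Or.inr (Or.inl ?_)
      rw [hc]; exact not_le.mp h
    · rw [min_eq_right h3] at hc ⊢
      refine Or.inr (Or.inr ?_)
      rw [← card_eq_iff_eq_univ, hc, Fintype.card_fin]; omega
  have hmem : ∀ X l, adversary α b K X l ∪ X ∈ hardFamily b K := by
    intro X l
    unfold adversary
    split_ifs with h
    · have hcompl : Xᶜ ∪ X ∈ hardFamily b K :=
        Or.inr (Or.inr (by rw [union_comm]; exact union_compl X))
      cases K with
      | none => exact hcompl
      | some K' =>
        simp only [Option.elim_some]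
        split_ifs
        · exact Or.inl ⟨K', rfl, by rw [sdiff_union_self_eq_union]; exact subset_union_left⟩
        · exact hcompl
    · exact hpick X l h
  refine ⟨fun X l _ => hmem X l, fun X l hex => ?_⟩
  have hl : (l : ℝ) ≤ α * l := by nlinarith [Nat.cast_nonneg (α := ℝ) l]
  have hle : (#(adversary α b K X l) : ℝ) ≤ α * l := by
    obtain ⟨S, hS, hSl⟩ := hex
    have hSl' : #S ≤ l := by exact_mod_cast hSl
    unfold adversary
    split_ifs with h
    · have hn : ¬ b < #(X ∪ S) := by
        intro hb
        have h1 : l ≤ ⌊α * l⌋₊ := Nat.le_floor hl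
        have h2 := card_union_le X S
        have h3 : #(X ∪ S) ≤ ⌊α * l⌋₊ + #X := by omega
        have h4 : (#(X ∪ S) : ℝ) ≤ ((⌊α * l⌋₊ + #X : ℕ) : ℝ) := by exact_mod_cast h3
        linarith
      cases K with
      | none =>
        rcases hS with ⟨K', hK', -⟩ | hS | hS
        · simp at hK'
        · exact absurd hS hn
        · refine le_trans ?_ hl
          exact_mod_cast (card_compl_le_of_union_eq_univ hS).trans hSl'
      | some K' =>
        have hsub : K' ⊆ X ∪ S := by
          rcases hS with ⟨K'', hK', h⟩ | hS | hS
          · simp at hK'; rwa [hK']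
          · exact absurd hS hn
          · rw [hS]; exact subset_univ _
        have hcard : #(K' \ X) ≤ l := (card_le_card (by
          rw [sdiff_le_iff]; exact hsub)).trans hSl'
        simp only [Option.elim_some, if_pos hcard]
        exact le_trans (by exact_mod_cast hcard) hl
    · rw [(pick_spec X (min_le_right _ _)).2]
      calc _ ≤ ((⌊α * l⌋₊ : ℕ) : ℝ) := by exact_mod_cast min_le_left _ _
        _ ≤ _ := Nat.floor_le (by linarith [Nat.cast_nonneg (α := ℝ) l])
  have hall : ∀ r : Fin (detOracle (adversary α b K)).m → Bool,
      IsExtension (hardFamily b K) (α * l) X ((detOracle (adversary α b K)).ans X l r) :=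
    fun r => ⟨by rw [union_comm]; exact hmem X l, hle⟩
  have : Nat.card {r : Fin (detOracle (adversary α b K)).m → Bool //
      IsExtension (hardFamily b K) (α * l) X ((detOracle (adversary α b K)).ans X l r)} =
      Nat.card (Fin (detOracle (adversary α b K)).m → Bool) :=
    Nat.card_congr (Equiv.subtypeUnivEquiv hall)
  rw [this]
  have := Nat.cast_nonneg (α := ℝ) (Nat.card (Fin (detOracle (adversary α b K)).m → Bool))
  linarith

lemma adversary_some_eq {α b : ℝ} {K X : Finset (Fin n)} {l : ℕ}
    (h : ¬ (((⌊α * l⌋₊ + #X : ℕ) : ℝ) ≤ b ∧ #(K \ X) ≤ l)) :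
    adversary α b (some K) X l = adversary α b none X l := by
  unfold adversary
  split_ifs with h1
  · have : ¬ #(K \ X) ≤ l := fun h2 => h ⟨h1, h2⟩
    simp [this]
  · rfl

end Adversary

variable {L : Finset (ℝ × ℝ)} {β : ℝ} {S n k : ℕ} {v : ℝ}

/-- Bounds the number of hidden sets that one query can distinguish from the reference. There are at
most `n + 1` intersection sizes, and the floor in the hypothesis breaks the constraint by less than
one. -/
lemma HypBound.card_le (hL : IsSpecList L) (hβ : 1 ≤ β)
    (hS : ∀ j ∈ L, j.1 = 1 ∨ 1 ≤ (j.1 - 1) * S) (hk : k ≤ n) (hv : 0 ≤ v)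
    (H : HypBound L β n k v) {j : ℝ × ℝ} (hj : j ∈ L) (X : Finset (Fin n)) (l : ℕ)
    (h : ((⌊j.1 * l⌋₊ + #X : ℕ) : ℝ) ≤ β * k) :
    (#{K ∈ powersetCard k (univ : Finset (Fin n)) | #(K \ X) ≤ l} : ℝ) ≤
      ((n + 1 : ℕ) * ((n + 1) ^ (2 * (S + 1)) : ℕ) * v * n.choose k) * j.2 ^ l := by
  have hX : #X ≤ n := by simpa using card_le_univ X
  have e : {K ∈ powersetCard k (univ : Finset (Fin n)) | #(K \ X) ≤ l} =
      {K ∈ powersetCard k (univ : Finset (Fin n)) | k - l ≤ #(K ∩ X)} := by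
    refine filter_congr fun K hK => ?_
    have h1 := (mem_powersetCard.mp hK).2
    have := card_inter_add_card_sdiff K X
    omega
  obtain ⟨hα, hc⟩ := hL.2 j hj
  have hc0 : 0 ≤ j.2 := by linarith
  rw [e, card_filter_le_card_inter X hk, ← tail_comm hk hX]
  have hsum : tail n k #X (k - l) ≤
      (n + 1 : ℕ) * (((n + 1) ^ (2 * (S + 1)) : ℕ) * v * j.2 ^ l) := by
    unfold tail
    have hterm : ∀ i ∈ Icc (k - l) (min #X k),
        hyp n k #X i ≤ ((n + 1) ^ (2 * (S + 1)) : ℕ) * v * j.2 ^ l := by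
      intro i hi
      rw [mem_Icc, le_min_iff] at hi
      have hkl : ((k - i : ℕ) : ℝ) ≤ l := by
        have : k - i ≤ l := by omega
        exact_mod_cast this
      refine (H.of_lt hL hβ hS hv hk hj hi.2.2 hi.2.1 hX ?_).trans ?_
      · have h1 := Nat.lt_floor_add_one (j.1 * (l : ℝ))
        push_cast at h
        have : j.1 * ((k - i : ℕ) : ℝ) ≤ j.1 * l := by gcongr
        linarith
      · have : k - i ≤ l := by omega
        gcongr
    refine (sum_le_card_nsmul _ _ _ hterm).trans ?_
    rw [nsmul_eq_mul]
    have hcard : #(Icc (k - l) (min #X k)) ≤ n + 1 := by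
      rw [Nat.card_Icc]; omega
    have : (#(Icc (k - l) (min #X k)) : ℝ) ≤ (n + 1 : ℕ) := by exact_mod_cast hcard
    gcongr
  calc _ ≤ (n.choose k : ℝ) * ((n + 1 : ℕ) * (((n + 1) ^ (2 * (S + 1)) : ℕ) * v * j.2 ^ l)) := by
        gcongr
    _ = _ := by ring

/-- With positive probability, a `β`-approximation finds a small superset of the hidden set. -/
lemma Algorithm.IsApprox.exists_fuel {A : Algorithm L} (hA : A.IsApprox β) (hβ : 0 ≤ β)
    {K : Finset (Fin n)} (hK : #K = k) {O : L → OracleFun n}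
    (hO : ∀ j : L, IsExtensionOracle (hardFamily (β * k) (some K)) j.1.1 (O j)) :
    ∃ fuel, ∀ fuel' ≥ fuel, (1 / 4 : ℝ≥0∞) ≤ expect (A.run O fuel') fun o =>
      o.elim 0 fun s : State n => open Classical in
        if K ⊆ s.set 0 ∧ (#(s.set 0) : ℝ) ≤ β * k then 1 else 0 := by
  classical
  set F := hardFamily (β * k) (some K) with hF
  obtain ⟨h1, h2⟩ := hA n F (isMonotone_hardFamily _ _) O hO
  -- The probabilities are suprema over the fuel, so values slightly below 1 and 1/2 are exceeded at
  -- finite fuel; 7/8 + 3/8 - 1 = 1/4 remains for both events together.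
  have h3 : (7 / 8 : ℝ≥0∞) < A.prob O fun S => S ∈ F := by
    rw [h1, ENNReal.div_lt_iff (by simp) (by simp)]; norm_num
  have h4 : (3 / 8 : ℝ≥0∞) < A.prob O fun S => (#S : ℝ) ≤ β * (minSize F : ℝ) := by
    refine lt_of_lt_of_le ?_ h2
    rw [ENNReal.div_lt_iff (by simp) (by simp), one_div, show (8 : ℝ≥0∞) = 2 * 4 by norm_num,
      ← mul_assoc, ENNReal.inv_mul_cancel (by simp) (by simp)]
    norm_num
  obtain ⟨f1, h3⟩ := lt_iSup_iff.mp h3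
  obtain ⟨f2, h4⟩ := lt_iSup_iff.mp h4
  have hmin : minSize F ≤ k := Nat.sInf_le ⟨K, Or.inl ⟨K, rfl, subset_rfl⟩, hK⟩
  refine ⟨max f1 f2, fun f hf => ?_⟩
  rw [toOuterMeasure_eq_expect] at h3 h4
  have hind : ∀ p : Finset (Fin n) → Prop,
      ({o | ∃ s : State n, o = some s ∧ p (s.set 0)} : Set (Option (State n))).indicator
        (1 : Option (State n) → ℝ≥0∞) none = 0 := fun p => by simp
  have h3' := h3.le.trans ((outcomeLE_exec _ O ((le_max_left f1 f2).trans hf) A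
    (State.init n)).expect_le (hind fun S => S ∈ F))
  have h4' := h4.le.trans ((outcomeLE_exec _ O ((le_max_right f1 f2).trans hf) A
    (State.init n)).expect_le (hind fun S => (#S : ℝ) ≤ β * (minSize F : ℝ)))
  have h5 := add_le_add h3' h4'
  rw [← expect_add] at h5
  have h6 : (7 / 8 : ℝ≥0∞) + 3 / 8 = 1 / 4 + 1 := by
    rw [← ENNReal.toReal_eq_toReal_iff' (by simp [ENNReal.div_eq_top]) (by simp),
      ENNReal.toReal_add (by simp [ENNReal.div_eq_top]) (by simp [ENNReal.div_eq_top]),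
      ENNReal.toReal_add (by simp) (by simp)]
    simp only [ENNReal.toReal_div, ENNReal.toReal_ofNat, ENNReal.toReal_one]
    norm_num
  rw [h6] at h5
  refine ENNReal.le_of_add_le_add_right ENNReal.one_ne_top (h5.trans ?_)
  refine le_trans ?_ (add_le_add_right (expect_const (A.run O f) 1).le _)
  rw [← expect_add]
  refine expect_mono_support fun o _ => ?_
  cases o with
  | none => simp
  | some s =>
    simp only [Set.indicator, Set.mem_ofPred_eq, Option.some.injEq, exists_eq_left',
      Pi.one_apply, Option.elim_some]
    by_cases ha : s.set 0 ∈ F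
    · by_cases hb : (#(s.set 0) : ℝ) ≤ β * (minSize F : ℝ)
      · have hb' : (#(s.set 0) : ℝ) ≤ β * k := hb.trans (by gcongr)
        have hKs : K ⊆ s.set 0 := by
          rcases ha with ⟨K', hK', h⟩ | h | h
          · simp at hK'; rwa [hK']
          · linarith
          · rw [h]; exact subset_univ _
        simp [ha, hb, hb', hKs]
      · simp [ha, hb]
    · simp only [ha, if_false, zero_add]
      split_ifs <;> simp

/-- Summed over all hidden sets, the success probabilities are at least `n.choose k / 4`. By
domination they sum to at most M for the final output plus M times the cost of the reference run.
Since M contains the factor `v * n.choose k`, the binomial coefficient cancels. -/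
theorem one_le_mul_cost (hL : IsSpecList L) (hβ : 1 ≤ β)
    (hS : ∀ j ∈ L, j.1 = 1 ∨ 1 ≤ (j.1 - 1) * S) (hk : β * k ≤ n) (hv : 0 ≤ v)
    (H : HypBound L β n k v) {A : Algorithm L} (hA : A.IsApprox β) (hT : A.cost n ≠ ⊤) :
    1 ≤ (8 * (n + 1) ^ (2 * (S + 1) + 1) : ℕ) * v * (A.cost n).toReal := by
  classical
  have hkn := le_of_mul_le hβ hk
  set M : ℝ := (n + 1 : ℕ) * ((n + 1) ^ (2 * (S + 1)) : ℕ) * v * n.choose k with hM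
  have hM0 : 0 ≤ M := by positivity
  have hcount := fun {j : ℝ × ℝ} (hj : j ∈ L) => H.card_le hL hβ hS hkn hv hj
  set 𝒦 := powersetCard k (univ : Finset (Fin n)) with h𝒦
  let a : Finset (Fin n) → L → Finset (Fin n) → ℕ → Finset (Fin n) :=
    fun K j => adversary j.1.1 (β * k) (some K)
  let a₀ : L → Finset (Fin n) → ℕ → Finset (Fin n) := fun j => adversary j.1.1 (β * k) none
  have hc : ∀ j : L, 0 ≤ j.1.2 := fun j => by linarith [(hL.2 j.1 j.2).2]
  have hO : ∀ K j, IsExtensionOracle (hardFamily (β * k) (some K)) j.1.1 (detOracle (a K j)) :=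
    fun K j => isExtensionOracle_adversary (hL.2 j.1 j.2).1 _ _
  have hO₀ : ∀ j, IsExtensionOracle (hardFamily (β * k) none) j.1.1 (detOracle (a₀ j)) :=
    fun j => isExtensionOracle_adversary (hL.2 j.1 j.2).1 _ _
  have ha : ∀ (j : L) X l, (#{K ∈ 𝒦 | a K j X l ≠ a₀ j X l} : ℝ) ≤ M * j.1.2 ^ l := by
    intro j X l
    by_cases h : ((⌊j.1.1 * l⌋₊ + #X : ℕ) : ℝ) ≤ β * k
    · refine le_trans ?_ (hcount j.2 X l h)
      have : #{K ∈ 𝒦 | a K j X l ≠ a₀ j X l} ≤ #{K ∈ 𝒦 | #(K \ X) ≤ l} := by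
        refine card_le_card fun K hK => ?_
        rw [mem_filter] at hK ⊢
        refine ⟨hK.1, ?_⟩
        by_contra hcon
        exact hK.2 (adversary_some_eq fun h' => hcon h'.2)
      exact_mod_cast this
    · have : {K ∈ 𝒦 | a K j X l ≠ a₀ j X l} = ∅ :=
        filter_eq_empty_iff.mpr fun K _ => not_not.mpr (adversary_some_eq fun h' => h h'.1)
      rw [this, card_empty, Nat.cast_zero]
      exact mul_nonneg hM0 (pow_nonneg (hc j) l)
  let g : Finset (Fin n) → State n → ℝ≥0∞ := fun K s =>
    if K ⊆ s.set 0 ∧ (#(s.set 0) : ℝ) ≤ β * k then 1 else 0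
  have hg : ∀ K s, g K s ≤ 1 := fun K s => by simp only [g]; split_ifs <;> simp
  -- A small output acts like one more revealing query, with `l = 0`.
  have hgsum : ∀ s, ∑ K ∈ 𝒦, g K s ≤ ENNReal.ofReal M := by
    intro s
    simp only [g, sum_boole]
    by_cases hs : (#(s.set 0) : ℝ) ≤ β * k
    · obtain ⟨j, hj⟩ := hL.1
      have h1 := hcount hj (s.set 0) 0 (by simpa using hs)
      rw [pow_zero, mul_one] at h1
      rw [← ENNReal.ofReal_natCast]
      refine ENNReal.ofReal_le_ofReal (le_trans ?_ h1)
      have : #{K ∈ 𝒦 | K ⊆ s.set 0 ∧ (#(s.set 0) : ℝ) ≤ β * k} ≤ #{K ∈ 𝒦 | #(K \ s.set 0) ≤ 0} :=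
        card_le_card fun K hK => by
          rw [mem_filter] at hK ⊢
          refine ⟨hK.1, ?_⟩
          rw [sdiff_eq_empty_iff_subset.mpr hK.2.1]; simp
      exact_mod_cast this
    · simp [hs]
  -- The cost of the reference run is an infimum over the fuel; ε provides the strict inequality
  -- from which a fuel is extracted.
  have key : ∀ ε : ℝ, 0 < ε → (n.choose k : ℝ) * (1 / 4) ≤ 2 * M * ((A.cost n).toReal + ε) := by
    intro ε hε
    set T : ℝ := (A.cost n).toReal + ε with hTdef
    have hT0 : 0 < T := by positivity
    have hcost : A.execCost (fun j => detOracle (a₀ j)) < ENNReal.ofReal T := by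
      refine lt_of_le_of_lt (b := A.cost n) ?_ ?_
      · exact le_iSup_of_le n <| le_iSup_of_le le_rfl <|
          le_iSup_of_le (hardFamily (β * k) none) <| le_iSup_of_le (isMonotone_hardFamily _ _) <|
          le_iSup_of_le (fun j => detOracle (a₀ j)) <| le_iSup_of_le hO₀ le_rfl
      · rw [ENNReal.lt_ofReal_iff_toReal_lt hT]; linarith
    obtain ⟨f₀, hf₀⟩ := iInf_lt_iff.mp hcost
    have hsupp : ∀ o ∈ (A.run (fun j => detOracle (a₀ j)) f₀).support,
        ∃ s, o = some s ∧ s.cost ≤ T := by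
      intro o ho
      have h1 := (le_iSup₂ (f := fun o _ => o.elim ⊤ fun s : State n => ENNReal.ofReal s.cost)
        o ho).trans hf₀.le
      cases o with
      | none => simp at h1
      | some s => exact ⟨s, rfl, (ENNReal.ofReal_le_ofReal_iff hT0.le).mp h1⟩
    have hex : ∀ K : Finset (Fin n), ∃ fuel, #K = k → ∀ fuel' ≥ fuel,
        (1 / 4 : ℝ≥0∞) ≤ expect (A.run (fun j => detOracle (a K j)) fuel') fun o =>
          o.elim 0 (g K) := by
      intro K
      by_cases hK : #K = k
      · obtain ⟨f, hf⟩ := hA.exists_fuel (by linarith) hK (hO K)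
        exact ⟨f, fun _ => hf⟩
      · exact ⟨0, fun h => absurd h hK⟩
    choose fK hfK using hex
    -- Enough fuel for all hidden sets at once; the reference run already ends within `f₀`.
    set f := max f₀ (𝒦.sup fK) with hf
    have hrun : A.run (fun j => detOracle (a₀ j)) f = A.run (fun j => detOracle (a₀ j)) f₀ :=
      ((outcomeLE_exec _ _ (le_max_left _ _) A _).eq fun hnone => by
        obtain ⟨s, hs, -⟩ := hsupp none hnone; simp at hs).symm
    have hdom := dominated_exec hM0 hc ha f A g hg (State.init n) le_rfl
    have h1 : (n.choose k : ℝ≥0∞) * (1 / 4) ≤ ∑ K ∈ 𝒦,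
        expect (A.run (fun j => detOracle (a K j)) f) fun o => o.elim 0 (g K) := by
      have : ∑ K ∈ 𝒦, (1 / 4 : ℝ≥0∞) = (n.choose k : ℝ≥0∞) * (1 / 4) := by
        rw [sum_const, h𝒦, card_powersetCard, card_univ, Fintype.card_fin, nsmul_eq_mul]
      rw [← this]
      exact sum_le_sum fun K hK => hfK K (mem_powersetCard.mp hK).2 f
        ((le_sup hK).trans (le_max_right _ _))
    obtain ⟨o, ho⟩ := (A.run (fun j => detOracle (a₀ j)) f₀).support_nonempty
    obtain ⟨s, rfl, hsT⟩ := hsupp o ho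
    -- Needed to absorb the contribution M of the output into M * T.
    have hs1 : 1 ≤ T := by
      have := add_one_le_cost hc _ _ A _ s ho
      have h0 : (State.init n).cost = 0 := rfl
      linarith
    have h2 : (expect (A.run (fun j => detOracle (a₀ j)) f) fun o => o.elim ⊤ fun s' =>
        (∑ K ∈ 𝒦, g K s') + ENNReal.ofReal (M * s'.cost)) ≤ ENNReal.ofReal (2 * M * T) := by
      rw [hrun]
      refine expect_le_of_support fun o ho => ?_
      obtain ⟨s, rfl, hsT⟩ := hsupp o ho
      simp only [Option.elim_some]
      calc _ ≤ ENNReal.ofReal M + ENNReal.ofReal (M * T) := by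
            gcongr
            exact hgsum s
        _ = ENNReal.ofReal (M + M * T) := (ENNReal.ofReal_add hM0 (by positivity)).symm
        _ ≤ _ := ENNReal.ofReal_le_ofReal (by nlinarith)
    have h3 := h1.trans (le_self_add.trans (hdom.trans h2))
    have h4 : (n.choose k : ℝ≥0∞) * (1 / 4) = ENNReal.ofReal (n.choose k * (1 / 4)) := by
      rw [ENNReal.ofReal_mul (by positivity), ENNReal.ofReal_natCast]
      congr 1
      rw [ENNReal.ofReal_div_of_pos (by norm_num)]; simp
    rw [h4] at h3
    exact (ENNReal.ofReal_le_ofReal_iff (by positivity)).mp h3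
  have hchoose : (0 : ℝ) < n.choose k := by exact_mod_cast Nat.choose_pos hkn
  set Q : ℝ := (8 * (n + 1) ^ (2 * (S + 1) + 1) : ℕ) * v with hQ
  have hQ0 : 0 ≤ Q := by positivity
  have key2 : ∀ ε : ℝ, 0 < ε → 1 ≤ Q * ((A.cost n).toReal + ε) := by
    intro ε hε
    have h := key ε hε
    have e : 2 * M * ((A.cost n).toReal + ε) =
        n.choose k * ((1 / 4) * (Q * ((A.cost n).toReal + ε))) := by
      rw [hM, hQ]; push_cast; ring
    rw [e] at h
    have := le_of_mul_le_mul_left h hchoose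
    linarith
  by_contra hcon
  rw [not_le] at hcon
  -- This ε makes Q * ε at most half of the gap that is to be refuted.
  have h := key2 ((1 - Q * (A.cost n).toReal) / (2 * (Q + 1))) (div_pos (by linarith) (by linarith))
  rw [mul_add] at h
  have h5 : Q * ((1 - Q * (A.cost n).toReal) / (2 * (Q + 1))) ≤
      (1 - Q * (A.cost n).toReal) / 2 := by
    rw [mul_div_assoc', div_le_div_iff₀ (by linarith) (by norm_num)]
    nlinarith
  linarith

end

/-! ### Lower bounds on the cost in terms of the objective -/

section

variable {L : Finset (ℝ × ℝ)} {β : ℝ} {S n k : ℕ}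

theorem le_mul_cost_of_le_obj (hL : IsSpecList L) (hβ : 1 ≤ β)
    (hS : ∀ j ∈ L, j.1 = 1 ∨ 1 ≤ (j.1 - 1) * S) (hk : β * k ≤ n) {cmax Φ : ℝ}
    (hcmax : ∀ j ∈ L, j.2 ≤ cmax) (hcmax0 : 0 ≤ cmax) (hΦ : 0 < Φ)
    (h : ∀ j ∈ L, ∀ t, ValidT j.1 β k t → Φ ≤ obj j.1 j.2 β n k t)
    {A : Algorithm L} (hA : A.IsApprox β) (hT : A.cost n ≠ ⊤) :
    Φ ≤ (8 * (n + 1) ^ (2 * (S + 1) + 1) : ℕ) * cmax * (A.cost n).toReal := by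
  have := one_le_mul_cost hL hβ hS hk (by positivity) (hypBound_of_le_obj hL hβ hk hcmax hΦ h) hA hT
  rw [← mul_div_assoc, div_mul_eq_mul_div, le_div_iff₀ hΦ, one_mul] at this
  exact this

/-- On universes with `n * m` elements the adversary bound reads 1 ≤ poly(m) * z ^ m, where z does
not involve the polynomial of the algorithm. If z were less than one, this would fail for large `m`.
-/
theorem le_mul_pow_of_le_obj (hL : IsSpecList L) (hβ : 1 ≤ β)
    (hS : ∀ j ∈ L, j.1 = 1 ∨ 1 ≤ (j.1 - 1) * S) (hk : β * k ≤ n) {cmax Φ : ℝ}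
    (hcmax : ∀ j ∈ L, j.2 ≤ cmax) (hcmax0 : 0 ≤ cmax) (hΦ : 0 < Φ)
    (h : ∀ j ∈ L, ∀ t, ValidT j.1 β k t → Φ ≤ obj j.1 j.2 β n k t)
    {A : Algorithm L} (hA : A.IsApprox β) {d : ℝ} (hd : 1 ≤ d) (hAd : A.HasCostBase d) :
    Φ ≤ (4 * (n + 1) ^ 5 * (n + 1) ^ (2 * (S + 1)) : ℕ) * cmax * d ^ n := by
  obtain ⟨C, hC⟩ := hAd
  set Q : ℝ := ((4 * (n + 1) ^ 5 * (n + 1) ^ (2 * (S + 1)) : ℕ) : ℝ) with hQ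
  set z : ℝ := Q * (cmax / Φ) * d ^ n with hz
  have hv : 0 ≤ cmax / Φ := by positivity
  have hz0 : 0 ≤ z := by positivity
  -- The degree in m: the first two terms come from the adversary bound, `C` from the cost of the
  -- algorithm.
  set E := 2 * (S + 1) + 1 + C with hE
  have hbound : ∀ m : ℕ, 0 < m → 1 ≤ (8 * C * (n + 1) ^ E : ℝ) * ((m : ℝ) ^ E * z ^ m) := by
    intro m hm
    have hm1 : (1 : ℝ) ≤ m := by exact_mod_cast hm
    have H := (hypBound_of_le_obj hL hβ hk hcmax hΦ h).mul hL hβ hS hv (le_of_mul_le hβ hk) hm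
    have hkm : β * ((k * m : ℕ) : ℝ) ≤ ((n * m : ℕ) : ℝ) := by
      push_cast; rw [← mul_assoc]; gcongr
    have hcost := hC (n * m)
    have hT : A.cost (n * m) ≠ ⊤ := ne_top_of_le_ne_top ENNReal.ofReal_ne_top hcost
    have h1 := one_le_mul_cost hL hβ hS hkm (by positivity) H hA hT
    have h2 : (A.cost (n * m)).toReal ≤ C * (((n * m : ℕ) : ℝ) + 1) ^ C * d ^ (n * m) :=
      ENNReal.toReal_le_of_le_ofReal (by positivity) hcost
    have h3 : ((n * m : ℕ) : ℝ) + 1 ≤ (n + 1) * m := by push_cast; nlinarith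
    calc (1 : ℝ) ≤ _ := h1
      _ ≤ (8 * (((n * m : ℕ) : ℝ) + 1) ^ (2 * (S + 1) + 1)) * (Q * (cmax / Φ)) ^ m *
          (C * (((n * m : ℕ) : ℝ) + 1) ^ C * d ^ (n * m)) := by
        have e : ((8 * (n * m + 1) ^ (2 * (S + 1) + 1) : ℕ) : ℝ) =
          8 * (((n * m : ℕ) : ℝ) + 1) ^ (2 * (S + 1) + 1) := by push_cast; ring
        rw [e]
        gcongr
      _ = (8 * C * (((n * m : ℕ) : ℝ) + 1) ^ E) * z ^ m := by
        rw [hz, mul_pow _ (d ^ n), ← pow_mul, hE, pow_add _ _ C]; ring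
      _ ≤ (8 * C * ((n + 1) * m) ^ E) * z ^ m := by gcongr
      _ = _ := by rw [mul_pow]; ring
  have hz1 : 1 ≤ z := by
    by_contra hcon
    have ht := tendsto_pow_const_mul_const_pow_of_abs_lt_one E (r := z)
      (by rw [abs_of_nonneg hz0]; exact not_le.mp hcon)
    have ht' := ht.const_mul (8 * C * (n + 1) ^ E : ℝ)
    rw [mul_zero] at ht'
    obtain ⟨m, hm1, hm2⟩ := ((ht'.eventually_lt_const one_pos).and
      (Filter.eventually_gt_atTop 0)).exists
    exact absurd (hbound m hm2) (not_le.mpr hm1)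
  rw [hz, ← mul_div_assoc, div_mul_eq_mul_div, le_div_iff₀ hΦ, one_mul] at hz1
  exact hz1

/-- The constants depend on no algorithm and the inequality is closed in `d`, so it passes to the
infimum, attained or not. -/
theorem le_mul_best_pow_of_le_obj (hL : IsSpecList L) (hβ : 1 ≤ β)
    (hS : ∀ j ∈ L, j.1 = 1 ∨ 1 ≤ (j.1 - 1) * S) (hk : β * k ≤ n) {cmax Φ : ℝ}
    (hcmax : ∀ j ∈ L, j.2 ≤ cmax) (hcmax0 : 0 ≤ cmax) (hΦ : 0 < Φ)
    (h : ∀ j ∈ L, ∀ t, ValidT j.1 β k t → Φ ≤ obj j.1 j.2 β n k t)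
    (hne : {d : ℝ | 1 ≤ d ∧ ∃ A : Algorithm L, A.IsApprox β ∧ A.HasCostBase d}.Nonempty) :
    Φ ≤ (4 * (n + 1) ^ 5 * (n + 1) ^ (2 * (S + 1)) : ℕ) * cmax * best L β ^ n := by
  have hbdd : BddBelow {d : ℝ | 1 ≤ d ∧ ∃ A : Algorithm L, A.IsApprox β ∧ A.HasCostBase d} :=
    ⟨1, fun d hd => hd.1⟩
  have hmem := csInf_mem_closure hne hbdd
  have hclosed : IsClosed {d : ℝ | Φ ≤
      (4 * (n + 1) ^ 5 * (n + 1) ^ (2 * (S + 1)) : ℕ) * cmax * d ^ n} :=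
    isClosed_le continuous_const (by fun_prop)
  exact closure_minimal (fun d hd => by
    obtain ⟨h1, A, hA, hAd⟩ := hd
    exact le_mul_pow_of_le_obj hL hβ hS hk hcmax hcmax0 hΦ h hA h1 hAd) hclosed hmem

lemma one_le_best
    (hne : {d : ℝ | 1 ≤ d ∧ ∃ A : Algorithm L, A.IsApprox β ∧ A.HasCostBase d}.Nonempty) :
    1 ≤ best L β :=
  le_csInf hne fun _ hd => hd.1

end

section

/-! ### Evaluation of the expressions of the algorithm -/

section Eval

variable {n : ℕ}

@[simp] lemma NExp.eval_reg (i : ℕ) (s : State n) : (NExp.reg i).eval s = s.num i := by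
  simp [NExp.reg, NExp.eval]

@[simp] lemma NExp.ops_reg (i : ℕ) (s : State n) : (NExp.reg i).ops s = 2 := by
  simp [NExp.reg, NExp.ops]; norm_num

@[simp] lemma SExp.eval_reg (i : ℕ) (s : State n) : (SExp.reg i).eval s = s.set i := by
  simp [SExp.reg, SExp.eval, NExp.eval]

@[simp] lemma SExp.ops_reg (i : ℕ) (s : State n) : (SExp.reg i).ops s = n + 2 := by
  simp [SExp.reg, SExp.ops, NExp.ops]; ring

lemma image_natCast_Icc (a b : ℕ) :
    (Icc a b).image (fun i : ℕ => (i : ℤ)) = Icc (a : ℤ) (b : ℤ) := by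
  ext y
  simp only [mem_image, mem_Icc]
  constructor
  · rintro ⟨i, hi, rfl⟩; omega
  · intro h; exact ⟨y.toNat, by omega, by omega⟩

lemma sum_Icc_natCast {R : Type*} [AddCommMonoid R] (a b : ℕ) (f : ℤ → R) :
    ∑ y ∈ Icc (a : ℤ) (b : ℤ), f y = ∑ i ∈ Icc a b, f i := by
  rw [← image_natCast_Icc, sum_image fun x _ y _ h => by exact_mod_cast h]

lemma prod_Icc_natCast {R : Type*} [CommMonoid R] (a b : ℕ) (f : ℤ → R) :
    ∏ y ∈ Icc (a : ℤ) (b : ℤ), f y = ∏ i ∈ Icc a b, f i := by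
  rw [← image_natCast_Icc, prod_image fun x _ y _ h => by exact_mod_cast h]

/-- In reverse order the numerators form the falling factorial A (A - 1) ⋯ (A - B + 1). -/
lemma prod_div_eq_choose (A B : ℕ) :
    ∏ i ∈ Icc 1 B, (((A : ℝ) - B + i) / i) = A.choose B := by
  have h1 : ∏ i ∈ range B, (((A : ℝ) - i) / (i + 1)) = A.choose B := by
    induction B with
    | zero => simp
    | succ B ih =>
      rw [prod_range_succ, ih, mul_div_assoc', div_eq_iff (by positivity)]
      have := Nat.choose_succ_right_eq A B
      rcases le_or_gt B A with h | h
      · rw [← Nat.cast_sub h]; exact_mod_cast this.symm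
      · rw [Nat.choose_eq_zero_of_lt h, Nat.choose_eq_zero_of_lt (by omega)]; simp
  rw [← h1, prod_div_distrib, prod_div_distrib, ← Ico_succ_right_eq_Icc, prod_Ico_eq_prod_range,
    prod_Ico_eq_prod_range]
  congr 1
  · rw [← prod_range_reflect]
    refine prod_congr (by simp) fun i hi => ?_
    simp only [mem_range, Order.succ_eq_add_one, Nat.add_sub_cancel] at hi ⊢
    have : B - 1 - i + (i + 1) = B := by omega
    have : ((B - 1 - i : ℕ) : ℝ) + (i + 1) = B := by exact_mod_cast this
    push_cast
    linarith
  · refine prod_congr (by simp) fun i _ => ?_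
    push_cast; ring

/-- The last two hypotheses express that the bound variable of the product, cell 9, does not occur
in `a` and `b`. -/
lemma chooseE_eval {a b : NExp} {s : State n} {A B : ℕ} (hb : b.eval s = B)
    (ha : ∀ y : ℝ, a.eval (s.putNum 9 y) = A) (hb' : ∀ y : ℝ, b.eval (s.putNum 9 y) = B) :
    (chooseE a b).eval s = A.choose B := by
  have h1 : ⌈(NExp.const 1).eval s⌉ = ((1 : ℕ) : ℤ) := by simp [NExp.eval]
  have h2 : ⌊b.eval s⌋ = (B : ℤ) := by rw [hb]; simp
  rw [chooseE, NExp.eval, h1, h2, prod_Icc_natCast, ← prod_div_eq_choose]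
  refine prod_congr rfl fun i _ => ?_
  simp only [NExp.eval, NExp.eval_reg, ha, hb']
  simp [State.putNum]

lemma chooseE_ops_le {a b : NExp} {s : State n} {B : ℕ} (hb : b.eval s = B) (hB : B ≤ n)
    (ha : ∀ s : State n, a.ops s ≤ 5) (hb' : ∀ s : State n, b.ops s ≤ 5) :
    (chooseE a b).ops s ≤ 25 * (n + 1) := by
  have h1 : ⌈(NExp.const 1).eval s⌉ = ((1 : ℕ) : ℤ) := by simp [NExp.eval]
  have h2 : ⌊b.eval s⌋ = (B : ℤ) := by rw [hb]; simp
  rw [chooseE, NExp.ops, h1, h2, sum_Icc_natCast]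
  have h3 : ∀ i ∈ Icc 1 B, 1 + ((NExp.div (.add (.sub a b) (.reg 9)) (.reg 9)).ops
      (s.putNum 9 (((i : ℕ) : ℤ) : ℝ))) ≤ 18 := by
    intro i _
    simp only [NExp.ops, NExp.ops_reg]
    linarith [ha (s.putNum 9 (((i : ℕ) : ℤ) : ℝ)), hb' (s.putNum 9 (((i : ℕ) : ℤ) : ℝ))]
  have h4 := sum_le_card_nsmul _ _ _ h3
  rw [nsmul_eq_mul, Nat.card_Icc, Nat.add_sub_cancel] at h4
  have hB' : (B : ℝ) ≤ n := by exact_mod_cast hB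
  simp only [NExp.ops] at h4 ⊢
  linarith [hb' s]

variable {β : ℝ} {k t r : ℕ}

lemma xE_eval {s : State n} (α : ℝ) (h0 : s.num 0 = k) (hr : s.num r = t) :
    (xE α β (.reg 0) (.reg r)).eval s = xval α β k t := by
  simp [xE, NExp.eval, h0, hr, xval]

/-- Matches the cut-off at zero in `pE` with the truncated ceiling used with `tail`. -/
lemma natCast_ceil_eq (x : ℝ) : (⌈max (⌈x⌉ : ℝ) 0⌉ : ℤ) = (⌈x⌉₊ : ℤ) := by
  have : max (⌈x⌉ : ℝ) 0 = ((max ⌈x⌉ 0 : ℤ) : ℝ) := by push_cast; rfl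
  rw [this, Int.ceil_intCast, ← Int.toNat_eq_max, Int.ceil_toNat]

lemma pE_bounds {s : State n} (α : ℝ) (h0 : s.num 0 = k) (hr : s.num r = t) :
    ⌈(NExp.max (.ceil (xE α β (.reg 0) (.reg r))) (.const 0)).eval s⌉ =
      ((⌈xval α β k t⌉₊ : ℕ) : ℤ) ∧
    ⌊(NExp.min (.reg r) (.reg 0)).eval s⌋ = ((min t k : ℕ) : ℤ) := by
  constructor
  · simp only [NExp.eval, xE_eval α h0 hr]
    exact natCast_ceil_eq _
  · simp only [NExp.eval, NExp.eval_reg, h0, hr]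
    rw [← Nat.cast_min, Int.floor_natCast]

lemma pE_eval {s : State n} (α : ℝ) (h0 : s.num 0 = k) (hr : s.num r = t) (hr8 : r ≠ 8)
    (hr9 : r ≠ 9) (hk : k ≤ n) :
    (pE α β (.reg 0) (.reg r)).eval s = tail n k t ⌈xval α β k t⌉₊ := by
  obtain ⟨h1, h2⟩ := pE_bounds (β := β) α h0 hr
  rw [pE, NExp.eval, h1, h2, sum_Icc_natCast, tail]
  refine sum_congr rfl fun i hi => ?_
  rw [mem_Icc, le_min_iff] at hi
  have e1 : ((n - k : ℕ) : ℝ) = n - k := Nat.cast_sub hk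
  have e2 : ((t - i : ℕ) : ℝ) = t - i := Nat.cast_sub hi.2.1
  simp only [NExp.eval]
  rw [chooseE_eval (A := k) (B := i), chooseE_eval (A := n - k) (B := t - i),
    chooseE_eval (A := n) (B := t)]
  · rfl
  all_goals simp [NExp.eval, State.putNum, h0, hr, hr8, hr9, e1, e2]

lemma pE_ops_le {s : State n} (α : ℝ) (h0 : s.num 0 = k) (hr : s.num r = t) (hr8 : r ≠ 8)
    (hk : k ≤ n) (ht : t ≤ n) :
    (pE α β (.reg 0) (.reg r)).ops s ≤ 96 * (n + 1) ^ 2 := by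
  obtain ⟨h1, h2⟩ := pE_bounds (β := β) α h0 hr
  rw [pE, NExp.ops, h1, h2, sum_Icc_natCast]
  have h3 : ∀ i ∈ Icc ⌈xval α β k t⌉₊ (min t k),
      1 + ((NExp.div (.mul (chooseE (.reg 0) (.reg 8))
        (chooseE (.sub .size (.reg 0)) (.sub (.reg r) (.reg 8)))) (chooseE .size (.reg r))).ops
          (s.putNum 8 (((i : ℕ) : ℤ) : ℝ))) ≤ 3 + 75 * (n + 1) := by
    intro i hi
    rw [mem_Icc, le_min_iff] at hi
    have e2 : ((t - i : ℕ) : ℝ) = t - i := Nat.cast_sub hi.2.1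
    have c1 := chooseE_ops_le (a := .reg 0) (b := .reg 8) (B := i)
      (s := s.putNum 8 (((i : ℕ) : ℤ) : ℝ)) (by simp [State.putNum]) (by omega)
      (fun _ => by simp; norm_num) (fun _ => by simp; norm_num)
    have c2 := chooseE_ops_le (a := .sub .size (.reg 0)) (b := .sub (.reg r) (.reg 8)) (B := t - i)
      (s := s.putNum 8 (((i : ℕ) : ℤ) : ℝ)) (by simp [NExp.eval, State.putNum, hr8, hr, e2])
      (by omega) (fun _ => by simp [NExp.ops]; norm_num) (fun _ => by simp [NExp.ops]; norm_num)
    have c3 := chooseE_ops_le (a := .size) (b := .reg r) (B := t)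
      (s := s.putNum 8 (((i : ℕ) : ℤ) : ℝ)) (by simp [State.putNum, hr8, hr]) ht
      (fun _ => by simp [NExp.ops]) (fun _ => by simp; norm_num)
    simp only [NExp.ops] at c1 c2 c3 ⊢
    linarith
  have h4 := sum_le_card_nsmul _ _ _ h3
  rw [nsmul_eq_mul] at h4
  have hcard : #(Icc ⌈xval α β k t⌉₊ (min t k)) ≤ n + 1 := by rw [Nat.card_Icc]; omega
  have hcard' : (#(Icc ⌈xval α β k t⌉₊ (min t k)) : ℝ) ≤ n + 1 := by exact_mod_cast hcard
  have h5 : (#(Icc ⌈xval α β k t⌉₊ (min t k)) : ℝ) * (3 + 75 * (n + 1)) ≤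
      (n + 1) * (3 + 75 * (n + 1)) := by gcongr
  have hn : (0 : ℝ) ≤ n := Nat.cast_nonneg n
  simp only [NExp.ops, NExp.ops_reg, xE] at h4 ⊢
  nlinarith

lemma objE_eval {s : State n} (α c : ℝ) (h0 : s.num 0 = k) (hr : s.num r = t) (hr8 : r ≠ 8)
    (hr9 : r ≠ 9) (hk : k ≤ n) :
    (objE α c β (.reg 0) (.reg r)).eval s = obj α c β n k t := by
  rw [objE, NExp.eval, pE_eval α h0 hr hr8 hr9 hk]
  simp [NExp.eval, h0, hr, obj]

lemma objE_ops_le {s : State n} (α c : ℝ) (h0 : s.num 0 = k) (hr : s.num r = t) (hr8 : r ≠ 8)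
    (hk : k ≤ n) (ht : t ≤ n) :
    (objE α c β (.reg 0) (.reg r)).ops s ≤ 108 * (n + 1) ^ 2 := by
  have := pE_ops_le (β := β) α h0 hr hr8 hk ht
  have hn : (0 : ℝ) ≤ n := Nat.cast_nonneg n
  simp only [objE, NExp.ops, NExp.ops_reg]
  nlinarith

end Eval

end

section

/-! ### Program logic -/

section Runs

variable {σ : Type}

/-- The computation ends with probability one in a state that satisfies `Q`. -/
def Runs (p : PMF (Option σ)) (Q : σ → Prop) : Prop := ∀ o ∈ p.support, ∃ s, o = some s ∧ Q s

lemma runs_pure {s : σ} {Q : σ → Prop} (h : Q s) : Runs (PMF.pure (some s)) Q := fun o ho =>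
  ⟨s, by simpa using ho, h⟩

lemma runs_map {τ : Type} {p : PMF τ} {f : τ → σ} {Q : σ → Prop} (h : ∀ r, Q (f r)) :
    Runs (p.map fun r => some (f r)) Q := fun o ho => by
  rw [PMF.mem_support_map_iff] at ho
  obtain ⟨r, -, rfl⟩ := ho
  exact ⟨f r, rfl, h r⟩

lemma Runs.mono {p : PMF (Option σ)} {Q R : σ → Prop} (h : Runs p Q) (hQR : ∀ s, Q s → R s) :
    Runs p R := fun o ho => by
  obtain ⟨s, rfl, hs⟩ := h o ho
  exact ⟨s, rfl, hQR s hs⟩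

lemma Runs.andThen {p : PMF (Option σ)} {f : σ → PMF (Option σ)} {Q R : σ → Prop} (h : Runs p Q)
    (hf : ∀ s, Q s → Runs (f s) R) : Runs (andThen p f) R := fun o ho => by
  unfold SubsetMin.andThen at ho
  rw [PMF.mem_support_bind_iff] at ho
  obtain ⟨o', ho', hs⟩ := ho
  obtain ⟨s, rfl, hQ⟩ := h o' ho'
  exact hf s hQ o hs

lemma runs_forIter {body : ℕ → σ → PMF (Option σ)} {I : ℕ → σ → Prop} {k : ℕ} {s : σ}
    (h0 : I 0 s) (h : ∀ m < k, ∀ s, I m s → Runs (body m s) (I (m + 1))) :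
    Runs (forIter body k s) (I k) := by
  induction k with
  | zero => exact runs_pure h0
  | succ k ih =>
    exact (ih fun m hm => h m (by omega)).andThen fun s hs => h k (by omega) s hs

@[simp] lemma andThen_pure_some (s : σ) (f : σ → PMF (Option σ)) :
    andThen (PMF.pure (some s)) f = f s := PMF.pure_bind _ _

lemma andThen_map {τ : Type} (p : PMF τ) (f : τ → σ) (g : σ → PMF (Option σ)) :
    andThen (p.map fun r => some (f r)) g = p.bind fun r => g (f r) := by
  unfold andThen
  rw [PMF.bind_map]
  rfl

lemma andThen_assoc (p : PMF (Option σ)) (f g : σ → PMF (Option σ)) :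
    andThen (andThen p f) g = andThen p fun s => andThen (f s) g := by
  unfold andThen
  rw [PMF.bind_bind]
  congr 1
  funext o
  cases o with
  | none => exact PMF.pure_bind _ _
  | some s => rfl

lemma Runs.expect_le {p : PMF (Option σ)} {Q : σ → Prop} (h : Runs p Q) {φ : Option σ → ℝ≥0∞}
    {r : ℝ≥0∞} (hφ : ∀ s, Q s → φ (some s) ≤ r) : expect p φ ≤ r :=
  expect_le_of_support fun o ho => by
    obtain ⟨s, rfl, hs⟩ := h o ho
    exact hφ s hs

lemma Runs.expect_andThen_le {p : PMF (Option σ)} {Q : σ → Prop} (h : Runs p Q)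
    {f : σ → PMF (Option σ)} {φ : Option σ → ℝ≥0∞} {r : ℝ≥0∞}
    (hφ : ∀ s, Q s → expect (f s) φ ≤ r) : expect (SubsetMin.andThen p f) φ ≤ r := by
  rw [expect_andThen]
  exact h.expect_le hφ

lemma Runs.expect_mono {p : PMF (Option σ)} {Q : σ → Prop} (h : Runs p Q)
    {φ ψ : Option σ → ℝ≥0∞} (hφ : ∀ s, Q s → φ (some s) ≤ ψ (some s)) : expect p φ ≤ expect p ψ :=
  expect_mono_support fun o ho => by
    obtain ⟨s, rfl, hs⟩ := h o ho
    exact hφ s hs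

end Runs

lemma expect_uniformOfFinset {τ : Type} (S : Finset τ) (hS : S.Nonempty) (φ : τ → ℝ≥0∞) :
    expect (PMF.uniformOfFinset S hS) φ = (#S : ℝ≥0∞)⁻¹ * ∑ x ∈ S, φ x := by
  unfold expect
  rw [tsum_eq_sum (s := S), mul_sum]
  · exact sum_congr rfl fun x hx => by rw [PMF.uniformOfFinset_apply_of_mem hS hx]
  · intro x hx
    rw [PMF.uniformOfFinset_apply_of_notMem hS hx, zero_mul]

lemma expect_uniformOfFintype_le_half {τ : Type} [Fintype τ] [Nonempty τ] {p : τ → Prop}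
    [DecidablePred p] (h : (1 / 2 : ℝ) * (Nat.card τ : ℝ) ≤ (Nat.card {r // p r} : ℝ)) :
    expect (PMF.uniformOfFintype τ) (fun r => if p r then 0 else 1) ≤ 1 / 2 := by
  unfold PMF.uniformOfFintype
  rw [expect_uniformOfFinset, card_univ]
  have h1 : ∑ r : τ, (if p r then (0 : ℝ≥0∞) else 1) = (#{r | ¬ p r} : ℝ≥0∞) := by
    rw [← sum_boole]
    exact sum_congr rfl fun r _ => by by_cases hr : p r <;> simp [hr]
  rw [h1]
  rw [Nat.card_eq_fintype_card, Nat.card_eq_fintype_card, Fintype.card_subtype] at h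
  have h2 := card_filter_add_card_filter_not (s := (univ : Finset τ)) p
  rw [card_univ] at h2
  have h3 : #{r | ¬ p r} * 2 ≤ Fintype.card τ := by
    have h2' : (#{r | p r} : ℝ) + (#{r | ¬ p r} : ℝ) = Fintype.card τ := by exact_mod_cast h2
    have : (#{r | ¬ p r} : ℝ) * 2 ≤ Fintype.card τ := by linarith
    exact_mod_cast this
  have hc : (Fintype.card τ : ℝ≥0∞) ≠ 0 := by simp
  rw [mul_comm, ← div_eq_mul_inv, ENNReal.div_le_iff hc (by simp), one_div, mul_comm,
    ← div_eq_mul_inv, ENNReal.le_div_iff_mul_le (by simp) (by simp)]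
  exact_mod_cast h3

/-- Each set with `m + 1` elements arises once for every choice of the element inserted last. -/
lemma sum_powersetCard_sum_insert {n : ℕ} (m : ℕ) (G : Finset (Fin n) → ℝ≥0∞) :
    ∑ X ∈ powersetCard m (univ : Finset (Fin n)), ∑ x ∈ Xᶜ, G (insert x X) =
      (m + 1 : ℕ) * ∑ Y ∈ powersetCard (m + 1) (univ : Finset (Fin n)), G Y := by
  have h1 : (m + 1 : ℕ) * ∑ Y ∈ powersetCard (m + 1) (univ : Finset (Fin n)), G Y =
      ∑ Y ∈ powersetCard (m + 1) (univ : Finset (Fin n)), ∑ x ∈ Y, G Y := by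
    rw [mul_sum]
    refine sum_congr rfl fun Y hY => ?_
    rw [sum_const, (mem_powersetCard.mp hY).2, nsmul_eq_mul]
  rw [h1, sum_sigma', sum_sigma']
  refine sum_bij' (fun p _ => ⟨insert p.2 p.1, p.2⟩) (fun p _ => ⟨p.1.erase p.2, p.2⟩) ?_ ?_ ?_ ?_ ?_
  · rintro ⟨X, x⟩ hp
    simp only [mem_sigma, mem_powersetCard, subset_univ, true_and, mem_compl] at hp ⊢
    exact ⟨by rw [card_insert_of_notMem hp.2, hp.1], mem_insert_self _ _⟩
  · rintro ⟨Y, x⟩ hp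
    simp only [mem_sigma, mem_powersetCard, subset_univ, true_and, mem_compl] at hp ⊢
    exact ⟨by rw [card_erase_of_mem hp.2, hp.1]; rfl, notMem_erase _ _⟩
  · rintro ⟨X, x⟩ hp
    simp only [mem_sigma, mem_compl] at hp
    simp [erase_insert hp.2]
  · rintro ⟨Y, x⟩ hp
    simp only [mem_sigma] at hp
    simp [insert_erase hp.2]
  · rintro ⟨X, x⟩ _
    rfl

/-! ### Drawing a random set -/

variable {L : Finset (ℝ × ℝ)} {n : ℕ} {O : L → OracleFun n} {fuel : ℕ} {β : ℝ} {k t : ℕ}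

/-- Execution with the query costs of the specification list. -/
noncomputable abbrev run (O : L → OracleFun n) (fuel : ℕ) (P : Algorithm L) (s : State n) :
    PMF (Option (State n)) := exec (fun j : L => j.1.2) O fuel P s

lemma run_letNum (i : ℕ) (e : NExp) (s : State n) : run O fuel (letNum i e) s =
    PMF.pure (some ((s.putNum i (e.eval s)).charge (2 + e.ops s))) := by
  simp only [run, letNum, exec, NExp.eval, NExp.ops, Nat.floor_natCast]
  norm_num

lemma run_letSet (i : ℕ) (e : SExp) (s : State n) : run O fuel (letSet i e) s =
    PMF.pure (some ((s.putSet i (e.eval s)).charge (2 + e.ops s))) := by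
  simp only [run, letSet, exec, NExp.eval, NExp.ops, Nat.floor_natCast]
  norm_num

lemma run_skip (s : State n) :
    run O fuel (.skip : Algorithm L) s = PMF.pure (some (s.charge 1)) := by
  simp only [run, exec]

lemma run_seq (P Q : Algorithm L) (s : State n) :
    run O fuel (.seq P Q) s = andThen (run O fuel P s) (run O fuel Q) := by
  simp only [run, exec]

/-- The registers that are not changed while a set is sampled. -/
structure Frame (s s' : State n) : Prop where
  num0 : s'.num 0 = s.num 0
  num4 : s'.num 4 = s.num 4
  num5 : s'.num 5 = s.num 5
  set0 : s'.set 0 = s.set 0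

lemma Frame.refl (s : State n) : Frame s s := ⟨rfl, rfl, rfl, rfl⟩

lemma Frame.trans {s s' s'' : State n} (h : Frame s s') (h' : Frame s' s'') : Frame s s'' :=
  ⟨h'.1.trans h.1, h'.2.trans h.2, h'.3.trans h.3, h'.4.trans h.4⟩

/-- The body of the loop that draws a set. -/
def drawBody : Algorithm L :=
  .seq (.randElem (.const 2) (.sdiff .univ (.reg 1))) (letSet 1 (.union (.reg 1) (.reg 2)))

/-- The state after the element `X` has been drawn. -/
noncomputable def drawState (s : State n) (X : Finset (Fin n)) : State n :=
  (((s.putSet 2 X).charge (3 * n + 6)).putSet 1 (s.set 1 ∪ X)).charge (3 * n + 7)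

lemma run_drawBody (s : State n) : run O fuel (drawBody : Algorithm L) s =
    (uniformOr (((s.set 1)ᶜ).image fun u => ({u} : Finset (Fin n))) ∅).map fun X =>
      some (drawState s X) := by
  rw [drawBody, run_seq, run, exec, andThen_map, ← PMF.bind_pure_comp]
  have e1 : (SExp.sdiff .univ (.reg 1)).eval s = (s.set 1)ᶜ := by
    simp [SExp.eval, compl_eq_univ_sdiff]
  rw [e1]
  congr 1
  funext X
  rw [run_letSet]
  simp only [Function.comp_apply, drawState, NExp.eval, SExp.eval, SExp.eval_reg, NExp.ops,
    SExp.ops, SExp.ops_reg, Nat.floor_ofNat]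
  congr 2
  simp only [State.putSet, State.charge, State.mk.injEq, true_and]
  constructor
  · simp
  · ring

lemma frame_drawState (s : State n) (X : Finset (Fin n)) : Frame s (drawState s X) :=
  ⟨rfl, rfl, rfl, by simp [drawState, State.putSet, State.charge]⟩

lemma drawState_set_one (s : State n) (X : Finset (Fin n)) : (drawState s X).set 1 = s.set 1 ∪ X := by
  simp [drawState, State.putSet, State.charge]

lemma drawState_cost (s : State n) (X : Finset (Fin n)) :
    (drawState s X).cost = s.cost + (6 * n + 13) := by
  simp only [drawState, State.putSet, State.charge]; ring

/-- The step of the loop that draws a set. -/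
noncomputable def drawStep (O : L → OracleFun n) (fuel : ℕ) (m : ℕ) (s : State n) :
    PMF (Option (State n)) :=
  run O fuel drawBody ((s.putNum 6 (1 + (m : ℝ))).charge 1)

lemma frame_putNum_six (s : State n) (x y : ℝ) : Frame s ((s.putNum 6 x).charge y) :=
  ⟨by simp [State.putNum, State.charge], by simp [State.putNum, State.charge],
    by simp [State.putNum, State.charge], rfl⟩

lemma runs_drawStep (m : ℕ) (s : State n) : Runs (drawStep O fuel m s) fun s' =>
    Frame s s' ∧ s'.cost = s.cost + (6 * n + 14) := by
  rw [drawStep, run_drawBody]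
  refine runs_map fun X => ⟨(frame_putNum_six s _ _).trans (frame_drawState _ _), ?_⟩
  rw [drawState_cost]
  simp only [State.charge, State.putNum]; ring

lemma runs_draw (t : ℕ) (s : State n) : Runs (forIter (drawStep O fuel) t s) fun s' =>
    Frame s s' ∧ s'.cost = s.cost + t * (6 * n + 14) := by
  refine runs_forIter (I := fun m s' => Frame s s' ∧ s'.cost = s.cost + m * (6 * n + 14))
    ⟨Frame.refl s, by simp⟩ fun m _ s₁ h => (runs_drawStep m s₁).mono fun s₂ h' =>
      ⟨h.1.trans h'.1, ?_⟩
  rw [h'.2, h.2]; push_cast; ring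

lemma expect_drawStep_le {m : ℕ} (hm : m < n) {s : State n} (hs : #(s.set 1) = m)
    {ψ : Option (State n) → ℝ≥0∞} {G : Finset (Fin n) → ℝ≥0∞}
    (h : ∀ s', Frame s s' → #(s'.set 1) = m + 1 → ψ (some s') ≤ G (s'.set 1)) :
    expect (drawStep O fuel m s) ψ ≤
      ((n - m : ℕ) : ℝ≥0∞)⁻¹ * ∑ x ∈ (s.set 1)ᶜ, G (insert x (s.set 1)) := by
  rw [drawStep, run_drawBody, expect_map]
  have hset : ((s.putNum 6 (1 + (m : ℝ))).charge 1).set 1 = s.set 1 := rfl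
  rw [hset]
  have hcard : #(s.set 1)ᶜ = n - m := by rw [card_compl, Fintype.card_fin, hs]
  have hne : (((s.set 1)ᶜ).image fun u => ({u} : Finset (Fin n))).Nonempty := by
    rw [image_nonempty, ← card_pos, hcard]; omega
  rw [uniformOr, dif_pos hne, expect_uniformOfFinset,
    card_image_of_injective _ (singleton_injective), hcard,
    sum_image fun x _ y _ hxy => singleton_injective hxy]
  gcongr with x hx
  set s₁ := drawState ((s.putNum 6 (1 + (m : ℝ))).charge 1) {x} with hs₁
  have e : s₁.set 1 = insert x (s.set 1) := by
    rw [hs₁, drawState_set_one, hset, union_comm]; rfl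
  have := h s₁ ((frame_putNum_six s _ _).trans (frame_drawState _ _))
    (by rw [e, card_insert_of_notMem (by simpa using hx), hs])
  rwa [e] at this

/-- The set that is drawn is uniformly distributed. -/
lemma expect_draw_le {m : ℕ} (hm : m ≤ n) {s : State n} (hs : s.set 1 = ∅) :
    ∀ {ψ : Option (State n) → ℝ≥0∞} {G : Finset (Fin n) → ℝ≥0∞},
      (∀ s', Frame s s' → #(s'.set 1) = m → ψ (some s') ≤ G (s'.set 1)) →
      expect (forIter (drawStep O fuel) m s) ψ ≤
        (n.choose m : ℝ≥0∞)⁻¹ * ∑ X ∈ powersetCard m (univ : Finset (Fin n)), G X := by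
  induction m with
  | zero =>
    intro ψ G h
    have := h s (Frame.refl s) (by simp [hs])
    simpa [forIter, expect_pure, hs] using this
  | succ m ih =>
    intro ψ G h
    rw [forIter, expect_andThen]
    -- The average of `G` over the next element bounds the value after `m` draws. The weights then
    -- combine by C(n, m) (n - m) = C(n, m + 1) (m + 1).
    refine (ih (by omega) (G := fun X => ((n - m : ℕ) : ℝ≥0∞)⁻¹ * ∑ x ∈ Xᶜ, G (insert x X))
      fun s' hs' hc => ?_).trans ?_
    · exact expect_drawStep_le (by omega) hc fun s'' h1 h2 => h s'' (hs'.trans h1) h2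
    · rw [← mul_sum, sum_powersetCard_sum_insert, ← mul_assoc, ← mul_assoc]
      gcongr
      have hch := Nat.choose_succ_right_eq n m
      have hch' : (n.choose m : ℝ≥0∞) * ((n - m : ℕ) : ℝ≥0∞) =
          (n.choose (m + 1) : ℝ≥0∞) * ((m + 1 : ℕ) : ℝ≥0∞) := by exact_mod_cast hch.symm
      rw [← ENNReal.mul_inv (Or.inr (ENNReal.natCast_ne_top _)) (Or.inl (ENNReal.natCast_ne_top _)),
        hch', ENNReal.mul_inv (Or.inr (ENNReal.natCast_ne_top _))
          (Or.inl (ENNReal.natCast_ne_top _)), mul_assoc,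
        ENNReal.inv_mul_cancel (by simp) (ENNReal.natCast_ne_top _), mul_one]

end

section

variable {L : Finset (ℝ × ℝ)} {n : ℕ} {O : L → OracleFun n} {fuel : ℕ} {β : ℝ} {k t : ℕ}

/-! ### One sample -/

/-- The bound on the size of the extension that is asked for. -/
noncomputable def queryLen (α β : ℝ) (k t : ℕ) : ℕ := ⌊(k : ℝ) - (⌈xval α β k t⌉ : ℝ)⌋₊

/-- The query and the union of the sample with its answer. -/
noncomputable def queryPart (β : ℝ) (j : L) : Algorithm L :=
  seqs
    [ .query j (.const 2) (.reg 1) (.sub (.reg 0) (.ceil (xE j.1.1 β (.reg 0) (.reg 4)))),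
      letSet 2 (.union (.reg 1) (.reg 2)) ]

/-- The state after the oracle has answered `Y`. -/
noncomputable def queryState (c : ℝ) (l : ℕ) (s : State n) (Y : Finset (Fin n)) : State n :=
  ((((s.putSet 2 Y).charge (n + 17 + c ^ l)).putSet 2 (s.set 1 ∪ Y)).charge (3 * n + 7)).charge 1

lemma run_queryPart (j : L) {s : State n} (h0 : s.num 0 = k) (h4 : s.num 4 = t) :
    run O fuel (queryPart β j) s = (PMF.uniformOfFintype (Fin (O j).m → Bool)).map fun r =>
      some (queryState j.1.2 (queryLen j.1.1 β k t) s
        ((O j).ans (s.set 1) (queryLen j.1.1 β k t) r)) := by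
  have hx := xE_eval (β := β) j.1.1 h0 h4
  have e1 : ⌊(NExp.sub (.reg 0) (.ceil (xE j.1.1 β (.reg 0) (.reg 4)))).eval s⌋₊ =
      queryLen j.1.1 β k t := by
    simp only [NExp.eval, NExp.eval_reg, hx, h0, queryLen]
  have e2 : (NExp.sub (.reg 0) (.ceil (xE j.1.1 β (.reg 0) (.reg 4)))).ops s = 13 := by
    simp only [NExp.ops, NExp.ops_reg, xE]; norm_num
  rw [queryPart, seqs, run_seq]
  conv_lhs => rw [run, exec]
  rw [andThen_map, ← PMF.bind_pure_comp, e1, e2]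
  congr 1
  funext r
  rw [seqs, run_seq, run_letSet, andThen_pure_some, seqs, run_skip]
  simp only [Function.comp_apply, queryState, NExp.eval, SExp.eval, SExp.eval_reg, NExp.ops,
    SExp.ops, SExp.ops_reg, Nat.floor_ofNat]
  congr 2
  simp only [State.putSet, State.charge, State.mk.injEq, true_and]
  constructor
  · simp
  · ring

lemma frame_queryState (c : ℝ) (l : ℕ) (s : State n) (Y : Finset (Fin n)) :
    Frame s (queryState c l s Y) :=
  ⟨rfl, rfl, rfl, by simp [queryState, State.putSet, State.charge]⟩

lemma queryState_set_two (c : ℝ) (l : ℕ) (s : State n) (Y : Finset (Fin n)) :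
    (queryState c l s Y).set 2 = s.set 1 ∪ Y := by
  simp [queryState, State.putSet, State.charge]

lemma queryState_cost (c : ℝ) (l : ℕ) (s : State n) (Y : Finset (Fin n)) :
    (queryState c l s Y).cost = s.cost + (4 * n + 25 + c ^ l) := by
  simp only [queryState, State.putSet, State.charge]; ring

/-- The state in which the drawing of a set begins. -/
noncomputable def drawInit (s : State n) : State n :=
  ((s.putSet 1 ∅).charge (n + 3)).charge 4

lemma frame_drawInit (s : State n) : Frame s (drawInit s) :=
  ⟨rfl, rfl, rfl, by simp [drawInit, State.putSet, State.charge]⟩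

lemma run_sample (j : L) {s : State n} (h4 : s.num 4 = t) :
    run O fuel (sample β j) s =
      andThen (forIter (drawStep O fuel) t (drawInit s)) (run O fuel (queryPart β j)) := by
  have hstep : (fun (m : ℕ) (s' : State n) => exec (fun j : L => j.1.2) O fuel drawBody
      ((s'.putNum 6 (1 + (m : ℝ))).charge 1)) = drawStep O fuel := rfl
  rw [sample, seqs, run_seq, run_letSet, andThen_pure_some, seqs, run_seq]
  congr 1
  have e : (s.putSet 1 (SExp.empty.eval s)).charge (2 + SExp.empty.ops s) =
      (s.putSet 1 ∅).charge (n + 3) := by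
    simp only [SExp.eval, SExp.ops, State.charge, State.putSet, State.mk.injEq, true_and]; ring
  rw [e, run, exec, NExp.eval_reg, NExp.ops_reg]
  simp only [NExp.eval, NExp.ops, Int.ceil_one, Int.cast_one]
  have h4' : ((s.putSet 1 ∅).charge ((n : ℝ) + 3)).num 4 = t := h4
  have e2 : (⌊((s.putSet 1 ∅).charge ((n : ℝ) + 3)).num 4⌋ + 1 - 1).toNat = t := by
    rw [h4']; simp
  rw [e2]
  change forIter (drawStep O fuel) t _ = _
  rw [drawInit]
  norm_num

/-- The smaller one of the last sample and the smallest sample so far is kept. -/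
def keep : Algorithm L :=
  .ifLe (.card (.const 2)) (.card (.const 0)) (letSet 0 (.reg 2)) .skip

lemma runs_keep (s : State n) : Runs (run O fuel (keep : Algorithm L) s) fun s' =>
    s'.num = s.num ∧ s'.cost ≤ s.cost + (3 * n + 9) ∧
      #(s'.set 0) ≤ #(s.set 0) ∧ #(s'.set 0) ≤ #(s.set 2) ∧
      (s'.set 0 = s.set 0 ∨ s'.set 0 = s.set 2) := by
  have e : NExp.eval (.const 2) s = 2 := rfl
  have e' : NExp.eval (.const 0) s = 0 := rfl
  have hn : (0 : ℝ) ≤ n := Nat.cast_nonneg n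
  rw [keep, run, exec]
  simp only [NExp.eval, Nat.floor_ofNat, Nat.floor_zero]
  split_ifs with h
  · change Runs (run O fuel (letSet 0 (.reg 2)) _) _
    rw [run_letSet]
    apply runs_pure
    simp only [SExp.eval_reg, SExp.ops_reg, NExp.ops, State.charge, State.putSet,
      Function.update_self]
    refine ⟨trivial, ?_, by exact_mod_cast h, le_rfl, Or.inr trivial⟩
    linarith
  · apply runs_pure
    simp only [NExp.ops, State.charge]
    refine ⟨trivial, by linarith, le_rfl, ?_, Or.inl trivial⟩
    rw [Nat.cast_le, not_le] at h
    exact h.le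

/-- One round of the sampling procedure. -/
noncomputable def trial (β : ℝ) (j : L) : Algorithm L := .seq (sample β j) keep

/-- The registers that are not changed by a round; the set in the output cell remains in `F` and
does not grow. -/
structure Improves (F : Set (Finset (Fin n))) (s s' : State n) : Prop where
  num0 : s'.num 0 = s.num 0
  num4 : s'.num 4 = s.num 4
  num5 : s'.num 5 = s.num 5
  card_le : #(s'.set 0) ≤ #(s.set 0)
  mem : s.set 0 ∈ F → s'.set 0 ∈ F

section

variable {F : Set (Finset (Fin n))}

lemma Improves.refl (s : State n) : Improves F s s := ⟨rfl, rfl, rfl, le_rfl, id⟩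

lemma Improves.trans {s s' s'' : State n} (h : Improves F s s') (h' : Improves F s' s'') :
    Improves F s s'' :=
  ⟨h'.1.trans h.1, h'.2.trans h.2, h'.3.trans h.3, h'.4.trans h.4, h'.5 ∘ h.5⟩

lemma runs_trial (j : L) (hO : IsExtensionOracle F j.1.1 (O j)) (ht : t ≤ n) {s : State n}
    (h0 : s.num 0 = k) (h4 : s.num 4 = t) :
    Runs (run O fuel (trial β j) s) fun s' => Improves F s s' ∧
      s'.cost ≤ s.cost + (60 * (n + 1) ^ 2 + j.1.2 ^ queryLen j.1.1 β k t) := by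
  rw [trial, run_seq, run_sample j h4, andThen_assoc]
  refine (runs_draw t _).andThen fun s₁ ⟨hf₁, hc₁⟩ => ?_
  have hf := (frame_drawInit s).trans hf₁
  have hcost : (drawInit s).cost = s.cost + (n + 7) := by
    simp only [drawInit, State.charge, State.putSet]; ring
  rw [run_queryPart (k := k) (t := t) j (hf.num0.trans h0) (hf.num4.trans h4), andThen_map]
  intro o ho
  rw [PMF.mem_support_bind_iff] at ho
  obtain ⟨r, -, ho⟩ := ho
  obtain ⟨s₂, rfl, hnum, hc₂, hle, -, hset⟩ := runs_keep _ o ho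
  have hf₂ := hf.trans (frame_queryState j.1.2 (queryLen j.1.1 β k t) s₁
    ((O j).ans (s₁.set 1) (queryLen j.1.1 β k t) r))
  refine ⟨s₂, rfl, ⟨by rw [hnum, hf₂.num0], by rw [hnum, hf₂.num4], by rw [hnum, hf₂.num5],
    by rwa [hf₂.set0] at hle, fun hmem => ?_⟩, ?_⟩
  · rcases hset with h | h
    · rw [h, hf₂.set0]; exact hmem
    · rw [h, queryState_set_two, union_comm]
      exact hO.1 _ _ _
  · rw [queryState_cost, hc₁, hcost] at hc₂
    have ht' : (t : ℝ) ≤ n := by exact_mod_cast ht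
    have hn : (0 : ℝ) ≤ n := Nat.cast_nonneg n
    have : (t : ℝ) * (6 * n + 14) ≤ n * (6 * n + 14) := by gcongr
    nlinarith

/-- The indicator function of the event that no set with at most `b` elements has been found. -/
noncomputable def fail (b : ℝ) : Option (State n) → ℝ≥0∞ :=
  fun o => o.elim 1 fun s => open Classical in if (#(s.set 0) : ℝ) ≤ b then 0 else 1

lemma fail_le_one (b : ℝ) (o : Option (State n)) : fail b o ≤ 1 := by
  cases o with
  | none => exact le_rfl
  | some s => simp only [fail, Option.elim_some]; split_ifs <;> simp

lemma fail_mono {b : ℝ} {s s' : State n} (h : #(s'.set 0) ≤ #(s.set 0)) :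
    fail b (some s') ≤ fail b (some s) := by
  simp only [fail, Option.elim_some]
  split_ifs with h1 h2
  · simp
  · simp
  · have : (#(s'.set 0) : ℝ) ≤ #(s.set 0) := by exact_mod_cast h
    exact absurd (this.trans ‹_›) h1
  · simp

lemma Runs.expect_fail_le {p : PMF (Option (State n))} {s : State n} (h : Runs p (Improves F s))
    (b : ℝ) : expect p (fail b) ≤ fail b (some s) :=
  h.expect_le fun _ hs => fail_mono hs.card_le

/-- Used twice: it keeps the union of the sample and an α-approximate answer within `β * k`
elements, and it bounds the query cost by the numerator of the objective. -/
lemma queryLen_le {α : ℝ} (hα : 1 ≤ α) (hv : ValidT α β k t) :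
    (queryLen α β k t : ℝ) ≤ (β * k - t) / α := by
  have h1 : (⌈xval α β k t⌉ : ℝ) ≤ k := by
    have : ⌈xval α β k t⌉ ≤ (k : ℤ) := Int.ceil_le.mpr (by exact_mod_cast hv.xval_le hα)
    exact_mod_cast this
  have h2 := Nat.floor_le (sub_nonneg.mpr h1)
  have h3 := Int.le_ceil (xval α β k t)
  rw [queryLen]
  rw [xval_eq] at h3 h2 ⊢
  linarith

/-- A sample with ⌈x⌉₊ elements of a k-element solution thus misses at most `queryLen` of them. For
negative x the query is at least as long as `k`, so the truncation does no harm. -/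
lemma le_queryLen_add {α : ℝ} : k ≤ queryLen α β k t + ⌈xval α β k t⌉₊ := by
  have h1 : (⌈xval α β k t⌉ : ℝ) ≤ (⌈xval α β k t⌉₊ : ℝ) := by
    have : ⌈xval α β k t⌉ ≤ (⌈xval α β k t⌉₊ : ℤ) := by
      rw [← Int.ceil_toNat]; exact Int.self_le_toNat _
    exact_mod_cast this
  have h2 : queryLen α β k t = (k - ⌈xval α β k t⌉ : ℤ).toNat := by
    rw [queryLen, ← Int.floor_toNat]
    congr 1
    have : (k : ℝ) - (⌈xval α β k t⌉ : ℝ) = ((k - ⌈xval α β k t⌉ : ℤ) : ℝ) := by push_cast; rfl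
    rw [this, Int.floor_intCast]
  have h3 : ⌈xval α β k t⌉ ≤ (⌈xval α β k t⌉₊ : ℤ) := by exact_mod_cast h1
  omega

/-- If the sample contains enough elements of an optimal solution, then the query succeeds with
probability at least one half. -/
lemma expect_query_fail_le (hF : IsMonotone F) (j : L) (hα : 1 ≤ j.1.1)
    (hO : IsExtensionOracle F j.1.1 (O j)) (hv : ValidT j.1.1 β k t) {K : Finset (Fin n)}
    (hKF : K ∈ F) (hK : #K = k) {s : State n} (h0 : s.num 0 = k) (h4 : s.num 4 = t)
    (h1 : #(s.set 1) = t) (hX : ⌈xval j.1.1 β k t⌉₊ ≤ #(s.set 1 ∩ K)) :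
    expect (andThen (run O fuel (queryPart β j) s) (run O fuel keep)) (fail (β * k)) ≤ 1 / 2 := by
  classical
  rw [run_queryPart (k := k) (t := t) j h0 h4, andThen_map, expect_bind]
  set l := queryLen j.1.1 β k t with hl
  have hext : ∃ S, IsExtension F (l : ℝ) (s.set 1) S := by
    refine ⟨K \ s.set 1, hF.2 K _ (fun x hx => ?_) hKF, ?_⟩
    · by_cases h : x ∈ s.set 1
      · exact mem_union_left _ h
      · exact mem_union_right _ (mem_sdiff.mpr ⟨hx, h⟩)
    · have h2 := card_inter_add_card_sdiff K (s.set 1)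
      rw [inter_comm] at h2
      have h3 := le_queryLen_add (α := j.1.1) (β := β) (k := k) (t := t)
      have : #(K \ s.set 1) ≤ l := by omega
      exact_mod_cast this
  refine le_trans ?_ (expect_uniformOfFintype_le_half (hO.2 (s.set 1) l hext))
  refine expect_mono_support fun r _ => ?_
  split_ifs with hr
  · refine (runs_keep _).expect_le fun s' hs' => ?_
    have h5 := hs'.2.2.2.1
    rw [queryState_set_two] at h5
    have h6 := card_union_le (s.set 1) ((O j).ans (s.set 1) l r)
    have h7 : (#(s'.set 0) : ℝ) ≤ t + #((O j).ans (s.set 1) l r) := by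
      rw [h1] at h6; exact_mod_cast h5.trans h6
    have h8 := hr.2
    have h9 := queryLen_le hα hv
    rw [le_div_iff₀ (by linarith)] at h9
    -- t + α · l ≤ t + (βk - t).
    have h10 : (#(s'.set 0) : ℝ) ≤ β * k := by nlinarith
    simp [fail, h10]
  · exact expect_le_of_support fun o _ => fail_le_one _ o

/-- Once the output is small it stays small, so both sides vanish. Otherwise a round succeeds if the
sample is good, which has probability `tail`, and the answer is helpful, which then has probability
at least 1/2. -/
lemma expect_trial_fail_le (hF : IsMonotone F) (hβ : 1 ≤ β) (j : L) (hα : 1 ≤ j.1.1)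
    (hO : IsExtensionOracle F j.1.1 (O j)) (hk : β * k ≤ n) (hv : ValidT j.1.1 β k t)
    {K : Finset (Fin n)} (hKF : K ∈ F) (hK : #K = k) {s : State n} (h0 : s.num 0 = k)
    (h4 : s.num 4 = t) :
    expect (run O fuel (trial β j) s) (fail (β * k)) ≤
      ENNReal.ofReal (1 - tail n k t ⌈xval j.1.1 β k t⌉₊ / 2) * fail (β * k) (some s) := by
  classical
  have hkn := le_of_mul_le hβ hk
  have htn := hv.le hk
  by_cases hs : (#(s.set 0) : ℝ) ≤ β * k
  · have h1 : fail (β * k) (some s) = 0 := by simp [fail, hs]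
    have h2 := ((runs_trial (fuel := fuel) (β := β) j hO htn h0 h4).mono
      fun _ h => h.1).expect_fail_le (β * k)
    rw [h1] at h2 ⊢
    simpa using h2
  · have h1 : fail (β * k) (some s) = 1 := by simp [fail, hs]
    rw [h1, mul_one, trial, run_seq, run_sample j h4, andThen_assoc, expect_andThen]
    set y := ⌈xval j.1.1 β k t⌉₊ with hy
    have hinit : (drawInit s).set 1 = ∅ := by simp [drawInit, State.putSet, State.charge]
    refine (expect_draw_le htn hinit
      (G := fun X => ENNReal.ofReal (if y ≤ #(X ∩ K) then 1 / 2 else 1)) ?_).trans ?_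
    · intro s' hf hc
      have hf' := (frame_drawInit s).trans hf
      split_ifs with hX
      · refine (expect_query_fail_le hF j hα hO hv hKF hK (hf'.num0.trans h0)
          (hf'.num4.trans h4) hc hX).trans ?_
        rw [ENNReal.ofReal_div_of_pos (by norm_num)]; simp
      · rw [ENNReal.ofReal_one]
        exact expect_le_of_support fun o _ => fail_le_one _ o
    · have hcount := card_filter_le_card_inter K htn y
      rw [hK] at hcount
      have hpos : (0 : ℝ) < n.choose t := by exact_mod_cast Nat.choose_pos htn
      rw [← ENNReal.ofReal_sum_of_nonneg fun X _ => by split_ifs <;> norm_num]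
      rw [← ENNReal.ofReal_natCast, ← ENNReal.ofReal_inv_of_pos hpos,
        ← ENNReal.ofReal_mul (by positivity)]
      apply ENNReal.ofReal_le_ofReal
      have e : ∑ X ∈ powersetCard t (univ : Finset (Fin n)),
          (if y ≤ #(X ∩ K) then (1 / 2 : ℝ) else 1) =
          n.choose t - (n.choose t * tail n k t y) / 2 := by
        have e1 : ∀ X ∈ powersetCard t (univ : Finset (Fin n)),
            (if y ≤ #(X ∩ K) then (1 / 2 : ℝ) else 1) =
              1 - (if y ≤ #(X ∩ K) then 1 else 0) / 2 := by
          intro X _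
          split_ifs <;> norm_num
        rw [sum_congr rfl e1, sum_sub_distrib, ← sum_div, sum_boole, hcount]
        simp
      rw [e]
      have : (n.choose t : ℝ)⁻¹ * (n.choose t - (n.choose t * tail n k t y) / 2) =
          1 - tail n k t y / 2 := by
        field_simp
      exact this.le

end

end

section

variable {L : Finset (ℝ × ℝ)} {n : ℕ} {O : L → OracleFun n} {fuel : ℕ} {β : ℝ} {k t : ℕ}
  {F : Set (Finset (Fin n))}

/-! ### Repeated sampling -/

/-- One iteration of the loop that repeats the sampling procedure. -/
noncomputable def trialStep (O : L → OracleFun n) (fuel : ℕ) (β : ℝ) (j : L) (m : ℕ)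
    (s : State n) : PMF (Option (State n)) :=
  run O fuel (trial β j) ((s.putNum 7 (1 + (m : ℝ))).charge 1)

lemma improves_putNum_seven (s : State n) (x y : ℝ) : Improves F s ((s.putNum 7 x).charge y) :=
  ⟨by simp [State.putNum, State.charge], by simp [State.putNum, State.charge],
    by simp [State.putNum, State.charge], le_rfl, id⟩

lemma runs_trials (j : L) (hO : IsExtensionOracle F j.1.1 (O j)) (ht : t ≤ n) (N : ℕ)
    {s : State n} (h0 : s.num 0 = k) (h4 : s.num 4 = t) :
    Runs (forIter (trialStep O fuel β j) N s) fun s' => Improves F s s' ∧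
      s'.cost ≤ s.cost + N * (61 * (n + 1) ^ 2 + j.1.2 ^ queryLen j.1.1 β k t) := by
  refine runs_forIter (I := fun (m : ℕ) s' => Improves F s s' ∧
    s'.cost ≤ s.cost + m * (61 * (n + 1) ^ 2 + j.1.2 ^ queryLen j.1.1 β k t))
    ⟨Improves.refl s, by simp⟩ fun m _ s₁ h => ?_
  have hi : Improves F s₁ ((s₁.putNum 7 (1 + (m : ℝ))).charge 1) := improves_putNum_seven s₁ _ _
  have hi' := h.1.trans hi
  refine (runs_trial (fuel := fuel) (β := β) j hO ht (hi'.num0.trans h0)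
    (hi'.num4.trans h4)).mono fun s₂ h' => ⟨hi'.trans h'.1, ?_⟩
  have e : ((s₁.putNum 7 (1 + (m : ℝ))).charge 1).cost = s₁.cost + 1 := rfl
  have h2 := h.2
  have h3 := h'.2
  rw [e] at h3
  have hn : (1 : ℝ) ≤ (n + 1) ^ 2 := one_le_pow₀ (by linarith [Nat.cast_nonneg (α := ℝ) n])
  push_cast
  linarith

/-- The bound for one round is proportional to the failure indicator of the state before it, so the
rounds multiply. -/
lemma expect_trials_fail_le (hF : IsMonotone F) (hβ : 1 ≤ β) (j : L) (hα : 1 ≤ j.1.1)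
    (hO : IsExtensionOracle F j.1.1 (O j)) (hk : β * k ≤ n) (hv : ValidT j.1.1 β k t)
    {K : Finset (Fin n)} (hKF : K ∈ F) (hK : #K = k) (N : ℕ) {s : State n} (h0 : s.num 0 = k)
    (h4 : s.num 4 = t) :
    expect (forIter (trialStep O fuel β j) N s) (fail (β * k)) ≤
      ENNReal.ofReal (1 - tail n k t ⌈xval j.1.1 β k t⌉₊ / 2) ^ N := by
  induction N with
  | zero => rw [forIter, expect_pure, pow_zero]; exact fail_le_one _ _
  | succ N ih =>
    rw [forIter, expect_andThen, pow_succ']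
    refine le_trans ?_ (mul_le_mul_right ih _)
    rw [← expect_mul_left]
    refine (runs_trials (fuel := fuel) (β := β) j hO (hv.le hk) N h0 h4).expect_mono
      fun s₁ h => ?_
    have hi : Improves F s₁ ((s₁.putNum 7 (1 + (N : ℝ))).charge 1) := improves_putNum_seven s₁ _ _
    have hi' := h.1.trans hi
    exact expect_trial_fail_le (s := (s₁.putNum 7 (1 + (N : ℝ))).charge 1)
      hF hβ j hα hO hk hv hKF hK (hi'.num0.trans h0) (hi'.num4.trans h4)

/-- The exponent times p/2 is at least one, so the power is at most 1/e. -/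
lemma one_sub_half_pow_le {p : ℝ} (hp : 0 < p) (hp1 : p ≤ 1) :
    (1 - p / 2) ^ (2 * ⌈1 / p⌉₊) ≤ 1 / 2 := by
  have h1 : 1 - p / 2 ≤ Real.exp (-(p / 2)) := Real.one_sub_le_exp_neg _
  have h2 : 1 / p ≤ ⌈1 / p⌉₊ := Nat.le_ceil _
  have h3 : 1 ≤ p * ⌈1 / p⌉₊ := by rwa [div_le_iff₀ hp, mul_comm] at h2
  calc (1 - p / 2) ^ (2 * ⌈1 / p⌉₊) ≤ Real.exp (-(p / 2)) ^ (2 * ⌈1 / p⌉₊) := by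
        gcongr; linarith
    _ = Real.exp (-(p * ⌈1 / p⌉₊)) := by
        rw [← Real.exp_nat_mul]; congr 1; push_cast; ring
    _ ≤ Real.exp (-1) := Real.exp_le_exp.mpr (by linarith)
    _ ≤ 1 / 2 := by
        rw [Real.exp_neg, one_div]
        exact inv_anti₀ (by norm_num) (by linarith [Real.exp_one_gt_d9])

lemma run_sampling_of_eq (j : L) {m : ℕ} (hk : k ≤ n) {s : State n} (h0 : s.num 0 = k)
    (h4 : s.num 4 = t) (h5 : s.num 5 = m) :
    ∃ s₀ : State n, Improves F s s₀ ∧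
      (t ≤ n → s₀.cost ≤ s.cost + 111 * (n + 1) ^ 2) ∧
      run O fuel (sampling β j m) s = forIter (trialStep O fuel β j)
        (2 * ⌈1 / tail n k t ⌈xval j.1.1 β k t⌉₊⌉₊) s₀ := by
  set p := tail n k t ⌈xval j.1.1 β k t⌉₊ with hp
  set s₁ : State n := (s.charge 4).charge 4 with hs₁
  have hp' := pE_eval (β := β) (s := s₁) (r := 4) j.1.1 h0 h4 (by norm_num) (by norm_num) hk
  set e : NExp :=
    .mul (.const 2) (.ceil (.div (.const 1) (pE j.1.1 β (.reg 0) (.reg 4)))) with he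
  refine ⟨s₁.charge (1 + 1 + e.ops s₁), ⟨rfl, rfl, rfl, le_rfl, id⟩, fun ht => ?_, ?_⟩
  · have h1 := pE_ops_le (β := β) (s := s₁) (r := 4) j.1.1 h0 h4 (by norm_num) hk ht
    have hn : (1 : ℝ) ≤ (n + 1) ^ 2 := one_le_pow₀ (by linarith [Nat.cast_nonneg (α := ℝ) n])
    simp only [he, NExp.ops, State.charge, hs₁] at h1 ⊢
    linarith
  · have c1 : (NExp.reg 5).eval s ≤ (NExp.const (m : ℝ)).eval s := by
      rw [NExp.eval_reg, h5]; exact le_rfl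
    have e1 : s.charge (1 + (NExp.reg 5).ops s + (NExp.const (m : ℝ)).ops s) = s.charge 4 := by
      rw [NExp.ops_reg, NExp.ops]; norm_num
    have c2 : (NExp.const (m : ℝ)).eval (s.charge 4) ≤ (NExp.reg 5).eval (s.charge 4) := by
      rw [NExp.eval_reg]; exact h5.ge
    have e2 : (s.charge 4).charge (1 + (NExp.const (m : ℝ)).ops (s.charge 4) +
        (NExp.reg 5).ops (s.charge 4)) = s₁ := by
      rw [NExp.ops_reg, NExp.ops]; norm_num [hs₁]
    rw [sampling, run, exec, if_pos c1, e1, exec, if_pos c2, e2, exec, ← he]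
    have hlo : ⌈(NExp.const 1).eval s₁⌉ = 1 := by simp [NExp.eval]
    have hhi : ⌊e.eval s₁⌋ = 2 * (⌈1 / p⌉₊ : ℤ) := by
      rw [he]
      simp only [NExp.eval, hp']
      have h1 : (⌈1 / p⌉ : ℤ) = (⌈1 / p⌉₊ : ℤ) :=
        (Int.natCast_ceil_eq_ceil (one_div_nonneg.mpr
          (sum_nonneg fun _ _ => hyp_nonneg _ _ _ _))).symm
      rw [h1]
      have h2 : (2 : ℝ) * (((⌈1 / p⌉₊ : ℕ) : ℤ) : ℝ) = ((2 * ((⌈1 / p⌉₊ : ℕ) : ℤ) : ℤ) : ℝ) := by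
        push_cast; rfl
      rw [h2, Int.floor_intCast]
    have hN : (2 * (⌈1 / p⌉₊ : ℤ) + 1 - 1).toNat = 2 * ⌈1 / p⌉₊ := by omega
    rw [hlo, hhi, hN, Int.cast_one]
    rfl

/-- Since p ≤ 1, there are at most 4/p rounds. Each makes one query of cost at most w, the numerator
of the objective, plus a polynomial overhead that is at most itself times w because w ≥ 1; and w/p
is the objective. -/
lemma runs_sampling_of_eq (hβ : 1 ≤ β) (j : L) (hα : 1 ≤ j.1.1) (hc : 1 ≤ j.1.2)
    (hO : IsExtensionOracle F j.1.1 (O j)) (hk : β * k ≤ n) (hv : ValidT j.1.1 β k t) {B : ℝ}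
    (hB : 1 ≤ B) (hobj : obj j.1.1 j.1.2 β n k t ≤ B) {m : ℕ} {s : State n} (h0 : s.num 0 = k)
    (h4 : s.num 4 = t) (h5 : s.num 5 = m) :
    Runs (run O fuel (sampling β j m) s) fun s' => Improves F s s' ∧
      s'.cost ≤ s.cost + 400 * (n + 1) ^ 2 * B := by
  have hkn := le_of_mul_le hβ hk
  have htn := hv.le hk
  obtain ⟨s₀, hi, hcost, hrun⟩ := run_sampling_of_eq (O := O) (fuel := fuel) (β := β) (F := F) j
    hkn h0 h4 h5
  rw [hrun]
  refine (runs_trials (fuel := fuel) (β := β) j hO htn _ (hi.num0.trans h0)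
    (hi.num4.trans h4)).mono fun s' h => ⟨hi.trans h.1, ?_⟩
  have h1 := hcost htn
  have h2 := h.2
  have hp := hv.tail_pos hα hβ hk
  have hp1 := tail_le_one hkn htn ⌈xval j.1.1 β k t⌉₊
  unfold obj at hobj
  set p := tail n k t ⌈xval j.1.1 β k t⌉₊
  set w : ℝ := j.1.2 ^ ((β * k - t) / j.1.1) with hw
  have hw1 : 1 ≤ w := Real.one_le_rpow hc (div_nonneg (by linarith [hv.2]) (by linarith))
  have hcl : j.1.2 ^ queryLen j.1.1 β k t ≤ w := by
    rw [hw, ← Real.rpow_natCast]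
    exact Real.rpow_le_rpow_of_exponent_le hc (queryLen_le hα hv)
  have hN : ((2 * ⌈1 / p⌉₊ : ℕ) : ℝ) ≤ 4 / p := by
    have h3 : (⌈1 / p⌉₊ : ℝ) < 1 / p + 1 := Nat.ceil_lt_add_one (by positivity)
    have h4 : 1 ≤ 1 / p := by rw [le_div_iff₀ hp]; linarith
    have h5 : 4 / p = 4 * (1 / p) := by ring
    rw [h5]; push_cast; linarith
  have hn : (1 : ℝ) ≤ (n + 1) ^ 2 := one_le_pow₀ (by linarith [Nat.cast_nonneg (α := ℝ) n])
  have h3 : ((2 * ⌈1 / p⌉₊ : ℕ) : ℝ) * (61 * (n + 1) ^ 2 + j.1.2 ^ queryLen j.1.1 β k t) ≤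
      248 * (n + 1) ^ 2 * B := by
    have h4 : 61 * ((n : ℝ) + 1) ^ 2 + j.1.2 ^ queryLen j.1.1 β k t ≤
        61 * (n + 1) ^ 2 * w + (n + 1) ^ 2 * w := by nlinarith
    calc _ ≤ 4 / p * (61 * (n + 1) ^ 2 * w + (n + 1) ^ 2 * w) := by gcongr
      _ = 248 * (n + 1) ^ 2 * (w / p) := by ring
      _ ≤ _ := by gcongr
  nlinarith

lemma runs_sampling_of_ne (j : L) {m : ℕ} {s : State n} (h5 : s.num 5 ≠ m) :
    Runs (run O fuel (sampling β j m) s) fun s' => Improves F s s' ∧ s'.cost ≤ s.cost + 9 := by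
  have e1 : s.charge (1 + (NExp.reg 5).ops s + (NExp.const (m : ℝ)).ops s) = s.charge 4 := by
    rw [NExp.ops_reg, NExp.ops]; norm_num
  have e2 : (s.charge 4).charge (1 + (NExp.const (m : ℝ)).ops (s.charge 4) +
      (NExp.reg 5).ops (s.charge 4)) = (s.charge 4).charge 4 := by
    rw [NExp.ops_reg, NExp.ops]; norm_num
  rw [sampling, run, exec, e1]
  split_ifs with h1
  · rw [exec, e2]
    split_ifs with h2
    · exact absurd (le_antisymm (by simpa [NExp.eval] using h1)
        (by simpa [NExp.eval, State.charge] using h2)) h5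
    · exact runs_pure ⟨⟨rfl, rfl, rfl, le_rfl, id⟩, by simp only [State.charge]; linarith⟩
  · exact runs_pure ⟨⟨rfl, rfl, rfl, le_rfl, id⟩, by simp only [State.charge]; linarith⟩

lemma expect_sampling_fail_le (hF : IsMonotone F) (hβ : 1 ≤ β) (j : L) (hα : 1 ≤ j.1.1)
    (hO : IsExtensionOracle F j.1.1 (O j)) (hk : β * k ≤ n) (hv : ValidT j.1.1 β k t)
    {K : Finset (Fin n)} (hKF : K ∈ F) (hK : #K = k) {m : ℕ} {s : State n} (h0 : s.num 0 = k)
    (h4 : s.num 4 = t) (h5 : s.num 5 = m) :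
    expect (run O fuel (sampling β j m) s) (fail (β * k)) ≤ 1 / 2 := by
  have hkn := le_of_mul_le hβ hk
  obtain ⟨s₀, hi, -, hrun⟩ := run_sampling_of_eq (O := O) (fuel := fuel) (β := β) (F := F) j
    hkn h0 h4 h5
  rw [hrun]
  have hp := hv.tail_pos hα hβ hk
  have hp1 := tail_le_one hkn (hv.le hk) ⌈xval j.1.1 β k t⌉₊
  refine (expect_trials_fail_le (fuel := fuel) hF hβ j hα hO hk hv hKF hK _ (hi.num0.trans h0)
    (hi.num4.trans h4)).trans ?_
  rw [← ENNReal.ofReal_pow (by linarith)]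
  refine (ENNReal.ofReal_le_ofReal (one_sub_half_pow_le hp hp1)).trans_eq ?_
  rw [ENNReal.ofReal_div_of_pos (by norm_num)]; simp

/-- The oracles with their numbers. -/
noncomputable def numbered (L : Finset (ℝ × ℝ)) : List (L × ℕ) := L.attach.toList.zipIdx

/-- Hence the selected number activates only one of the sampling branches. -/
lemma eq_of_mem_numbered {q q' : L × ℕ} (h : q ∈ numbered L) (h' : q' ∈ numbered L)
    (e : q.2 = q'.2) : q = q' := by
  obtain ⟨j, m⟩ := q
  obtain ⟨j', m'⟩ := q'
  simp only at e
  subst e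
  rw [numbered, List.mem_zipIdx_iff_getElem?] at h h'
  rw [h] at h'
  simpa using h'

lemma exists_mem_numbered (j : L) : ∃ m, (j, m) ∈ numbered L := by
  have h : j ∈ L.attach.toList := by simp
  obtain ⟨m, hm, he⟩ := List.mem_iff_getElem.mp h
  exact ⟨m, by rw [numbered, List.mem_zipIdx_iff_getElem?]; simp [← he]⟩

lemma length_numbered (L : Finset (ℝ × ℝ)) : (numbered L).length = #L := by simp [numbered]

/-- The samplings for the oracles in the list `l`. -/
noncomputable def samplings (β : ℝ) (l : List (L × ℕ)) : Algorithm L :=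
  seqs (l.map fun q => sampling β q.1 q.2)

section

variable {q₀ : L × ℕ} {B : ℝ}

lemma runs_sampling (hβ : 1 ≤ β) (hq₀ : q₀ ∈ numbered L) (hα : 1 ≤ q₀.1.1.1) (hc : 1 ≤ q₀.1.1.2)
    (hO : IsExtensionOracle F q₀.1.1.1 (O q₀.1)) (hk : β * k ≤ n) (hv : ValidT q₀.1.1.1 β k t)
    (hB : 1 ≤ B) (hobj : obj q₀.1.1.1 q₀.1.1.2 β n k t ≤ B) {q : L × ℕ} (hq : q ∈ numbered L)
    {s : State n} (h0 : s.num 0 = k) (h4 : s.num 4 = t) (h5 : s.num 5 = q₀.2) :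
    Runs (run O fuel (sampling β q.1 q.2) s) fun s' => Improves F s s' ∧
      s'.cost ≤ s.cost + 400 * (n + 1) ^ 2 * B := by
  by_cases h : q.2 = q₀.2
  · obtain rfl := eq_of_mem_numbered hq hq₀ h
    exact runs_sampling_of_eq hβ _ hα hc hO hk hv hB hobj h0 h4 h5
  · refine (runs_sampling_of_ne (F := F) _ (by rw [h5]; exact_mod_cast Ne.symm h)).mono
      fun s' hs => ⟨hs.1, hs.2.trans ?_⟩
    have hn : (1 : ℝ) ≤ (n + 1) ^ 2 := one_le_pow₀ (by linarith [Nat.cast_nonneg (α := ℝ) n])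
    nlinarith

lemma runs_samplings (hβ : 1 ≤ β) (hq₀ : q₀ ∈ numbered L) (hα : 1 ≤ q₀.1.1.1)
    (hc : 1 ≤ q₀.1.1.2) (hO : IsExtensionOracle F q₀.1.1.1 (O q₀.1)) (hk : β * k ≤ n)
    (hv : ValidT q₀.1.1.1 β k t) (hB : 1 ≤ B) (hobj : obj q₀.1.1.1 q₀.1.1.2 β n k t ≤ B)
    (l : List (L × ℕ)) : (∀ q ∈ l, q ∈ numbered L) → ∀ {s : State n}, s.num 0 = k → s.num 4 = t →
    s.num 5 = q₀.2 → Runs (run O fuel (samplings β l) s) fun s' => Improves F s s' ∧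
      s'.cost ≤ s.cost + (1 + l.length * (400 * (n + 1) ^ 2 * B)) := by
  induction l with
  | nil =>
    intro _ s _ _ _
    rw [samplings, List.map_nil, seqs, run_skip]
    exact runs_pure ⟨⟨rfl, rfl, rfl, le_rfl, id⟩, by simp [State.charge]⟩
  | cons q l ih =>
    intro hl s h0 h4 h5
    rw [samplings, List.map_cons, seqs, run_seq]
    refine (runs_sampling hβ hq₀ hα hc hO hk hv hB hobj (hl q List.mem_cons_self) h0 h4
      h5).andThen fun s₁ h₁ => ?_
    refine (ih (fun q' hq' => hl q' (List.mem_cons_of_mem q hq')) (h₁.1.num0.trans h0)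
      (h₁.1.num4.trans h4) (h₁.1.num5.trans h5)).mono fun s₂ h₂ => ⟨h₁.1.trans h₂.1, ?_⟩
    have := h₁.2
    have := h₂.2
    rw [List.length_cons]
    push_cast
    linarith

/-- Only the branch of the selected oracle counts: the branches before it preserve the selection,
those after it cannot enlarge the output. -/
lemma expect_samplings_fail_le (hF : IsMonotone F) (hβ : 1 ≤ β) (hq₀ : q₀ ∈ numbered L)
    (hα : 1 ≤ q₀.1.1.1) (hc : 1 ≤ q₀.1.1.2) (hO : IsExtensionOracle F q₀.1.1.1 (O q₀.1))
    (hk : β * k ≤ n) (hv : ValidT q₀.1.1.1 β k t) (hB : 1 ≤ B)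
    (hobj : obj q₀.1.1.1 q₀.1.1.2 β n k t ≤ B) {K : Finset (Fin n)} (hKF : K ∈ F) (hK : #K = k)
    (l : List (L × ℕ)) : (∀ q ∈ l, q ∈ numbered L) → q₀ ∈ l → ∀ {s : State n}, s.num 0 = k →
    s.num 4 = t → s.num 5 = q₀.2 →
      expect (run O fuel (samplings β l) s) (fail (β * k)) ≤ 1 / 2 := by
  induction l with
  | nil => intro _ h; simp at h
  | cons q l ih =>
    intro hl hmem s h0 h4 h5
    have hl' : ∀ q' ∈ l, q' ∈ numbered L := fun q' hq' => hl q' (List.mem_cons_of_mem q hq')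
    have hruns := runs_sampling (fuel := fuel) hβ hq₀ hα hc hO hk hv hB hobj
      (hl q List.mem_cons_self) h0 h4 h5
    rw [samplings, List.map_cons, seqs, run_seq]
    rcases List.mem_cons.mp hmem with rfl | hmem'
    · rw [expect_andThen]
      refine le_trans (hruns.expect_mono fun s₁ h₁ => ?_)
        (expect_sampling_fail_le (fuel := fuel) hF hβ _ hα hO hk hv hKF hK h0 h4 h5)
      exact ((runs_samplings (fuel := fuel) hβ hq₀ hα hc hO hk hv hB hobj l hl'
        (h₁.1.num0.trans h0) (h₁.1.num4.trans h4) (h₁.1.num5.trans h5)).mono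
          fun _ h => h.1).expect_fail_le _
    · exact hruns.expect_andThen_le fun s₁ h₁ => ih hl' hmem' (h₁.1.num0.trans h0)
        (h₁.1.num4.trans h4) (h₁.1.num5.trans h5)

end

end

section

variable {L : Finset (ℝ × ℝ)} {n : ℕ} {O : L → OracleFun n} {fuel : ℕ} {β : ℝ} {k t : ℕ}
  {F : Set (Finset (Fin n))}

/-! ### The search for the oracle and the sample size -/

lemma runs_record (m : ℕ) (s : State n) :
    Runs (run O fuel (scan.record m : Algorithm L) s) fun s' => s'.num 0 = s.num 0 ∧
      s'.num 3 = s.num 2 ∧ s'.num 4 = s.num 1 ∧ s'.num 5 = m ∧ s'.set = s.set ∧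
      s'.cost = s.cost + 12 := by
  simp only [scan.record, seqs, run_seq, run_letNum, andThen_pure_some, run_skip]
  apply runs_pure
  simp only [NExp.eval_reg, NExp.ops_reg, NExp.eval, NExp.ops, State.charge, State.putNum]
  refine ⟨by simp, by simp, by simp, by simp, trivial, by ring⟩

/-- For all pairs in `D`, the objective has been compared with the smallest value so far. -/
structure Selected (β : ℝ) (k : ℕ) (D : L → ℕ → Prop) (X : Finset (Fin n)) (s : State n) :
    Prop where
  num0 : s.num 0 = k
  set0 : s.set 0 = X
  lower : ∀ j t, D j t → 0 < s.num 3 ∧ s.num 3 ≤ obj j.1.1 j.1.2 β n k t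
  attained : s.num 3 = 0 ∨ ∃ q ∈ numbered L, ∃ t, ValidT q.1.1.1 β k t ∧
    s.num 3 = obj q.1.1.1 q.1.1.2 β n k t ∧ s.num 4 = t ∧ s.num 5 = q.2

/-- The body of the loop of the search. -/
noncomputable def scanBody (β : ℝ) (j : L) (m : ℕ) : Algorithm L :=
  .seq (letNum 2 (objE j.1.1 j.1.2 β (.reg 0) (.reg 1))) <|
    .ifLe (.reg 3) (.const 0) (scan.record m) <|
      .ifLe (.reg 3) (.reg 2) .skip (scan.record m)

variable {D : L → ℕ → Prop} {X : Finset (Fin n)}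

lemma runs_scanBody (hL : IsSpecList L) (hβ : 1 ≤ β) (hk : β * k ≤ n) {j : L} {m : ℕ}
    (hj : (j, m) ∈ numbered L) (hv : ValidT j.1.1 β k t) {s : State n}
    (hs : Selected β k D X s) (h1 : s.num 1 = t) :
    Runs (run O fuel (scanBody β j m) s) fun s' =>
      Selected β k (fun j' t' => D j' t' ∨ (j' = j ∧ t' = t)) X s' ∧
        s'.cost ≤ s.cost + 139 * (n + 1) ^ 2 := by
  have hkn := le_of_mul_le hβ hk
  have hops := objE_ops_le (β := β) (s := s) (r := 1) j.1.1 j.1.2 hs.num0 h1 (by norm_num) hkn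
    (hv.le hk)
  have heval := objE_eval (β := β) (s := s) (r := 1) j.1.1 j.1.2 hs.num0 h1 (by norm_num)
    (by norm_num) hkn
  have hpos := hv.obj_pos (hL.2 j.1 j.2).1 (hL.2 j.1 j.2).2 hβ hk
  have hn : (1 : ℝ) ≤ (n + 1) ^ 2 := one_le_pow₀ (by linarith [Nat.cast_nonneg (α := ℝ) n])
  set w := obj j.1.1 j.1.2 β n k t with hw
  rw [scanBody, run_seq, run_letNum, andThen_pure_some, heval]
  set s₁ := (s.putNum 2 w).charge (2 + (objE j.1.1 j.1.2 β (.reg 0) (.reg 1)).ops s) with hs₁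
  have e0 : s₁.num 0 = s.num 0 := by simp [hs₁, State.putNum, State.charge]
  have e1 : s₁.num 1 = s.num 1 := by simp [hs₁, State.putNum, State.charge]
  have e2 : s₁.num 2 = w := by simp [hs₁, State.putNum, State.charge]
  have e3 : s₁.num 3 = s.num 3 := by simp [hs₁, State.putNum, State.charge]
  have e4 : s₁.num 4 = s.num 4 := by simp [hs₁, State.putNum, State.charge]
  have e5 : s₁.num 5 = s.num 5 := by simp [hs₁, State.putNum, State.charge]
  have e6 : s₁.set = s.set := rfl
  have e7 : s₁.cost ≤ s.cost + 110 * (n + 1) ^ 2 := by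
    simp only [hs₁, State.putNum, State.charge]; linarith
  clear_value s₁
  have hrec : ∀ s₂ : State n, s₂.num = s₁.num → s₂.set = s₁.set → s₂.cost ≤ s₁.cost + 9 →
      (∀ j' t', D j' t' → w ≤ obj j'.1.1 j'.1.2 β n k t') →
      Runs (run O fuel (scan.record m : Algorithm L) s₂) fun s' =>
        Selected β k (fun j' t' => D j' t' ∨ (j' = j ∧ t' = t)) X s' ∧
          s'.cost ≤ s.cost + 139 * (n + 1) ^ 2 := by
    intro s₂ hnum hset hcost hD
    refine (runs_record m s₂).mono fun s' ⟨r0, r3, r4, r5, rset, rcost⟩ => ⟨⟨?_, ?_, ?_, ?_⟩, ?_⟩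
    · rw [r0, hnum, e0, hs.num0]
    · rw [rset, hset, e6, hs.set0]
    · rw [r3, hnum, e2]
      rintro j' t' (h | ⟨rfl, rfl⟩)
      · exact ⟨hpos, hD j' t' h⟩
      · exact ⟨hpos, le_rfl⟩
    · exact Or.inr ⟨(j, m), hj, t, hv, by rw [r3, hnum, e2], by rw [r4, hnum, e1, h1], r5⟩
    · linarith
  rw [run, exec]
  split_ifs with c1
  · simp only [NExp.eval_reg, NExp.eval, e3] at c1
    -- For any pair examined before, cell 3 would be positive; so there is none, and the first value
    -- is recorded unconditionally.
    refine hrec _ rfl rfl ?_ fun j' t' h => absurd (hs.lower j' t' h).1 (not_lt.mpr c1)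
    simp only [NExp.ops_reg, NExp.ops, State.charge]; linarith
  · simp only [NExp.eval_reg, NExp.eval, e3, not_le] at c1
    rw [exec]
    split_ifs with c2
    · simp only [NExp.eval_reg, State.charge, e2, e3] at c2
      change Runs (run O fuel .skip _) _
      rw [run_skip]
      refine runs_pure ⟨⟨?_, ?_, ?_, ?_⟩, ?_⟩
      · simp only [State.charge]; rw [e0, hs.num0]
      · simp only [State.charge]; rw [e6, hs.set0]
      · simp only [State.charge]; rw [e3]
        rintro j' t' (h | ⟨rfl, rfl⟩)
        · exact hs.lower j' t' h
        · exact ⟨c1, c2⟩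
      · simp only [State.charge]; rw [e3, e4, e5]; exact hs.attained
      · simp only [NExp.ops_reg, NExp.ops, State.charge]; linarith
    · simp only [NExp.eval_reg, State.charge, e2, e3, not_le] at c2
      refine hrec _ rfl rfl ?_ fun j' t' h => c2.le.trans (hs.lower j' t' h).2
      simp only [NExp.ops_reg, NExp.ops, State.charge]; linarith

lemma Selected.imp {D' : L → ℕ → Prop} {s : State n} (hs : Selected β k D X s)
    (h : ∀ j t, D' j t → D j t) : Selected β k D' X s :=
  ⟨hs.1, hs.2, fun j t hj => hs.3 j t (h j t hj), hs.4⟩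

lemma runs_scan (hL : IsSpecList L) (hβ : 1 ≤ β) (hk : β * k ≤ n) {j : L} {m : ℕ}
    (hj : (j, m) ∈ numbered L) {s : State n} (hs : Selected β k D X s) :
    Runs (run O fuel (scan β j m) s) fun s' =>
      Selected β k (fun j' t' => D j' t' ∨ (j' = j ∧ ValidT j'.1.1 β k t')) X s' ∧
        s'.cost ≤ s.cost + 150 * (n + 1) ^ 3 := by
  have hM := Mstar_nonneg (α := j.1.1) hβ
  have hk0 : (0 : ℝ) ≤ k := Nat.cast_nonneg k
  set t₀ := ⌈Mstar j.1.1 β * k⌉₊ with ht₀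
  have hlo : ⌈(NExp.mul (.const (Mstar j.1.1 β)) (.reg 0)).eval s⌉ = (t₀ : ℤ) := by
    simp only [NExp.eval, NExp.eval_reg, hs.num0]
    exact (Int.natCast_ceil_eq_ceil (by positivity)).symm
  have hhi : ⌊(NExp.mul (.const β) (.reg 0)).eval s⌋ = (⌊β * k⌋₊ : ℤ) := by
    simp only [NExp.eval, NExp.eval_reg, hs.num0]
    exact (Int.natCast_floor_eq_floor (by positivity)).symm
  have hfl : ((⌊β * k⌋₊ : ℕ) : ℝ) ≤ β * k := Nat.floor_le (by positivity)
  have hfln : ⌊β * k⌋₊ ≤ n := by exact_mod_cast hfl.trans hk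
  have hn : (0 : ℝ) ≤ n := Nat.cast_nonneg n
  rw [scan, run, exec, hlo, hhi]
  set N := ((⌊β * k⌋₊ : ℤ) + 1 - (t₀ : ℤ)).toNat with hN
  have hloop := runs_forIter (σ := State n) (k := N)
    (s := s.charge (1 + (NExp.mul (.const (Mstar j.1.1 β)) (.reg 0)).ops s +
      (NExp.mul (.const β) (.reg 0)).ops s))
    (body := fun m' s' => exec (fun j : L => j.1.2) O fuel (scanBody β j m)
      ((s'.putNum 1 (((t₀ : ℤ) : ℝ) + (m' : ℝ))).charge 1))
    -- After `m'` iterations the admissible sizes below `t₀ + m'` have been compared.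
    (I := fun (m' : ℕ) s' => Selected β k
      (fun j' t' => D j' t' ∨ (j' = j ∧ ValidT j'.1.1 β k t' ∧ t' < t₀ + m')) X s' ∧
        s'.cost ≤ s.cost + 9 + m' * (140 * (n + 1) ^ 2))
    ⟨?_, ?_⟩ ?_
  · refine hloop.mono fun s' h => ⟨h.1.imp ?_, h.2.trans ?_⟩
    · rintro j' t' (h' | ⟨rfl, hv'⟩)
      · exact Or.inl h'
      · refine Or.inr ⟨rfl, hv', ?_⟩
        have : t' ≤ ⌊β * k⌋₊ := Nat.le_floor hv'.2
        omega
    · have : (N : ℝ) ≤ n + 1 := by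
        have : N ≤ n + 1 := by omega
        exact_mod_cast this
      have h2 : (N : ℝ) * (140 * (n + 1) ^ 2) ≤ (n + 1) * (140 * (n + 1) ^ 2) := by gcongr
      have h3 : (1 : ℝ) ≤ (n + 1) ^ 3 := one_le_pow₀ (by linarith)
      nlinarith
  · refine Selected.imp (D := D) ⟨hs.num0, hs.set0, hs.lower, hs.attained⟩ ?_
    rintro j' t' (h | ⟨rfl, h, h'⟩)
    · exact h
    · have : t₀ ≤ t' := Nat.ceil_le.mpr h.1
      omega
  · simp only [NExp.ops, NExp.ops_reg, State.charge]; norm_num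
  · intro m' hm' s₁ h
    have hcast : (((t₀ : ℤ) : ℝ) + (m' : ℝ)) = ((t₀ + m' : ℕ) : ℝ) := by push_cast; rfl
    have hv : ValidT j.1.1 β k (t₀ + m') := by
      constructor
      · exact (Nat.le_ceil _).trans (by exact_mod_cast Nat.le_add_right _ _)
      · have : t₀ + m' ≤ ⌊β * k⌋₊ := by omega
        exact le_trans (by exact_mod_cast this) hfl
    have hsel : Selected β k
        (fun j' t' => D j' t' ∨ (j' = j ∧ ValidT j'.1.1 β k t' ∧ t' < t₀ + m')) X
        ((s₁.putNum 1 (((t₀ : ℤ) : ℝ) + (m' : ℝ))).charge 1) := by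
      obtain ⟨g1, g2, g3, g4⟩ := h.1
      refine ⟨?_, g2, fun j' t' hj' => ?_, ?_⟩
      · simpa [State.putNum, State.charge] using g1
      · simpa [State.putNum, State.charge] using g3 j' t' hj'
      · simpa [State.putNum, State.charge] using g4
    have hone : ((s₁.putNum 1 (((t₀ : ℤ) : ℝ) + (m' : ℝ))).charge 1).num 1 =
        ((t₀ + m' : ℕ) : ℝ) := by
      rw [← hcast]; simp [State.putNum, State.charge]
    refine (runs_scanBody (fuel := fuel) hL hβ hk hj hv hsel hone).mono
      fun s₂ h₂ => ⟨h₂.1.imp ?_, ?_⟩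
    · rintro j' t' (h | ⟨rfl, h, h'⟩)
      · exact Or.inl (Or.inl h)
      · rcases Nat.lt_or_ge t' (t₀ + m') with h3 | h3
        · exact Or.inl (Or.inr ⟨rfl, h, h3⟩)
        · exact Or.inr ⟨rfl, by omega⟩
    · have e : ((s₁.putNum 1 (((t₀ : ℤ) : ℝ) + (m' : ℝ))).charge 1).cost = s₁.cost + 1 := rfl
      have h3 := h₂.2
      rw [e] at h3
      have h4 := h.2
      have h5 : (1 : ℝ) ≤ (n + 1) ^ 2 := one_le_pow₀ (by linarith)
      push_cast
      linarith

/-- The searches for the oracles in the list `l`. -/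
noncomputable def scans (β : ℝ) (l : List (L × ℕ)) : Algorithm L :=
  seqs (l.map fun q => scan β q.1 q.2)

lemma runs_scans (hL : IsSpecList L) (hβ : 1 ≤ β) (hk : β * k ≤ n) (l : List (L × ℕ)) :
    (∀ q ∈ l, q ∈ numbered L) → ∀ {D : L → ℕ → Prop} {s : State n}, Selected β k D X s →
    Runs (run O fuel (scans β l) s) fun s' =>
      Selected β k (fun j t => D j t ∨ ((∃ q ∈ l, j = q.1) ∧ ValidT j.1.1 β k t)) X s' ∧
        s'.cost ≤ s.cost + (1 + l.length * (150 * (n + 1) ^ 3)) := by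
  induction l with
  | nil =>
    intro _ D s hs
    rw [scans, List.map_nil, seqs, run_skip]
    refine runs_pure ⟨Selected.imp (D := D) ⟨hs.1, hs.2, hs.3, hs.4⟩ ?_, by simp [State.charge]⟩
    rintro j t (h | ⟨⟨q, hq, -⟩, -⟩)
    · exact h
    · simp at hq
  | cons q l ih =>
    intro hl D s hs
    rw [scans, List.map_cons, seqs, run_seq]
    refine (runs_scan hL hβ hk (j := q.1) (m := q.2) (hl q List.mem_cons_self) hs).andThen
      fun s₁ h₁ => ?_
    refine (ih (fun q' hq' => hl q' (List.mem_cons_of_mem q hq')) h₁.1).mono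
      fun s₂ h₂ => ⟨h₂.1.imp ?_, ?_⟩
    · rintro j t (h | ⟨⟨q', hq', rfl⟩, hv⟩)
      · exact Or.inl (Or.inl h)
      · rcases List.mem_cons.mp hq' with rfl | hq''
        · exact Or.inl (Or.inr ⟨rfl, hv⟩)
        · exact Or.inr ⟨⟨q', hq'', rfl⟩, hv⟩
    · have := h₁.2
      have := h₂.2
      rw [List.length_cons]
      push_cast
      linarith

/-! ### The main loop -/

/-- The computations for one value of `k`. -/
noncomputable def mainBody (L : Finset (ℝ × ℝ)) (β : ℝ) : Algorithm L :=
  seqs [letNum 3 (.const 0), scans β (numbered L), samplings β (numbered L)]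

/-- The output for one value of `k`, before the samplings. -/
lemma runs_search (hL : IsSpecList L) (hβ : 1 ≤ β) (hk : β * k ≤ n) {s : State n}
    (h0 : s.num 0 = k) :
    Runs (run O fuel (scans β (numbered L)) ((s.putNum 3 0).charge 3)) fun s' =>
      (s'.num 0 = k ∧ s'.set 0 = s.set 0 ∧ ∃ q ∈ numbered L, ∃ t, ValidT q.1.1.1 β k t ∧
        s'.num 4 = t ∧ s'.num 5 = q.2 ∧ ∀ j ∈ L, ∀ t', ValidT j.1 β k t' →
          obj q.1.1.1 q.1.1.2 β n k t ≤ obj j.1 j.2 β n k t') ∧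
      s'.cost ≤ s.cost + (4 + #L * (150 * (n + 1) ^ 3)) := by
  have hsel : Selected (L := L) β k (fun _ _ => False) (s.set 0) ((s.putNum 3 0).charge 3) := by
    refine ⟨?_, rfl, fun _ _ h => h.elim, Or.inl ?_⟩
    · simpa [State.putNum, State.charge] using h0
    · simp [State.putNum, State.charge]
  refine (runs_scans hL hβ hk (numbered L) (fun _ h => h) hsel).mono fun s' h =>
    ⟨⟨h.1.num0, h.1.set0, ?_⟩, ?_⟩
  · have hall : ∀ j : L, ∀ t', ValidT j.1.1 β k t' →
        0 < s'.num 3 ∧ s'.num 3 ≤ obj j.1.1 j.1.2 β n k t' := fun j t' hv => by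
      obtain ⟨m, hm⟩ := exists_mem_numbered j
      exact h.1.lower j t' (Or.inr ⟨⟨(j, m), hm, rfl⟩, hv⟩)
    rcases h.1.attained with h3 | ⟨q, hq, t, hv, h3, h4, h5⟩
    -- Cell 3 cannot still be zero: `t = k` is always admissible and the list is non-empty.
    · obtain ⟨j, hj⟩ := hL.1
      have := (hall ⟨j, hj⟩ k (validT_self hβ k)).1
      rw [h3] at this
      exact absurd this (lt_irrefl 0)
    · exact ⟨q, hq, t, hv, h4, h5, fun j hj t' hv' => h3 ▸ (hall ⟨j, hj⟩ t' hv').2⟩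
  · have h2 := h.2
    rw [length_numbered] at h2
    simp only [State.putNum, State.charge] at h2
    linarith

lemma run_mainBody (s : State n) : run O fuel (mainBody L β) s =
    andThen (run O fuel (scans β (numbered L)) ((s.putNum 3 0).charge 3)) fun s' =>
      andThen (run O fuel (samplings β (numbered L)) s') (run O fuel .skip) := by
  rw [mainBody, seqs, run_seq, run_letNum, andThen_pure_some, seqs, run_seq, seqs]
  have e : (s.putNum 3 ((NExp.const 0).eval s)).charge (2 + (NExp.const 0).ops s) =
      (s.putNum 3 0).charge 3 := by
    simp only [NExp.eval, NExp.ops]; norm_num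
  rw [e]
  congr 1

/-- The value `B` bounds the minimum of the objective for `k`. -/
def MinObjLE (L : Finset (ℝ × ℝ)) (β : ℝ) (n k : ℕ) (B : ℝ) : Prop :=
  ∃ j ∈ L, ∃ t, ValidT j.1 β k t ∧ obj j.1 j.2 β n k t ≤ B

lemma runs_mainBody (hL : IsSpecList L) (hβ : 1 ≤ β)
    (hO : ∀ j : L, IsExtensionOracle F j.1.1 (O j)) (hk : β * k ≤ n) {B : ℝ} (hB : 1 ≤ B)
    (hmin : MinObjLE L β n k B) {s : State n} (h0 : s.num 0 = k) :
    Runs (run O fuel (mainBody L β) s) fun s' =>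
      (#(s'.set 0) ≤ #(s.set 0) ∧ (s.set 0 ∈ F → s'.set 0 ∈ F)) ∧
        s'.cost ≤ s.cost + (6 + 550 * #L) * (n + 1) ^ 3 * B := by
  obtain ⟨j, hj, t', hv', hobj'⟩ := hmin
  rw [run_mainBody]
  refine (runs_search hL hβ hk h0).andThen fun s₁ ⟨⟨h1, hset, q, hq, t, hv, h4, h5, hle⟩, hc⟩ => ?_
  have hobj := (hle j hj t' hv').trans hobj'
  obtain ⟨hα, hc1⟩ := hL.2 q.1.1 q.1.2
  refine (runs_samplings hβ hq hα hc1 (hO q.1) hk hv hB hobj (numbered L) (fun _ h => h) h1 h4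
    h5).andThen fun s₂ ⟨hi, hc2⟩ => ?_
  rw [run_skip]
  refine runs_pure ⟨⟨?_, fun h => ?_⟩, ?_⟩
  · have := hi.card_le; rwa [hset] at this
  · have := hi.mem; rw [hset] at this; exact this h
  · rw [length_numbered] at hc2
    simp only [State.charge]
    have hn : (0 : ℝ) ≤ n := Nat.cast_nonneg n
    have hn3 : (1 : ℝ) ≤ (n + 1) ^ 3 := one_le_pow₀ (by linarith)
    have hn2 : ((n : ℝ) + 1) ^ 2 ≤ (n + 1) ^ 3 :=
      pow_le_pow_right₀ (by linarith) (by norm_num)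
    have hL0 : (0 : ℝ) ≤ #L := Nat.cast_nonneg _
    have a1 : (#L : ℝ) * (400 * (n + 1) ^ 2 * B) ≤ #L * (400 * (n + 1) ^ 3 * B) := by gcongr
    have a2 : (#L : ℝ) * (150 * (n + 1) ^ 3) ≤ #L * (150 * (n + 1) ^ 3 * B) :=
      mul_le_mul_of_nonneg_left (le_mul_of_one_le_right (by positivity) hB) hL0
    have a3 : 1 ≤ ((n : ℝ) + 1) ^ 3 * B := one_le_mul_of_one_le_of_one_le hn3 hB
    nlinarith

lemma expect_mainBody_fail_le (hL : IsSpecList L) (hF : IsMonotone F) (hβ : 1 ≤ β)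
    (hO : ∀ j : L, IsExtensionOracle F j.1.1 (O j)) (hk : β * k ≤ n) {B : ℝ} (hB : 1 ≤ B)
    (hmin : MinObjLE L β n k B) {K : Finset (Fin n)} (hKF : K ∈ F) (hK : #K = k) {s : State n}
    (h0 : s.num 0 = k) :
    expect (run O fuel (mainBody L β) s) (fail (β * k)) ≤ 1 / 2 := by
  obtain ⟨j, hj, t', hv', hobj'⟩ := hmin
  rw [run_mainBody]
  refine (runs_search hL hβ hk h0).expect_andThen_le
    fun s₁ ⟨⟨h1, hset, q, hq, t, hv, h4, h5, hle⟩, hc⟩ => ?_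
  have hobj := (hle j hj t' hv').trans hobj'
  obtain ⟨hα, hc1⟩ := hL.2 q.1.1 q.1.2
  rw [expect_andThen]
  refine le_trans ((runs_samplings (fuel := fuel) hβ hq hα hc1 (hO q.1) hk hv hB hobj (numbered L)
    (fun _ h => h) h1 h4 h5).expect_mono fun s₂ _ => ?_)
    (expect_samplings_fail_le (fuel := fuel) hF hβ hq hα hc1 (hO q.1) hk hv hB hobj hKF hK
      (numbered L) (fun _ h => h) hq h1 h4 h5)
  simp only [Option.elim_some]
  rw [run_skip, expect_pure]
  exact le_rfl

/-- One iteration of the main loop. -/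
noncomputable def mainStep (O : L → OracleFun n) (fuel : ℕ) (β : ℝ) (m : ℕ) (s : State n) :
    PMF (Option (State n)) :=
  run O fuel (mainBody L β) ((s.putNum 0 ((0 : ℝ) + (m : ℝ))).charge 1)

lemma run_amls (hβ : 1 ≤ β) : run O fuel (amls L β) (State.init n) =
    forIter (mainStep O fuel β) (⌊(n : ℝ) / β⌋₊ + 1)
      ((((State.init n).putSet 0 univ).charge (n + 3)).charge 5) := by
  have hstep : (fun (m : ℕ) (s' : State n) => exec (fun j : L => j.1.2) O fuel (mainBody L β)
      ((s'.putNum 0 ((0 : ℝ) + (m : ℝ))).charge 1)) = mainStep O fuel β := rfl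
  rw [amls, run_seq, run_letSet, andThen_pure_some, run, exec]
  have e : ((State.init n).putSet 0 (SExp.univ.eval (State.init n))).charge
      (2 + SExp.univ.ops (State.init n)) = ((State.init n).putSet 0 univ).charge (n + 3) := by
    simp only [SExp.eval, SExp.ops, State.charge, State.putSet, State.mk.injEq, true_and]; ring
  rw [e]
  simp only [NExp.eval, NExp.ops, Int.ceil_zero, Int.cast_zero]
  have hN : (⌊(n : ℝ) / β⌋ + 1 - 0).toNat = ⌊(n : ℝ) / β⌋₊ + 1 := by
    rw [← Int.natCast_floor_eq_floor (by positivity)]; omega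
  rw [hN]
  change forIter (mainStep O fuel β) _ _ = _
  norm_num

lemma runs_mainLoop (hL : IsSpecList L) (hβ : 1 ≤ β)
    (hO : ∀ j : L, IsExtensionOracle F j.1.1 (O j)) {B : ℝ} (hB : 1 ≤ B)
    (hmin : ∀ k : ℕ, β * k ≤ n → MinObjLE L β n k B) {N : ℕ}
    (hN : ∀ k < N, β * k ≤ n) (s : State n) :
    Runs (forIter (mainStep O fuel β) N s) fun s' =>
      (#(s'.set 0) ≤ #(s.set 0) ∧ (s.set 0 ∈ F → s'.set 0 ∈ F)) ∧
        s'.cost ≤ s.cost + N * ((7 + 550 * #L) * (n + 1) ^ 3 * B) := by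
  refine runs_forIter (I := fun (m : ℕ) (s' : State n) =>
    (#(s'.set 0) ≤ #(s.set 0) ∧ (s.set 0 ∈ F → s'.set 0 ∈ F)) ∧
        s'.cost ≤ s.cost + m * ((7 + 550 * #L) * (n + 1) ^ 3 * B))
    ⟨⟨le_rfl, id⟩, by simp⟩ fun m hm s₁ h => ?_
  have h0 : ((s₁.putNum 0 ((0 : ℝ) + (m : ℝ))).charge 1).num 0 = m := by
    simp [State.putNum, State.charge]
  refine (runs_mainBody (fuel := fuel) hL hβ hO (hN m hm) hB (hmin m (hN m hm)) h0).mono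
    fun s₂ h₂ => ⟨⟨h₂.1.1.trans h.1.1, fun hs => h₂.1.2 (h.1.2 hs)⟩, ?_⟩
  have e : ((s₁.putNum 0 ((0 : ℝ) + (m : ℝ))).charge 1).cost = s₁.cost + 1 := rfl
  have h3 := h₂.2
  rw [e] at h3
  have h4 := h.2
  have hn3 : (1 : ℝ) ≤ (n + 1) ^ 3 := one_le_pow₀ (by linarith [Nat.cast_nonneg (α := ℝ) n])
  have a3 : 1 ≤ ((n : ℝ) + 1) ^ 3 * B := one_le_mul_of_one_le_of_one_le hn3 hB
  push_cast
  linarith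

/-- The iteration for the size of `K` fails with probability at most 1/2 from any state, and later
iterations cannot enlarge the output. -/
lemma expect_mainLoop_fail_le (hL : IsSpecList L) (hF : IsMonotone F) (hβ : 1 ≤ β)
    (hO : ∀ j : L, IsExtensionOracle F j.1.1 (O j)) {B : ℝ} (hB : 1 ≤ B)
    (hmin : ∀ k : ℕ, β * k ≤ n → MinObjLE L β n k B) {K : Finset (Fin n)} (hKF : K ∈ F)
    (hK : #K = k) {N : ℕ} (hkN : k < N) (hN : ∀ k < N, β * k ≤ n) (s : State n) :
    expect (forIter (mainStep O fuel β) N s) (fail (β * k)) ≤ 1 / 2 := by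
  induction N, hkN using Nat.le_induction with
  | base =>
    have hk := hN k (Nat.lt_succ_self k)
    refine (runs_mainLoop (fuel := fuel) hL hβ hO hB hmin (N := k)
      (fun k' hk' => hN k' (by omega)) s).expect_andThen_le fun s₁ _ => ?_
    exact expect_mainBody_fail_le (s := (s₁.putNum 0 ((0 : ℝ) + (k : ℝ))).charge 1)
      hL hF hβ hO hk hB (hmin k hk) hKF hK (by simp [State.putNum, State.charge])
  | succ N hkN ih =>
    have hN' : ∀ k < N, β * k ≤ n := fun k' hk' => hN k' (by omega)
    rw [forIter, expect_andThen]
    refine le_trans ((runs_mainLoop (fuel := fuel) hL hβ hO hB hmin hN' s).expect_mono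
      fun s₁ _ => ?_) (ih hN')
    have h0 : ((s₁.putNum 0 ((0 : ℝ) + (N : ℝ))).charge 1).num 0 = N := by
      simp [State.putNum, State.charge]
    have hk := hN N (Nat.lt_succ_self N)
    exact (runs_mainBody (fuel := fuel) hL hβ hO hk hB (hmin N hk) h0).expect_le
      fun s₂ h₂ => fail_mono (s := s₁) h₂.1.1

lemma mul_le_of_lt_floor_add_one (hβ : 1 ≤ β) {k : ℕ} (hk : k < ⌊(n : ℝ) / β⌋₊ + 1) :
    β * k ≤ n := by
  have h1 : (k : ℝ) ≤ ⌊(n : ℝ) / β⌋₊ := by exact_mod_cast Nat.lt_succ_iff.mp hk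
  have h2 := h1.trans (Nat.floor_le (by positivity))
  rw [le_div_iff₀ (by linarith)] at h2
  linarith

lemma runs_amls (hL : IsSpecList L) (hF : IsMonotone F) (hβ : 1 ≤ β)
    (hO : ∀ j : L, IsExtensionOracle F j.1.1 (O j)) {B : ℝ} (hB : 1 ≤ B)
    (hmin : ∀ k : ℕ, β * k ≤ n → MinObjLE L β n k B) :
    Runs (run O fuel (amls L β) (State.init n)) fun s =>
      s.set 0 ∈ F ∧ s.cost ≤ (15 + 550 * #L) * (n + 1) ^ 4 * B := by
  rw [run_amls hβ]
  refine (runs_mainLoop (fuel := fuel) hL hβ hO hB hmin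
    (fun k hk => mul_le_of_lt_floor_add_one hβ hk) _).mono fun s h => ⟨h.1.2 ?_, h.2.trans ?_⟩
  · simpa [State.putSet, State.charge] using hF.1
  · simp only [State.putSet, State.charge, State.init]
    have hn : (0 : ℝ) ≤ n := Nat.cast_nonneg n
    have hN : ((⌊(n : ℝ) / β⌋₊ + 1 : ℕ) : ℝ) ≤ n + 1 := by
      have h1 : ((⌊(n : ℝ) / β⌋₊ : ℕ) : ℝ) ≤ n / β := Nat.floor_le (by positivity)
      have h2 : (n : ℝ) / β ≤ n := div_le_self hn hβ
      push_cast; linarith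
    have h3 : ((⌊(n : ℝ) / β⌋₊ + 1 : ℕ) : ℝ) * ((7 + 550 * #L) * (n + 1) ^ 3 * B) ≤
        (n + 1) * ((7 + 550 * #L) * (n + 1) ^ 3 * B) := by gcongr
    have h4 : (n : ℝ) + 1 ≤ (n + 1) ^ 4 := le_self_pow₀ (by linarith) (by norm_num)
    have h5 : ((n : ℝ) + 1) ^ 4 ≤ (n + 1) ^ 4 * B := le_mul_of_one_le_right (by positivity) hB
    have e : ((n : ℝ) + 1) * ((7 + 550 * #L) * (n + 1) ^ 3 * B) =
      (7 + 550 * #L) * (n + 1) ^ 4 * B := by ring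
    nlinarith

/-- If `β * #K` exceeds `n`, the size of `K` is never tried, but then every subset of the universe
is small enough. -/
lemma expect_amls_fail_le (hL : IsSpecList L) (hF : IsMonotone F) (hβ : 1 ≤ β)
    (hO : ∀ j : L, IsExtensionOracle F j.1.1 (O j)) {B : ℝ} (hB : 1 ≤ B)
    (hmin : ∀ k : ℕ, β * k ≤ n → MinObjLE L β n k B) {K : Finset (Fin n)} (hKF : K ∈ F) :
    expect (run O fuel (amls L β) (State.init n)) (fail (β * #K)) ≤ 1 / 2 := by
  by_cases hk : β * #K ≤ n
  · rw [run_amls hβ]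
    refine expect_mainLoop_fail_le hL hF hβ hO hB hmin hKF rfl ?_
      (fun k hk => mul_le_of_lt_floor_add_one hβ hk) _
    rw [Nat.lt_succ_iff]
    apply Nat.le_floor
    rw [le_div_iff₀ (by linarith)]
    linarith
  · refine (runs_amls (fuel := fuel) hL hF hβ hO hB hmin).expect_le fun s _ => ?_
    have h1 : #(s.set 0) ≤ n := by simpa using card_le_univ (s.set 0)
    have h2 : (#(s.set 0) : ℝ) ≤ n := by exact_mod_cast h1
    have : (#(s.set 0) : ℝ) ≤ β * #K := by linarith
    simp [fail, this]

end

section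

variable {L : Finset (ℝ × ℝ)} {β : ℝ} {n k : ℕ}

/-! ### The cost and the correctness of approximate monotone local search -/

lemma ValidT.one_le_obj {α c : ℝ} (hα : 1 ≤ α) (hc : 1 ≤ c) (hβ : 1 ≤ β) {t : ℕ}
    (hk : β * k ≤ n) (h : ValidT α β k t) : 1 ≤ obj α c β n k t := by
  unfold obj
  rw [one_le_div (h.tail_pos hα hβ hk)]
  refine (tail_le_one (le_of_mul_le hβ hk) (h.le hk) _).trans (Real.one_le_rpow hc ?_)
  exact div_nonneg (sub_nonneg.mpr h.2) (by linarith)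

lemma MinObjLE.mono {B B' : ℝ} (h : MinObjLE L β n k B) (hB : B ≤ B') : MinObjLE L β n k B' := by
  obtain ⟨j, hj, t, hv, hle⟩ := h
  exact ⟨j, hj, t, hv, hle.trans hB⟩

lemma MinObjLE.one_le (hL : IsSpecList L) (hβ : 1 ≤ β) (hk : β * k ≤ n) {B : ℝ}
    (h : MinObjLE L β n k B) : 1 ≤ B := by
  obtain ⟨j, hj, t, hv, hle⟩ := h
  exact (hv.one_le_obj (hL.2 j hj).1 (hL.2 j hj).2 hβ hk).trans hle

/-- To bound the minimum of the objective, it suffices to bound its positive lower bounds. -/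
lemma minObjLE_of_forall (hL : IsSpecList L) (hβ : 1 ≤ β) (hk : β * k ≤ n) {B : ℝ}
    (h : ∀ Φ : ℝ, 0 < Φ → (∀ j ∈ L, ∀ t, ValidT j.1 β k t → Φ ≤ obj j.1 j.2 β n k t) → Φ ≤ B) :
    MinObjLE L β n k B := by
  classical
  -- Admissible `t` are at most `n`, so the minimum is attained; it is positive and can itself be
  -- taken as Φ.
  have hne : ((L ×ˢ range (n + 1)).filter fun q => ValidT q.1.1 β k q.2).Nonempty := by
    obtain ⟨j, hj⟩ := hL.1
    refine ⟨(j, k), mem_filter.mpr ⟨mem_product.mpr ⟨hj, mem_range.mpr ?_⟩, validT_self hβ k⟩⟩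
    exact Nat.lt_succ_of_le (le_of_mul_le hβ hk)
  obtain ⟨⟨j, t⟩, hq, hmin⟩ := exists_min_image _
    (fun q : (ℝ × ℝ) × ℕ => obj q.1.1 q.1.2 β n k q.2) hne
  obtain ⟨hq, hv⟩ := mem_filter.mp hq
  have hj := (mem_product.mp hq).1
  refine ⟨j, hj, t, hv, h _ (hv.obj_pos (hL.2 j hj).1 (hL.2 j hj).2 hβ hk) fun j' hj' t' hv' => ?_⟩
  exact hmin (j', t') (mem_filter.mpr ⟨mem_product.mpr
    ⟨hj', mem_range.mpr (Nat.lt_succ_of_le (hv'.le hk))⟩, hv'⟩)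

/-- A crude bound from `t = k`, where the sample is the whole solution with probability 1 / C(n, k)
≥ 2^(-n). It serves where any finite bound will do: for correctness, and to see that the infimum
`best` is over a non-empty set. -/
lemma minObjLE_pow (hL : IsSpecList L) (hβ : 1 ≤ β) (hk : β * k ≤ n) {cmax : ℝ}
    (hcmax : ∀ j ∈ L, j.2 ≤ cmax) : MinObjLE L β n k ((2 * cmax) ^ n) := by
  obtain ⟨j, hj⟩ := hL.1
  obtain ⟨hα, hc⟩ := hL.2 j hj
  have hkn := le_of_mul_le hβ hk
  have hv := validT_self (α := j.1) hβ k
  refine ⟨j, hj, k, hv, ?_⟩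
  unfold obj
  rw [div_le_iff₀ (hv.tail_pos hα hβ hk)]
  have hexp : (β * k - k) / j.1 ≤ n := by
    have h1 : (0 : ℝ) ≤ β * k - k := sub_nonneg.mpr hv.2
    have h2 := div_le_self h1 hα
    have h3 : (0 : ℝ) ≤ k := Nat.cast_nonneg k
    linarith
  have hpow : j.2 ^ ((β * k - k) / j.1) ≤ cmax ^ n :=
    (Real.rpow_le_rpow_of_exponent_le hc hexp).trans
      ((Real.rpow_natCast _ _).trans_le (pow_le_pow_left₀ (by linarith) (hcmax j hj) n))
  have hcpos : 0 ≤ cmax ^ n := pow_nonneg (by linarith [hcmax j hj]) n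
  have htail : 1 ≤ 2 ^ n * tail n k k ⌈xval j.1 β k k⌉₊ := by
    have h1 : hyp n k k k ≤ tail n k k ⌈xval j.1 β k k⌉₊ :=
      single_le_sum (f := hyp n k k) (fun i _ => hyp_nonneg n k k i)
        (mem_Icc.mpr ⟨(hv.ceil_le hα hβ).1, (min_self k).ge⟩)
    have h2 : hyp n k k k = 1 / n.choose k := by simp [hyp]
    have h3 : (n.choose k : ℝ) ≤ 2 ^ n := by exact_mod_cast Nat.choose_le_two_pow n k
    have h4 : (0 : ℝ) < n.choose k := by exact_mod_cast Nat.choose_pos hkn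
    calc (1 : ℝ) ≤ 2 ^ n * (1 / n.choose k) := by rw [mul_one_div, one_le_div h4]; exact h3
      _ ≤ _ := by rw [← h2]; gcongr
  rw [mul_pow, mul_right_comm]
  exact hpow.trans (le_mul_of_one_le_left hcpos htail)

lemma exists_card_eq_minSize {F : Set (Finset (Fin n))} (hF : IsMonotone F) :
    ∃ K ∈ F, #K = minSize F :=
  Nat.sInf_mem (s := {m | ∃ S ∈ F, #S = m}) ⟨_, univ, hF.1, rfl⟩

lemma le_sum_snd (hL : IsSpecList L) : ∀ j ∈ L, j.2 ≤ ∑ j ∈ L, j.2 := fun _ hj =>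
  single_le_sum (f := fun j : ℝ × ℝ => j.2) (fun i hi => by linarith [(hL.2 i hi).2]) hj

lemma one_le_sum_snd (hL : IsSpecList L) : 1 ≤ ∑ j ∈ L, j.2 := by
  obtain ⟨j, hj⟩ := hL.1
  exact (hL.2 j hj).2.trans (le_sum_snd hL j hj)

/-- The program has no `while` loops, so fuel `0` already shows its full behaviour. -/
theorem isApprox_amls (hL : IsSpecList L) (hβ : 1 ≤ β) : (amls L β).IsApprox β := by
  intro n F hF O hO
  have hmin : ∀ k : ℕ, β * k ≤ n → MinObjLE L β n k ((2 * ∑ j ∈ L, j.2) ^ n) := fun k hk =>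
    minObjLE_pow hL hβ hk (le_sum_snd hL)
  have hB : 1 ≤ (2 * ∑ j ∈ L, j.2) ^ n := one_le_pow₀ (by linarith [one_le_sum_snd hL])
  have hruns : Runs (Algorithm.run (amls L β) O 0) _ := runs_amls hL hF hβ hO hB hmin
  constructor
  · refine le_antisymm (iSup_le fun fuel => ?_) (le_iSup_of_le 0 (ge_of_eq ?_))
    · rw [toOuterMeasure_eq_expect]
      refine expect_le_of_support fun o _ => ?_
      exact Set.indicator_le_self' (fun _ _ => zero_le) o
    · rw [PMF.toOuterMeasure_apply_eq_one_iff]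
      intro o ho
      obtain ⟨s, rfl, hs⟩ := hruns o ho
      exact ⟨s, rfl, hs.1⟩
  · obtain ⟨K, hKF, hK⟩ := exists_card_eq_minSize hF
    have hfail := expect_amls_fail_le (fuel := 0) hL hF hβ hO hB hmin hKF
    rw [hK] at hfail
    refine le_iSup_of_le 0 ?_
    rw [toOuterMeasure_eq_expect]
    set p := Algorithm.run (amls L β) O 0 with hp
    change expect p (fail (β * minSize F)) ≤ 1 / 2 at hfail
    have hone : (1 : ℝ≥0∞) ≤ expect p (Set.indicator
        {o | ∃ s, o = some s ∧ (#(s.set 0) : ℝ) ≤ β * minSize F} 1) + 1 / 2 := by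
      refine le_trans ?_ (add_le_add_right hfail _)
      rw [← expect_add]
      refine (expect_const p 1).symm.le.trans (expect_mono_support fun o _ => ?_)
      rcases o with _ | s
      · simp [fail]
      · by_cases h : (#(s.set 0) : ℝ) ≤ β * minSize F <;> simp [fail, h]
    have h2 : (1 : ℝ≥0∞) / 2 + 1 / 2 = 1 := ENNReal.add_halves 1
    exact (ENNReal.add_le_add_iff_right (a := 1 / 2) (by norm_num)).mp (h2.trans_le hone)

lemma cost_amls_le (hL : IsSpecList L) (hβ : 1 ≤ β) {N : ℕ} {B : ℝ}
    (hmin : ∀ n ≤ N, ∀ k : ℕ, β * k ≤ n → MinObjLE L β n k B) :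
    (amls L β).cost N ≤ ENNReal.ofReal ((15 + 550 * #L) * (N + 1) ^ 4 * B) := by
  have hB : 1 ≤ B := (hmin N le_rfl 0 (by simp)).one_le hL hβ (by simp)
  refine iSup_le fun n => iSup_le fun hn => iSup_le fun F => iSup_le fun hF => iSup_le fun O =>
    iSup_le fun hO => iInf_le_of_le 0 (iSup₂_le fun o ho => ?_)
  obtain ⟨s, rfl, hs⟩ := runs_amls hL hF hβ hO hB (hmin n hn) o ho
  refine ENNReal.ofReal_le_ofReal (hs.2.trans ?_)
  gcongr

lemma Algorithm.cost_mono (A : Algorithm L) {n N : ℕ} (h : n ≤ N) : A.cost n ≤ A.cost N :=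
  iSup_le fun m => iSup_le fun hm => le_iSup_of_le m (le_iSup_of_le (hm.trans h) le_rfl)

lemma exists_isApprox_hasCostBase (hL : IsSpecList L) (hβ : 1 ≤ β) :
    {d : ℝ | 1 ≤ d ∧ ∃ A : Algorithm L, A.IsApprox β ∧ A.HasCostBase d}.Nonempty := by
  have hc := one_le_sum_snd hL
  refine ⟨2 * ∑ j ∈ L, j.2, by linarith, amls L β, isApprox_amls hL hβ, 15 + 550 * #L,
    fun n => ?_⟩
  refine (cost_amls_le hL hβ (B := (2 * ∑ j ∈ L, j.2) ^ n) fun n' hn' k hk =>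
    (minObjLE_pow hL hβ hk (le_sum_snd hL)).mono
      (pow_le_pow_right₀ (by linarith) hn')).trans (ENNReal.ofReal_le_ofReal ?_)
  push_cast
  gcongr ?_ * ?_ * ?_
  exact pow_le_pow_right₀ (by linarith [Nat.cast_nonneg (α := ℝ) n]) (by omega)

/-- The minimum of the objective bounds the cost of the algorithm from above and, up to a polynomial
that no competitor influences, `best L β ^ n` from below. -/
theorem hasCostBase_best_amls (hL : IsSpecList L) (hβ : 1 ≤ β) :
    (amls L β).HasCostBase (best L β) := by
  obtain ⟨S, hS⟩ := exists_slack L hL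
  have hc := one_le_sum_snd hL
  set c := ∑ j ∈ L, j.2 with hcdef
  have hne := exists_isApprox_hasCostBase hL hβ
  have hbest := one_le_best hne
  obtain ⟨M, hM⟩ := exists_nat_ge ((15 + 550 * #L) * (4 * c))
  refine ⟨M + (4 + 5 + 2 * (S + 1)), fun n => ?_⟩
  have hn : (1 : ℝ) ≤ n + 1 := by linarith [Nat.cast_nonneg (α := ℝ) n]
  have hmin : ∀ n' ≤ n, ∀ k : ℕ, β * k ≤ n' → MinObjLE L β n' k
      ((4 * (n + 1) ^ 5 * (n + 1) ^ (2 * (S + 1)) : ℕ) * c * best L β ^ n) := by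
    intro n' hn' k hk
    refine (minObjLE_of_forall hL hβ hk fun Φ hΦ h => le_mul_best_pow_of_le_obj hL hβ hS hk
      (le_sum_snd hL) (by linarith) hΦ h hne).mono ?_
    gcongr
  refine (cost_amls_le hL hβ hmin).trans (ENNReal.ofReal_le_ofReal ?_)
  have h0 : 0 ≤ best L β ^ n := by positivity
  calc _ = ((15 + 550 * #L) * (4 * c)) * (n + 1) ^ (4 + 5 + 2 * (S + 1)) * best L β ^ n := by
        push_cast; ring
    _ ≤ M * (n + 1) ^ (M + (4 + 5 + 2 * (S + 1))) * best L β ^ n := by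
        gcongr ?_ * ?_ * _
        exact pow_le_pow_right₀ hn (by omega)
    _ ≤ _ := by gcongr; simp

theorem exists_cost_amls_le (hL : IsSpecList L) (hβ : 1 ≤ β) {A : Algorithm L}
    (hA : A.IsApprox β) :
    ∃ C : ℕ, ∀ n : ℕ, (amls L β).cost n ≤ (C * (n + 1) ^ C : ℕ) * A.cost n := by
  obtain ⟨S, hS⟩ := exists_slack L hL
  have hc := one_le_sum_snd hL
  set c := ∑ j ∈ L, j.2 with hcdef
  obtain ⟨M, hM⟩ := exists_nat_ge ((15 + 550 * #L) * (8 * c))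
  set E := M + 1 + (4 + (2 * (S + 1) + 1)) with hE
  refine ⟨E, fun n => ?_⟩
  by_cases hT : A.cost n = ⊤
  · rw [hT, ENNReal.mul_top]
    · exact le_top
    · have : 0 < E * (n + 1) ^ E := by positivity
      exact_mod_cast this.ne'
  have hn : (1 : ℝ) ≤ n + 1 := by linarith [Nat.cast_nonneg (α := ℝ) n]
  have hmin : ∀ n' ≤ n, ∀ k : ℕ, β * k ≤ n' → MinObjLE L β n' k
      ((8 * (n + 1) ^ (2 * (S + 1) + 1) : ℕ) * c * (A.cost n).toReal) := by
    intro n' hn' k hk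
    -- The cost at `n` is a maximum over all smaller universes too, so the lower bound at `n'`
    -- carries over to `n`.
    have hle := A.cost_mono hn'
    refine (minObjLE_of_forall hL hβ hk fun Φ hΦ h => le_mul_cost_of_le_obj hL hβ hS hk
      (le_sum_snd hL) (by linarith) hΦ h hA (ne_top_of_le_ne_top hT hle)).mono ?_
    have := ENNReal.toReal_mono hT hle
    gcongr
  refine (cost_amls_le hL hβ hmin).trans ?_
  have e : ((E * (n + 1) ^ E : ℕ) : ℝ≥0∞) * A.cost n =
      ENNReal.ofReal ((E * (n + 1) ^ E : ℕ) * (A.cost n).toReal) := by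
    rw [ENNReal.ofReal_mul (Nat.cast_nonneg _), ENNReal.ofReal_natCast, ENNReal.ofReal_toReal hT]
  rw [e]
  refine ENNReal.ofReal_le_ofReal ?_
  have h0 : 0 ≤ (A.cost n).toReal := ENNReal.toReal_nonneg
  calc _ = ((15 + 550 * #L) * (8 * c)) * (n + 1) ^ (4 + (2 * (S + 1) + 1)) *
          (A.cost n).toReal := by push_cast; ring
    _ ≤ M * (n + 1) ^ E * (A.cost n).toReal := by
        gcongr ?_ * ?_ * _
        exact pow_le_pow_right₀ hn (by omega)
    _ ≤ _ := by
        push_cast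
        gcongr
        rw [hE]; omega

end

end SubsetMin

theorem theorem2p2 (L : Finset (ℝ × ℝ)) (hL : IsSpecList L) (β : ℝ) (hβ : 1 ≤ β) :
    (amls L β).IsApprox β ∧
    (amls L β).HasCostBase (best L β) ∧
    ∀ A : Algorithm L, A.IsApprox β →
      ∃ C : ℕ, ∀ n : ℕ, (amls L β).cost n ≤ (C * (n + 1) ^ C : ℕ) * A.cost n :=
  ⟨isApprox_amls hL hβ, hasCostBase_best_amls hL hβ, fun _ hA => exists_cost_amls_le hL hβ hA⟩
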